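/- Let $V$ be a finite-dimensional complex vector space and let $W$ be a finite group acting faithfully and irreducibly on $V$, generated by its reflections (elements whose fixed space is a hyperplane). Let $V^*$ be the dual space with the contragredient action and pairing $\langle\cdot,\cdot\rangle$. For a reflection hyperplane $H$ let $W_H$ be its pointwise stabilizer, $e_H=|W_H|$, let $\alpha_H\in V$ be a non-zero vector lying in the image of $1-s$ for all $s\in W_H\setminus\{1\}$, let $\alpha_H^\vee\in V^*$ have kernel $H$, and put $(x,y)_H=\langle x,\alpha_H^\vee\rangle\langle\alpha_H,y\rangle/\langle\alpha_H,\alpha_H^\vee\rangle$. Let $k=(k_{\Omega,j})$ be any family of complex numbers, indexed by the $W$-orbits $\Omega$ of reflection hyperplanes and by $j\in\mathbb{Z}/e_\Omega$, where $e_\Omega=e_H$ for $H\in\Omega$. Let $\mathrm H_{0,k}$ be the quotient of $\mathrm T(V\oplus V^*)\rtimes\mathbb{C}W$ by the relations $[x,x']=0=[y,y']$ and \[ [x,y]=\sum_{H}(x,y)_H\sum_{s\in W_H\setminus\{1\}}\Big(\sum_{j=0}^{e_H-1}\det(s)^j\,(k_{\Omega_H,j+1}-k_{\Omega_H,j})\Big)s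 \] for $x,x'\in V$ and $y,y'\in V^*$, where $H$ runs over the reflection hyperplanes and $\Omega_H$ is the orbit of $H$. Let $\overline{\mathrm H}_k$ be the restricted rational Cherednik algebra, that is, the quotient of $\mathrm H_{0,k}$ by the ideal generated by the images of all $W$-invariants with zero constant term in the symmetric algebras $\mathrm S(V)$ and $\mathrm S(V^*)$. For an irreducible character $\lambda$ of $W$ let $\mathrm M_k(\lambda)=\overline{\mathrm H}_k\otimes_{\mathrm S(V^*)\rtimes\mathbb{C}W}\lambda$ be the Verma module, where $V^*$ acts on $\lambda$ by zero, and let $\mathrm L_k(\lambda)$ be its (simple) head. The Calogero--Moser $k$-families are the sets of irreducible characters $\lambda$ of $W$ for which $\mathrm L_k(\lambda)$ lies in a given block of $\overline{\mathrm H}_k$. Then for every irreducible character $\lambda$ of $W$: if $\dim_{\mathbb C}\mathrm L_k(\lambda)<|W|$, then $\lambda$ lies in a Calogero--Moser $k$-family with at least two elements. -/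

import Mathlib

open scoped TensorProduct

noncomputable section

/-! ### Irreducible complex reflection groups -/

/-- `s` acts on `V` as a reflection: its fixed space is a hyperplane. -/
def IsReflection {W V : Type*} [Group W] [AddCommGroup V] [Module ℂ V]
    (ρ : Representation ℂ W V) (s : W) : Prop :=
  Module.finrank ℂ (LinearMap.ker (ρ s - 1)) + 1 = Module.finrank ℂ V

/-- An irreducible complex reflection group `Γ = (W, V)`: a faithful irreducible
representation of `W` on `V` such that `W` is generated by the elements acting as reflections.
Finiteness of `W` and finite-dimensionality of `V` are instance arguments below. -/
structure ReflectionGroup (W V : Type*) [Group W] [AddCommGroup V] [Module ℂ V] where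
  /-- The action of `W` on `V`. -/
  rep : Representation ℂ W V
  faithful : Function.Injective rep
  irreducible : rep.IsIrreducible
  generated : Subgroup.closure {s : W | IsReflection rep s} = ⊤

namespace ReflectionGroup

variable {W V : Type*} [Group W] [AddCommGroup V] [Module ℂ V]

section Hyperplanes

variable (Γ : ReflectionGroup W V)

/-- The set of reflection hyperplanes of `Γ`. -/
def Hyp : Type _ :=
  {H : Submodule ℂ V // ∃ s : W, IsReflection Γ.rep s ∧ H = LinearMap.ker (Γ.rep s - 1)}

theorem rep_mul_apply (g h : W) (v : V) : Γ.rep (g * h) v = Γ.rep g (Γ.rep h v) := by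
  rw [map_mul]; rfl

theorem rep_inv_apply (g : W) (v : V) : Γ.rep g⁻¹ (Γ.rep g v) = v := by
  rw [← rep_mul_apply, inv_mul_cancel, map_one]; rfl

theorem rep_apply_inv (g : W) (v : V) : Γ.rep g (Γ.rep g⁻¹ v) = v := by
  rw [← rep_mul_apply, mul_inv_cancel, map_one]; rfl

instance [Finite W] : Finite Γ.Hyp := by
  let f : {s : W // IsReflection Γ.rep s} → Γ.Hyp :=
    fun s => ⟨LinearMap.ker (Γ.rep s.1 - 1), s.1, s.2, rfl⟩
  refine Finite.of_surjective f ?_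
  rintro ⟨H, s, hs, rfl⟩
  exact ⟨⟨s, hs⟩, rfl⟩

/-- The pointwise stabilizer `W_H` of a reflection hyperplane `H`. -/
def stab (H : Γ.Hyp) : Subgroup W where
  carrier := {w | ∀ v ∈ H.1, Γ.rep w v = v}
  one_mem' := fun v _ => by rw [map_one]; rfl
  mul_mem' := fun {a b} ha hb v hv => by
    rw [rep_mul_apply, hb v hv, ha v hv]
  inv_mem' := fun {a} ha v hv => by
    have h := congrArg (Γ.rep a⁻¹) (ha v hv)
    rw [rep_inv_apply] at h
    exact h.symm

/-- Two reflection hyperplanes are equivalent if they lie in the same `W`-orbit. -/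
instance hypSetoid : Setoid Γ.Hyp where
  r H H' := ∃ w : W, H.1.map (Γ.rep w) = H'.1
  iseqv :=
    { refl := fun H => ⟨1, by rw [map_one]; exact Submodule.map_id _⟩
      symm := by
        rintro H H' ⟨w, hw⟩
        refine ⟨w⁻¹, ?_⟩
        rw [← hw, ← Submodule.map_comp]
        have : Γ.rep w⁻¹ ∘ₗ Γ.rep w = LinearMap.id := by
          ext v; exact Γ.rep_inv_apply w v
        rw [this, Submodule.map_id]
      trans := by
        rintro H H' H'' ⟨w, hw⟩ ⟨w', hw'⟩
        refine ⟨w' * w, ?_⟩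
        rw [← hw', ← hw, map_mul, ← Submodule.map_comp]
        rfl }

/-- The set `Hyp(Γ)/W` of orbits of reflection hyperplanes. -/
def HypOrbit : Type _ := Quotient Γ.hypSetoid

/-- The orbit of a reflection hyperplane. -/
def orbit (H : Γ.Hyp) : Γ.HypOrbit := Quotient.mk _ H

theorem card_stab_eq {H H' : Γ.Hyp} (h : H ≈ H') :
    Nat.card (Γ.stab H) = Nat.card (Γ.stab H') := by
  obtain ⟨w, hw⟩ := h
  have key : ∀ g : W, g ∈ Γ.stab H ↔ MulAut.conj w g ∈ Γ.stab H' := by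
    intro g
    change (∀ v ∈ H.1, Γ.rep g v = v) ↔ (∀ v ∈ H'.1, Γ.rep (w * g * w⁻¹) v = v)
    rw [← hw]
    constructor
    · rintro hg _ ⟨v, hv, rfl⟩
      rw [rep_mul_apply, rep_mul_apply, rep_inv_apply, hg v hv]
    · intro hg v hv
      have := hg (Γ.rep w v) ⟨v, hv, rfl⟩
      rw [rep_mul_apply, rep_mul_apply, rep_inv_apply] at this
      have h2 := congrArg (Γ.rep w⁻¹) this
      rwa [rep_inv_apply, rep_inv_apply] at h2
  exact Nat.card_congr ((MulAut.conj w).toEquiv.subtypeEquiv key)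

/-- The order `e_Ω` of the pointwise stabilizer of any hyperplane in the orbit `Ω`. -/
def e (Ω : Γ.HypOrbit) : ℕ :=
  Quotient.lift (fun H => Nat.card (Γ.stab H)) (fun _ _ h => Γ.card_stab_eq h) Ω

/-- Parameter families `k = (k_{Ω,j})`, indexed by the orbits `Ω` and by `j` modulo `e_Ω`. -/
abbrev Parameter : Type _ := (Ω : Γ.HypOrbit) → ZMod (Γ.e Ω) → ℂ

/-- `(α, α')` is a root-coroot pair for the hyperplane `H`: the line spanned by `α` is
`W_H`-stable, `α` is a root of every reflection in `W_H`, and `α'` is a functional with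
kernel `H`. -/
structure IsRootCorootPair (H : Γ.Hyp) (α : V) (α' : Module.Dual ℂ V) : Prop where
  ne_zero : α ≠ 0
  stable : ∀ w ∈ Γ.stab H, Γ.rep w α ∈ Submodule.span ℂ {α}
  root : ∀ s ∈ Γ.stab H, s ≠ 1 → α ∈ LinearMap.range (1 - Γ.rep s)
  coroot : LinearMap.ker α' = H.1

theorem exists_rootCorootPair [Finite W] [FiniteDimensional ℂ V] (H : Γ.Hyp) :
    ∃ p : V × Module.Dual ℂ V, Γ.IsRootCorootPair H p.1 p.2 := by
  obtain ⟨H, s, hs, rfl⟩ := H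
  set H : Γ.Hyp := ⟨LinearMap.ker (Γ.rep s - 1), s, hs, rfl⟩ with hH
  have hfix : ∀ v : V, v ∈ H.1 ↔ Γ.rep s v = v := fun v => by
    change v ∈ LinearMap.ker (Γ.rep s - 1) ↔ _
    rw [LinearMap.mem_ker, LinearMap.sub_apply, sub_eq_zero]; rfl
  have hrank : Module.finrank ℂ H.1 + 1 = Module.finrank ℂ V := hs
  have hsH : s ∈ Γ.stab H := fun v hv => (hfix v).1 hv
  -- the averaging projection onto `H`
  have : Fintype (Γ.stab H) := Fintype.ofFinite _
  have : Invertible (Fintype.card (Γ.stab H) : ℂ) :=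
    invertibleOfNonzero (by exact_mod_cast Fintype.card_ne_zero)
  let τ : Representation ℂ (Γ.stab H) V := Γ.rep.comp (Γ.stab H).subtype
  have hinv : τ.invariants = H.1 := by
    ext v
    rw [Representation.mem_invariants]
    exact ⟨fun h => (hfix v).2 (h ⟨s, hsH⟩), fun h g => g.2 v h⟩
  have hc : IsCompl H.1 (LinearMap.ker τ.averageMap) := by
    rw [← hinv]; exact τ.isProj_averageMap.isCompl
  have hk1 : Module.finrank ℂ (LinearMap.ker τ.averageMap) = 1 := by
    have := Submodule.finrank_add_eq_of_isCompl hc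
    omega
  obtain ⟨⟨α, hα⟩, hα0, hspan⟩ := finrank_eq_one_iff'.1 hk1
  have hα0' : α ≠ 0 := fun h => hα0 (Subtype.ext h)
  have hstab : ∀ w ∈ Γ.stab H, Γ.rep w α ∈ Submodule.span ℂ {α} := by
    intro w hw
    have hmem : Γ.rep w α ∈ LinearMap.ker τ.averageMap := by
      rw [LinearMap.mem_ker] at hα ⊢
      have h := DFunLike.congr_fun (congrArg τ.asAlgebraHom
        (GroupAlgebra.mul_average_right ℂ (Γ.stab H) ⟨w, hw⟩)) α
      rw [map_mul, Representation.asAlgebraHom_single_one] at h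
      exact h.trans hα
    obtain ⟨c, hc⟩ := hspan ⟨_, hmem⟩
    exact Submodule.mem_span_singleton.2 ⟨c, congrArg Subtype.val hc⟩
  have hαH : α ∉ H.1 := fun h => hα0' (by
    have := (Submodule.disjoint_def.1 hc.disjoint) α h hα
    exact this)
  have hroot : ∀ w ∈ Γ.stab H, w ≠ 1 → α ∈ LinearMap.range (1 - Γ.rep w) := by
    intro w hw hw1
    obtain ⟨c, hcα⟩ := Submodule.mem_span_singleton.1 (hstab w hw)
    have hc1 : c ≠ 1 := by
      rintro rfl
      apply hw1
      apply Γ.faithful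
      rw [map_one]
      ext v
      obtain ⟨a, ha, b, hb, rfl⟩ : ∃ a ∈ H.1, ∃ b ∈ LinearMap.ker τ.averageMap, a + b = v :=
        Submodule.mem_sup.1 (by rw [hc.sup_eq_top]; trivial)
      obtain ⟨d, hd⟩ := hspan ⟨b, hb⟩
      have hd' : d • α = b := congrArg Subtype.val hd
      rw [one_smul] at hcα
      rw [map_add, hw a ha, ← hd', map_smul, ← hcα]
      rfl
    have h1c : (1 - c) ≠ 0 := sub_ne_zero.2 hc1.symm
    refine ⟨(1 - c)⁻¹ • α, ?_⟩
    rw [map_smul, LinearMap.sub_apply, ← hcα, Module.End.one_apply]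
    rw [show α - c • α = (1 - c) • α by rw [sub_smul, one_smul], smul_smul,
      inv_mul_cancel₀ h1c, one_smul]
  obtain ⟨φ, hφ1, hφ2⟩ := Submodule.exists_dual_map_eq_bot_of_notMem hαH inferInstance
  refine ⟨(α, φ), hα0', hstab, hroot, ?_⟩
  have hle : H.1 ≤ LinearMap.ker φ := fun v hv => by
    have : φ v ∈ H.1.map φ := ⟨v, hv, rfl⟩
    rw [hφ2] at this
    exact this
  symm
  refine Submodule.eq_of_le_of_finrank_le hle ?_
  have hlt : Module.finrank ℂ (LinearMap.ker φ) < Module.finrank ℂ V :=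
    Submodule.finrank_lt (fun h => hφ1 (by
      have : α ∈ LinearMap.ker φ := by rw [h]; trivial
      exact this))
  change Module.finrank ℂ (LinearMap.ker φ) ≤ _
  omega

/-- A chosen root `α_H`. -/
def root [Finite W] [FiniteDimensional ℂ V] (H : Γ.Hyp) : V :=
  (Γ.exists_rootCorootPair H).choose.1

/-- A chosen coroot `α_H^∨`. -/
def coroot [Finite W] [FiniteDimensional ℂ V] (H : Γ.Hyp) : Module.Dual ℂ V :=
  (Γ.exists_rootCorootPair H).choose.2

theorem isRootCorootPair [Finite W] [FiniteDimensional ℂ V] (H : Γ.Hyp) :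
    Γ.IsRootCorootPair H (Γ.root H) (Γ.coroot H) :=
  (Γ.exists_rootCorootPair H).choose_spec

/-- The pairing `(x, y)_H = ⟨x, α_H^∨⟩ ⟨α_H, y⟩ / ⟨α_H, α_H^∨⟩`. -/
def hypPairing [Finite W] [FiniteDimensional ℂ V] (H : Γ.Hyp) (x : V) (y : Module.Dual ℂ V) : ℂ :=
  Γ.coroot H x * y (Γ.root H) / Γ.coroot H (Γ.root H)

/-- The coefficient `∑_{j=0}^{e_H-1} det(s)^j (k_{Ω_H,j+1} - k_{Ω_H,j})`, for `s ∈ W_H`. -/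
def coeff (k : Γ.Parameter) (H : Γ.Hyp) (s : W) : ℂ :=
  ∑ j ∈ Finset.range (Γ.e (Γ.orbit H)),
    LinearMap.det (Γ.rep s) ^ j * (k (Γ.orbit H) ((j + 1 : ℕ)) - k (Γ.orbit H) (j : ℕ))

end Hyperplanes

/-! ### Rational Cherednik algebras -/

/-- Generators of the rational Cherednik algebra: the vectors of `V` and `V^*` and the elements
of `W`. -/
inductive Gen (W V : Type*) [AddCommGroup V] [Module ℂ V]
  | vec (x : V) : Gen W V
  | cov (y : Module.Dual ℂ V) : Gen W V
  | grp (w : W) : Gen W V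

/-- The defining relations of the rational Cherednik algebra `H_{t,k}`. The relations
up to `grp_cov` present `T(V ⊕ V^*) ⋊ ℂ W`; the last three are the commutator relations. -/
inductive Rel [Finite W] [FiniteDimensional ℂ V] (Γ : ReflectionGroup W V) (t : ℂ)
    (k : Γ.Parameter) : FreeAlgebra ℂ (Gen W V) → FreeAlgebra ℂ (Gen W V) → Prop
  | vec_add (x x' : V) : Rel Γ t k (.ι ℂ (.vec (x + x'))) (.ι ℂ (.vec x) + .ι ℂ (.vec x'))
  | vec_smul (c : ℂ) (x : V) : Rel Γ t k (.ι ℂ (.vec (c • x))) (c • .ι ℂ (.vec x))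
  | cov_add (y y' : Module.Dual ℂ V) :
      Rel Γ t k (.ι ℂ (.cov (y + y'))) (.ι ℂ (.cov y) + .ι ℂ (.cov y'))
  | cov_smul (c : ℂ) (y : Module.Dual ℂ V) : Rel Γ t k (.ι ℂ (.cov (c • y))) (c • .ι ℂ (.cov y))
  | grp_one : Rel Γ t k (.ι ℂ (.grp 1)) 1
  | grp_mul (g h : W) : Rel Γ t k (.ι ℂ (.grp (g * h))) (.ι ℂ (.grp g) * .ι ℂ (.grp h))
  | grp_vec (g : W) (x : V) :
      Rel Γ t k (.ι ℂ (.grp g) * .ι ℂ (.vec x)) (.ι ℂ (.vec (Γ.rep g x)) * .ι ℂ (.grp g))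
  | grp_cov (g : W) (y : Module.Dual ℂ V) :
      Rel Γ t k (.ι ℂ (.grp g) * .ι ℂ (.cov y)) (.ι ℂ (.cov (Γ.rep.dual g y)) * .ι ℂ (.grp g))
  | vec_vec (x x' : V) :
      Rel Γ t k (.ι ℂ (.vec x) * .ι ℂ (.vec x')) (.ι ℂ (.vec x') * .ι ℂ (.vec x))
  | cov_cov (y y' : Module.Dual ℂ V) :
      Rel Γ t k (.ι ℂ (.cov y) * .ι ℂ (.cov y')) (.ι ℂ (.cov y') * .ι ℂ (.cov y))
  | vec_cov (x : V) (y : Module.Dual ℂ V) :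
      Rel Γ t k (.ι ℂ (.vec x) * .ι ℂ (.cov y) - .ι ℂ (.cov y) * .ι ℂ (.vec x))
        (algebraMap ℂ _ (t * y x) +
          ∑ᶠ H : Γ.Hyp, Γ.hypPairing H x y •
            ∑ᶠ s : {s : Γ.stab H // s ≠ 1}, Γ.coeff k H s.1 • .ι ℂ (.grp (s.1 : W)))

section Algebras

variable [Finite W] [FiniteDimensional ℂ V] (Γ : ReflectionGroup W V)

/-- The rational Cherednik algebra `H_{t,k}(Γ)`. -/
def Cherednik (t : ℂ) (k : Γ.Parameter) : Type _ := RingQuot (Rel Γ t k)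

instance (t : ℂ) (k : Γ.Parameter) : Ring (Γ.Cherednik t k) :=
  inferInstanceAs (Ring (RingQuot (Rel Γ t k)))

instance (t : ℂ) (k : Γ.Parameter) : Algebra ℂ (Γ.Cherednik t k) :=
  inferInstanceAs (Algebra ℂ (RingQuot (Rel Γ t k)))

/-- The quotient map onto the rational Cherednik algebra. -/
def toCherednik (t : ℂ) (k : Γ.Parameter) :
    FreeAlgebra ℂ (Gen W V) →ₐ[ℂ] Γ.Cherednik t k :=
  RingQuot.mkAlgHom ℂ (Rel Γ t k)

variable {Γ} in
theorem toCherednik_rel {t : ℂ} {k : Γ.Parameter} {a b : FreeAlgebra ℂ (Gen W V)}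
    (h : Rel Γ t k a b) : Γ.toCherednik t k a = Γ.toCherednik t k b :=
  RingQuot.mkAlgHom_rel ℂ h

/-- The canonical map `V → H_{t,k}`. -/
def vec (t : ℂ) (k : Γ.Parameter) : V →ₗ[ℂ] Γ.Cherednik t k where
  toFun x := Γ.toCherednik t k (.ι ℂ (.vec x))
  map_add' x x' := by rw [toCherednik_rel (Rel.vec_add x x'), map_add]
  map_smul' c x := by rw [toCherednik_rel (Rel.vec_smul c x), map_smul, RingHom.id_apply]

/-- The canonical map `V^* → H_{t,k}`. -/
def cov (t : ℂ) (k : Γ.Parameter) : Module.Dual ℂ V →ₗ[ℂ] Γ.Cherednik t k where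
  toFun y := Γ.toCherednik t k (.ι ℂ (.cov y))
  map_add' y y' := by rw [toCherednik_rel (Rel.cov_add y y'), map_add]
  map_smul' c y := by rw [toCherednik_rel (Rel.cov_smul c y), map_smul, RingHom.id_apply]

/-- The canonical map `W → H_{t,k}`. -/
def grp (t : ℂ) (k : Γ.Parameter) : W →* Γ.Cherednik t k where
  toFun g := Γ.toCherednik t k (.ι ℂ (.grp g))
  map_one' := by rw [toCherednik_rel Rel.grp_one, map_one]
  map_mul' g h := by rw [toCherednik_rel (Rel.grp_mul g h), map_mul]

theorem vec_commute (t : ℂ) (k : Γ.Parameter) (x x' : V) :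
    Commute (Γ.vec t k x) (Γ.vec t k x') := by
  have h := toCherednik_rel (Rel.vec_vec (Γ := Γ) (t := t) (k := k) x x')
  rwa [map_mul, map_mul] at h

theorem cov_commute (t : ℂ) (k : Γ.Parameter) (y y' : Module.Dual ℂ V) :
    Commute (Γ.cov t k y) (Γ.cov t k y') := by
  have h := toCherednik_rel (Rel.cov_cov (Γ := Γ) (t := t) (k := k) y y')
  rwa [map_mul, map_mul] at h

end Algebras

end ReflectionGroup

/-! ### Symmetric algebras and their invariants -/

/-- A linear map with pairwise commuting values in a possibly noncommutative algebra extends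
to the symmetric algebra. -/
def symLift {M A : Type*} [AddCommGroup M] [Module ℂ M] [Ring A] [Algebra ℂ A]
    (f : M →ₗ[ℂ] A) (hf : ∀ x y, Commute (f x) (f y)) : SymmetricAlgebra ℂ M →ₐ[ℂ] A :=
  RingCon.liftₐ (TensorAlgebra.symRingCon ℂ M) (TensorAlgebra.lift ℂ f) (by
    refine fun x y h => RingCon.ringConGen_le.2 (fun x y h' => ?_) h
    induction h' with | mul_comm x y
    rw [RingCon.ker_apply]
    simpa using (hf x y).eq)

theorem symLift_ι {M A : Type*} [AddCommGroup M] [Module ℂ M] [Ring A] [Algebra ℂ A]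
    (f : M →ₗ[ℂ] A) (hf : ∀ x y, Commute (f x) (f y)) (x : M) :
    symLift f hf (SymmetricAlgebra.ι ℂ M x) = f x := by
  change TensorAlgebra.lift ℂ f (TensorAlgebra.ι ℂ x) = f x
  exact TensorAlgebra.lift_ι_apply f x

/-- The action of a group element on the symmetric algebra by algebra automorphisms. -/
def symAct {W M : Type*} [Group W] [AddCommGroup M] [Module ℂ M] (ρ : Representation ℂ W M)
    (w : W) : SymmetricAlgebra ℂ M →ₐ[ℂ] SymmetricAlgebra ℂ M :=
  SymmetricAlgebra.lift (SymmetricAlgebra.ι ℂ M ∘ₗ ρ w)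

/-- `S(M)^W_+`: the `W`-invariants in the symmetric algebra with zero constant term. -/
def posInvariants {W M : Type*} [Group W] [AddCommGroup M] [Module ℂ M]
    (ρ : Representation ℂ W M) : Set (SymmetricAlgebra ℂ M) :=
  {f | (∀ w, symAct ρ w f = f) ∧ SymmetricAlgebra.algebraMapInv f = 0}

namespace ReflectionGroup

variable {W V : Type*} [Group W] [Finite W] [AddCommGroup V] [Module ℂ V] [FiniteDimensional ℂ V]
  (Γ : ReflectionGroup W V)

/-! ### Restricted rational Cherednik algebras -/

/-- The canonical map `S(V) → H_{0,k}`. -/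
def symVec (k : Γ.Parameter) : SymmetricAlgebra ℂ V →ₐ[ℂ] Γ.Cherednik 0 k :=
  symLift (Γ.vec 0 k) (Γ.vec_commute 0 k)

/-- The canonical map `S(V^*) → H_{0,k}`. -/
def symCov (k : Γ.Parameter) : SymmetricAlgebra ℂ (Module.Dual ℂ V) →ₐ[ℂ] Γ.Cherednik 0 k :=
  symLift (Γ.cov 0 k) (Γ.cov_commute 0 k)

/-- The ideal of `H_{0,k}` generated by `(S(V)^W ⊗ S(V^*)^W)_+`, as a relation: the images of
`S(V)^W_+` and of `S(V^*)^W_+` are set to zero. -/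
inductive RestrictedRel (k : Γ.Parameter) : Γ.Cherednik 0 k → Γ.Cherednik 0 k → Prop
  | vec (f : SymmetricAlgebra ℂ V) (hf : f ∈ posInvariants Γ.rep) :
      RestrictedRel k (Γ.symVec k f) 0
  | cov (f : SymmetricAlgebra ℂ (Module.Dual ℂ V)) (hf : f ∈ posInvariants Γ.rep.dual) :
      RestrictedRel k (Γ.symCov k f) 0

/-- The restricted rational Cherednik algebra. -/
def Restricted (k : Γ.Parameter) : Type _ := RingQuot (Γ.RestrictedRel k)

instance (k : Γ.Parameter) : Ring (Γ.Restricted k) :=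
  inferInstanceAs (Ring (RingQuot (Γ.RestrictedRel k)))

instance (k : Γ.Parameter) : Algebra ℂ (Γ.Restricted k) :=
  inferInstanceAs (Algebra ℂ (RingQuot (Γ.RestrictedRel k)))

/-- The quotient map from `H_{0,k}` to the restricted rational Cherednik algebra. -/
def toRestricted (k : Γ.Parameter) : Γ.Cherednik 0 k →ₐ[ℂ] Γ.Restricted k :=
  RingQuot.mkAlgHom ℂ (Γ.RestrictedRel k)

/-! ### Verma modules and their heads -/

section Verma

variable (k : Γ.Parameter) {U : Type*} [AddCommGroup U] [Module ℂ U] (σ : Representation ℂ W U)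

/-- The submodule of relations of the Verma module: `h w ⊗ u - h ⊗ w u` for `w ∈ W` and
`h y ⊗ u` for `y ∈ V^*`. -/
def vermaRel : Submodule (Γ.Restricted k) (Γ.Restricted k ⊗[ℂ] U) :=
  Submodule.span (Γ.Restricted k)
    ({z | ∃ (h : Γ.Restricted k) (w : W) (u : U),
        z = (h * Γ.toRestricted k (Γ.grp 0 k w)) ⊗ₜ[ℂ] u - h ⊗ₜ[ℂ] σ w u} ∪
      {z | ∃ (h : Γ.Restricted k) (y : Module.Dual ℂ V) (u : U),
        z = (h * Γ.toRestricted k (Γ.cov 0 k y)) ⊗ₜ[ℂ] u})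

/-- The Verma module `M_k(σ)`: the tensor product of the restricted rational Cherednik algebra
with `σ` over the subalgebra generated by `V^*` and `W`, where `V^*` acts on `σ` by zero. -/
abbrev Verma : Type _ := (Γ.Restricted k ⊗[ℂ] U) ⧸ Γ.vermaRel k σ

/-- The head `L_k(σ)` of the Verma module, i.e. its quotient by the intersection of its maximal
submodules. -/
abbrev VermaHead : Type _ :=
  Γ.Verma k σ ⧸ Module.jacobson (Γ.Restricted k) (Γ.Verma k σ)

end Verma

end ReflectionGroup

/-! ### Irreducible characters and blocks -/

/-- The set `Irr(ℂ W)` of irreducible complex characters of `W`. -/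
def IrrChar (W : Type*) [Group W] : Type _ :=
  {χ : W → ℂ // ∃ (n : ℕ) (σ : Representation ℂ W (Fin n → ℂ)),
    σ.IsIrreducible ∧ σ.character = χ}

namespace IrrChar

variable {W : Type*} [Group W] (χ : IrrChar W)

/-- The degree of an irreducible character. -/
def degree : ℕ := χ.2.choose

/-- A chosen irreducible representation affording the character. -/
def rep : Representation ℂ W (Fin χ.degree → ℂ) := χ.2.choose_spec.choose

theorem rep_irreducible : χ.rep.IsIrreducible := χ.2.choose_spec.choose_spec.1

theorem rep_character : χ.rep.character = χ.1 := χ.2.choose_spec.choose_spec.2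

end IrrChar

/-- A block idempotent: a primitive idempotent of the center. -/
structure IsBlockIdempotent {A : Type*} [Ring A] (b : A) : Prop where
  central : b ∈ Subring.center A
  idem : IsIdempotentElem b
  ne_zero : b ≠ 0
  primitive : ∀ c ∈ Subring.center A, IsIdempotentElem c → b * c = c → c = 0 ∨ c = b

namespace ReflectionGroup

variable {W V : Type*} [Group W] [Finite W] [AddCommGroup V] [Module ℂ V] [FiniteDimensional ℂ V]
  (Γ : ReflectionGroup W V) (k : Γ.Parameter)

/-- The simple module `L_k(χ)`, the head of the Verma module `M_k(χ)`. -/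
abbrev L (χ : IrrChar W) : Type _ := Γ.VermaHead k χ.rep

/-- The set of irreducible characters `χ` for which `L_k(χ)` lies in the block of `b`. -/
def blockFamily (b : Γ.Restricted k) : Set (IrrChar W) :=
  {χ | ∀ m : Γ.L k χ, b • m = m}

/-- The set `CM_k` of Calogero-Moser `k`-families. -/
def CM : Set (Set (IrrChar W)) :=
  {F | ∃ b : Γ.Restricted k, IsBlockIdempotent b ∧ F = Γ.blockFamily k b}

end ReflectionGroup

end

/-! Let L be the head of the Verma module M of λ, and suppose that λ is alone in its block. The
block idempotent acts as the identity on L. Since M has a largest proper submodule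
(`exists_coatom_verma`), with quotient L, the idempotent acts as the identity on all of M. Hence
every composition factor of M lies in the block. Every simple module is the head of some Verma
module (`exists_equiv_L`), so each of these factors is isomorphic to L. Traces are additive along a
composition series (`exists_trace_eq_mul`), so tr_M = n · tr_L for some n ≥ 1. Elements w ≠ 1 of W
have trace zero on M (`trace_verma`), hence also on L (`trace_L_eq_zero`). A W-representation with
this property has dimension divisible by |W| (`card_dvd_finrank`). As L is non-zero, dim L ≥ |W|.

The vanishing of traces on M rests on two facts. First, M is S(V)^co ⊗ λ as a W-module
(`exists_coinv_equiv_verma`). Spanning is the usual reordering of products. For independence, H̄_k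
is made to act on S(V)^co ⊗ λ by Dunkl operators at t = 0 (`isCherednikTriple_dunkl`), which gives a
map back from M.

Second, w ≠ 1 has trace zero on the coinvariant algebra S(V)^co (`trace_coinv_eq_zero`). This is
proved without gradings and without freeness of S(V) over its invariants. Divided differences and
Chevalley's argument show that lifts of a basis of S(V)^co are independent over the invariants.
Nakayama's lemma shows that they span after multiplication by an invariant u with non-zero constant
term. The matrix of w in these lifts is then conjugate, over the fraction field, to a permutation
matrix without fixed points. -/

noncomputable section

set_option linter.unusedSectionVars false

/-! ### Divided differences and coinvariants -/

namespace Coinvariant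

variable {k W S : Type*} [Field k] [Group W] [CommRing S] [Algebra k S]
  [MulSemiringAction W S] [SMulCommClass W k S]

/-- The ideal generated by the invariants in the kernel of `ε`. -/
def hilbertIdeal (W : Type*) [Group W] [MulSemiringAction W S] (ε : S →ₐ[k] k) : Ideal S :=
  Ideal.span {f | (∀ w : W, w • f = f) ∧ ε f = 0}

theorem smul_mem_hilbertIdeal {ε : S →ₐ[k] k} (w : W) {f : S} (hf : f ∈ hilbertIdeal W ε) :
    w • f ∈ hilbertIdeal W ε := by
  induction hf using Submodule.span_induction with
  | mem f hf => rw [hf.1 w]; exact Ideal.subset_span hf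
  | zero => rw [smul_zero]; exact Ideal.zero_mem _
  | add f g _ _ hf hg => rw [smul_add]; exact Ideal.add_mem _ hf hg
  | smul c f _ hf => rw [smul_eq_mul, smul_mul']; exact Ideal.mul_mem_left _ _ hf

theorem sub_algebraMap_mem {ε : S →ₐ[k] k} {f : S} (hf : ∀ w : W, w • f = f) :
    f - algebraMap k S (ε f) ∈ hilbertIdeal W ε := by
  refine Ideal.subset_span ⟨fun w => ?_, ?_⟩
  · rw [smul_sub, hf, smul_algebraMap]
  · rw [map_sub, AlgHom.commutes]; exact sub_self _

/-- `δ` is a divided difference operator with denominator `α` for the group element `s`,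
lowering the filtration `F`. -/
structure IsDividedDifference (F : ℕ → Submodule k S) (s : W) (α : S) (δ : S →ₗ[k] S) : Prop where
  ne_zero : α ≠ 0
  sub_smul_eq : ∀ f, f - s • f = δ f * α
  map_zero : ∀ f ∈ F 0, δ f = 0
  map_succ : ∀ d, ∀ f ∈ F (d + 1), δ f ∈ F d

namespace IsDividedDifference

variable [IsDomain S] {F : ℕ → Submodule k S} {s : W} {α : S} {δ : S →ₗ[k] S}

/-- After multiplication by α both sides are f · (g - s • g), and α can be cancelled in a domain. -/
theorem invariant_mul (h : IsDividedDifference F s α δ) {f : S} (hf : s • f = f) (g : S) :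
    δ (f * g) = f * δ g := by
  refine mul_right_cancel₀ h.ne_zero ?_
  rw [← h.sub_smul_eq, smul_mul', hf, mul_assoc, ← h.sub_smul_eq, mul_sub]

end IsDividedDifference

/-! ### Independence over the invariants, by Chevalley's argument -/

section Chevalley

variable [IsDomain S] [Fintype W] [CharZero k] {ε : S →ₐ[k] k}

theorem sum_smul_invariant (p : S) (v : W) : v • ∑ w : W, w • p = ∑ w : W, w • p := by
  rw [Finset.smul_sum]
  simp_rw [smul_smul]
  exact Fintype.sum_equiv (Equiv.mulLeft v) _ _ fun _ => rfl

/-- Chevalley's lemma. -/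
theorem mem_hilbertIdeal_of_sum_eq_zero {F : ℕ → Submodule k S}
    (hgen : Subgroup.closure {s : W | ∃ α δ, IsDividedDifference F s α δ} = ⊤)
    {n : ℕ} (f₀ : S) (f : Fin n → S)
    (hf₀ : ∀ w : W, w • f₀ = f₀) (hf : ∀ i, ∀ w : W, w • f i = f i)
    (hind : ∀ u : S, (∀ w : W, w • u = u) → ε u ≠ 0 → ∀ g : Fin n → S,
      (∀ i, ∀ w : W, w • g i = g i) → u * f₀ ≠ ∑ i, f i * g i)
    (d : ℕ) (p₀ : S) (p : Fin n → S) (hp₀ : p₀ ∈ F d) (hsum : f₀ * p₀ + ∑ i, f i * p i = 0) :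
    p₀ ∈ hilbertIdeal W ε := by
  induction d using Nat.strong_induction_on generalizing p₀ p with
  | _ d ih =>
  have hcard : (Fintype.card W : k) ≠ 0 := by exact_mod_cast Fintype.card_ne_zero
  -- A divided difference is linear over the invariants, so applying it to the relation gives a
  -- relation of the same shape with δ p₀ of lower degree. By induction δ p₀, hence p₀ - s • p₀, is
  -- in the ideal. This passes from generators to all of W because the ideal is W-stable.
  have hrefl : ∀ w : W, p₀ - w • p₀ ∈ hilbertIdeal W ε := by
    intro w
    have hw : w ∈ Subgroup.closure {s : W | ∃ α δ, IsDividedDifference F s α δ} := by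
      rw [hgen]; trivial
    induction hw using Subgroup.closure_induction with
    | mem s hs =>
      obtain ⟨α, δ, h⟩ := hs
      rw [h.sub_smul_eq]
      refine Ideal.mul_mem_right _ _ ?_
      cases d with
      | zero => rw [h.map_zero _ hp₀]; exact Ideal.zero_mem _
      | succ d =>
        refine ih d (Nat.lt_succ_self d) (δ p₀) (fun i => δ (p i)) (h.map_succ d _ hp₀) ?_
        have := congrArg δ hsum
        rw [map_add, map_sum, map_zero, h.invariant_mul (hf₀ s)] at this
        rw [← this]
        congr 1
        exact Finset.sum_congr rfl fun i _ => (h.invariant_mul (hf i s) _).symm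
    | one => rw [one_smul, sub_self]; exact Ideal.zero_mem _
    | mul a b _ _ ha hb =>
      have := Ideal.add_mem _ ha (smul_mem_hilbertIdeal a hb)
      rwa [smul_sub, smul_smul, sub_add_sub_cancel] at this
    | inv a _ ha =>
      have := smul_mem_hilbertIdeal a⁻¹ ha
      rw [smul_sub, smul_smul, inv_mul_cancel, one_smul] at this
      rw [← neg_sub]
      exact neg_mem this
  set q := ∑ w : W, w • p₀ with hq
  have hqinv : ∀ w : W, w • q = q := sum_smul_invariant p₀
  have h1 : (Fintype.card W : S) * p₀ - q ∈ hilbertIdeal W ε := by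
    have : (Fintype.card W : S) * p₀ - q = ∑ w : W, (p₀ - w • p₀) := by
      rw [Finset.sum_sub_distrib, Finset.sum_const, nsmul_eq_mul, Finset.card_univ]
    rw [this]
    exact Ideal.sum_mem _ fun w _ => hrefl w
  -- Summing the relation over W expresses q * f₀ through the other f i with invariant coefficients.
  -- If ε q were non-zero, this would contradict `hind` with u = q.
  have hεq : ε q = 0 := by
    by_contra hne
    refine hind q hqinv hne (fun i => -∑ w : W, w • p i) (fun i w => ?_) ?_
    · rw [smul_neg, sum_smul_invariant]
    · have : ∑ w : W, w • (f₀ * p₀ + ∑ i, f i * p i) = 0 := by simp [hsum]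
      simp only [smul_add, smul_mul', hf₀, Finset.smul_sum, hf, Finset.sum_add_distrib] at this
      rw [← Finset.mul_sum, Finset.sum_comm] at this
      simp only [← Finset.mul_sum] at this
      simp only [mul_neg, Finset.sum_neg_distrib]
      rw [eq_neg_iff_add_eq_zero, mul_comm q]
      exact this
  have h2 : q ∈ hilbertIdeal W ε := Ideal.subset_span ⟨hqinv, hεq⟩
  have h3 := Ideal.add_mem _ h1 h2
  rw [sub_add_cancel] at h3
  have h4 := Ideal.mul_mem_left _ (algebraMap k S (Fintype.card W : k)⁻¹) h3
  rwa [← mul_assoc, ← map_natCast (algebraMap k S), ← map_mul, inv_mul_cancel₀ hcard, map_one,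
    one_mul] at h4

/-- Elements that are linearly independent modulo the Hilbert ideal are linearly independent over
the invariants. -/
theorem eq_zero_of_sum_mul_eq_zero {F : ℕ → Submodule k S} (hF : ∀ f, ∃ d, f ∈ F d)
    (hgen : Subgroup.closure {s : W | ∃ α δ, IsDividedDifference F s α δ} = ⊤)
    {n : ℕ} (f h : Fin n → S)
    (hf : ∀ i, ∀ w : W, w • f i = f i)
    (hh : LinearIndependent k fun i => Ideal.Quotient.mk (hilbertIdeal W ε) (h i))
    (hsum : ∑ i, f i * h i = 0) : f = 0 := by
  induction n with
  | zero => exact Subsingleton.elim _ _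
  | succ n ih =>
    have hh0 : h 0 ∉ hilbertIdeal W ε := fun h0 =>
      hh.ne_zero 0 (Ideal.Quotient.eq_zero_iff_mem.2 h0)
    rw [Fin.sum_univ_succ] at hsum
    obtain ⟨d, hd⟩ := hF (h 0)
    -- Otherwise Chevalley's lemma would put h 0 into the Hilbert ideal. The factor u is a unit in
    -- the localisation of the invariants at the kernel of ε, and it replaces homogeneity.
    have key : ∃ u : S, (∀ w : W, w • u = u) ∧ ε u ≠ 0 ∧ ∃ g : Fin n → S,
        (∀ i, ∀ w : W, w • g i = g i) ∧ u * f 0 = ∑ i, f i.succ * g i := by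
      by_contra hcon
      push Not at hcon
      exact hh0 (mem_hilbertIdeal_of_sum_eq_zero hgen (f 0) (fun i => f i.succ) (hf 0)
        (fun i => hf _) hcon d (h 0) (fun i => h i.succ) hd hsum)
    obtain ⟨u, hu, hεu, g, hg, hug⟩ := key
    have hz : (fun i : Fin n => f i.succ) = 0 := by
      -- Multiplying the relation by u and eliminating f 0 leaves a shorter relation. Modulo the
      -- ideal, u and g i act as the scalars ε u ≠ 0 and ε (g i), so the new elements are still
      -- independent there.
      refine ih (fun i => f i.succ) (fun i => u * h i.succ + g i * h 0) (fun i => hf _) ?_ ?_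
      · have hmod : ∀ {a : S}, (∀ w : W, w • a = a) → ∀ b : S,
            Ideal.Quotient.mk (hilbertIdeal W ε) (a * b) =
              ε a • Ideal.Quotient.mk (hilbertIdeal W ε) b := by
          intro a ha b
          rw [Algebra.smul_def, ← Ideal.Quotient.mk_algebraMap, ← map_mul,
            Ideal.Quotient.eq, ← sub_mul]
          exact Ideal.mul_mem_right _ _ (sub_algebraMap_mem ha)
        rw [Fintype.linearIndependent_iff] at hh ⊢
        intro c hc i
        have := hh (Fin.cons (∑ i, c i * ε (g i)) fun i => c i * ε u) (by
          rw [Fin.sum_univ_succ]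
          simp only [Fin.cons_zero, Fin.cons_succ]
          rw [← hc]
          simp only [map_add, hmod hu, hmod (hg _), smul_add, smul_smul, Finset.sum_add_distrib,
            Finset.sum_smul]
          rw [add_comm]) i.succ
        simp only [Fin.cons_succ, mul_eq_zero, hεu, or_false] at this
        exact this
      · have e1 : ∀ i : Fin n, f i.succ * (u * h i.succ + g i * h 0) =
            u * (f i.succ * h i.succ) + f i.succ * g i * h 0 := fun i => by ring
        simp only [e1, Finset.sum_add_distrib]
        rw [← Finset.mul_sum, ← Finset.sum_mul, ← hug]
        linear_combination u * hsum
    have hz' : ∀ i : Fin n, f i.succ = 0 := fun i => congrFun hz i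
    simp only [hz', zero_mul, Finset.sum_const_zero, add_zero] at hsum
    have hh0' : h 0 ≠ 0 := fun h0 => hh0 (by rw [h0]; exact Ideal.zero_mem _)
    funext i
    refine Fin.cases ?_ hz' i
    exact (mul_eq_zero.1 hsum).resolve_right hh0'

end Chevalley

end Coinvariant

/-! ### Traces on the coinvariant algebra -/

namespace Coinvariant

variable {k W S : Type*} [Field k] [Group W] [CommRing S] [Algebra k S]
  [MulSemiringAction W S] [SMulCommClass W k S] [Fintype W] {ε : S →ₐ[k] k}

theorem mk_invariant_mul {a : S} (ha : ∀ w : W, w • a = a) (b : S) :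
    Ideal.Quotient.mk (hilbertIdeal W ε) (a * b) =
      ε a • Ideal.Quotient.mk (hilbertIdeal W ε) b := by
  rw [Algebra.smul_def, ← Ideal.Quotient.mk_algebraMap, ← map_mul, Ideal.Quotient.eq, ← sub_mul]
  exact Ideal.mul_mem_right _ _ (sub_algebraMap_mem ha)

instance : Algebra.IsInvariant (FixedPoints.subalgebra k S W) S W :=
  ⟨fun b hb => ⟨⟨b, hb⟩, rfl⟩⟩

/-- Each element is a root of its monic orbit polynomial, so S is integral over the invariants. An
integral algebra of finite type is a finite module. -/
theorem finite_over_invariants (k W S : Type*) [Field k] [Group W] [CommRing S] [Algebra k S]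
    [MulSemiringAction W S] [SMulCommClass W k S] [Fintype W] [Algebra.FiniteType k S] :
    Module.Finite (FixedPoints.subalgebra k S W) S := by
  have : Algebra.IsIntegral (FixedPoints.subalgebra k S W) S :=
    Algebra.IsInvariant.isIntegral (FixedPoints.subalgebra k S W) S W
  have : Algebra.FiniteType (FixedPoints.subalgebra k S W) S :=
    Algebra.FiniteType.of_restrictScalars_finiteType k _ _
  exact Algebra.IsIntegral.finite

theorem finite_quotient_hilbertIdeal [Algebra.FiniteType k S] :
    Module.Finite k (S ⧸ hilbertIdeal W ε) := by
  have := finite_over_invariants k W S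
  obtain ⟨n, s, hs⟩ := Module.Finite.exists_fin (R := FixedPoints.subalgebra k S W) (M := S)
  refine ⟨Submodule.fg_iff_exists_fin_generating_family.2
    ⟨n, fun i => Ideal.Quotient.mk (hilbertIdeal W ε) (s i), ?_⟩⟩
  rw [eq_top_iff]
  rintro x -
  obtain ⟨f, rfl⟩ := Ideal.Quotient.mk_surjective x
  have hf : f ∈ Submodule.span (FixedPoints.subalgebra k S W) (Set.range s) := by
    rw [hs]; trivial
  obtain ⟨c, rfl⟩ := (Submodule.mem_span_range_iff_exists_fun _).1 hf
  rw [map_sum]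
  refine Submodule.sum_mem _ fun i _ => ?_
  have : c i • s i = (c i : S) * s i := rfl
  rw [this, mk_invariant_mul (c i).2]
  exact Submodule.smul_mem _ _ (Submodule.subset_span ⟨i, rfl⟩)

/-- Nakayama's lemma for the finite module S / N over the invariants, where N is the span of the h i
and m is the kernel of ε. The hypothesis says S = N + mS, so some u ≡ 1 modulo m maps S into N. -/
theorem exists_mul_mem_span [Algebra.FiniteType k S] {n : ℕ} (h : Fin n → S)
    (hspan : ∀ x : S ⧸ hilbertIdeal W ε, ∃ c : Fin n → k,
      x = ∑ i, c i • Ideal.Quotient.mk (hilbertIdeal W ε) (h i)) :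
    ∃ u : FixedPoints.subalgebra k S W, ε u ≠ 0 ∧
      ∀ f : S, ∃ c : Fin n → FixedPoints.subalgebra k S W, u * f = ∑ i, h i * c i := by
  have := finite_over_invariants k W S
  let m : Ideal (FixedPoints.subalgebra k S W) :=
    RingHom.ker (ε.comp (FixedPoints.subalgebra k S W).val)
  let N : Submodule (FixedPoints.subalgebra k S W) S := Submodule.span _ (Set.range h)
  have hI : hilbertIdeal W ε ≤ m.map (algebraMap _ S) := by
    refine Ideal.span_le.2 fun f hf => ?_
    exact Ideal.mem_map_of_mem (algebraMap (FixedPoints.subalgebra k S W) S)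
      (show (⟨f, hf.1⟩ : FixedPoints.subalgebra k S W) ∈ m from hf.2)
  have hle : (⊤ : Submodule (FixedPoints.subalgebra k S W) (S ⧸ N)) ≤ m • ⊤ := by
    rintro x -
    obtain ⟨f, rfl⟩ := N.mkQ_surjective x
    obtain ⟨c, hc⟩ := hspan (Ideal.Quotient.mk _ f)
    have h1 : f - ∑ i, c i • h i ∈ hilbertIdeal W ε := by
      rw [← Ideal.Quotient.eq, hc, map_sum]
      rfl
    have h2 : f - ∑ i, c i • h i ∈ m • (⊤ : Submodule (FixedPoints.subalgebra k S W) S) := by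
      rw [Ideal.smul_top_eq_map]
      exact hI h1
    have h3 : N.mkQ f = N.mkQ (f - ∑ i, c i • h i) := by
      rw [map_sub, eq_comm, sub_eq_self, ← LinearMap.mem_ker, Submodule.ker_mkQ]
      refine Submodule.sum_mem _ fun i _ => ?_
      have : c i • h i = algebraMap k (FixedPoints.subalgebra k S W) (c i) • h i := by
        rw [algebraMap_smul]
      rw [this]
      exact N.smul_mem _ (Submodule.subset_span ⟨i, rfl⟩)
    rw [h3]
    have h4 := Submodule.mem_map_of_mem (f := N.mkQ) h2
    rw [Submodule.map_smul''] at h4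
    exact Submodule.smul_mono le_rfl le_top h4
  obtain ⟨u, hu, hu'⟩ := Submodule.exists_sub_one_mem_and_smul_eq_zero_of_fg_of_le_smul m ⊤
    (Module.Finite.fg_top) hle
  refine ⟨u, ?_, fun f => ?_⟩
  · have : ε ((u - 1 : FixedPoints.subalgebra k S W) : S) = 0 := hu
    rw [AddSubgroupClass.coe_sub, map_sub, OneMemClass.coe_one, map_one, sub_eq_zero] at this
    rw [this]; exact one_ne_zero
  · have h1 := hu' (N.mkQ f) trivial
    rw [← map_smul, ← LinearMap.mem_ker, Submodule.ker_mkQ] at h1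
    obtain ⟨c, hc⟩ := (Submodule.mem_span_range_iff_exists_fun _).1 h1
    refine ⟨c, ?_⟩
    change u • f = _
    rw [← hc]
    exact Finset.sum_congr rfl fun i _ => mul_comm _ _

/-- With d = det(AᵀA), the matrix B = adj(AᵀA)Aᵀ is d times a left inverse of A. It is also d times
a right inverse, because the rows of AB - d are annihilated by A. Thus P and b are conjugate up to
the factor d, which is cancelled at the end. Equality of the two index sizes is never needed as an
input. -/
theorem trace_eq_of_mul_eq {L m n : Type*} [CommRing L] [IsDomain L] [Fintype m] [Fintype n]
    [DecidableEq m] [DecidableEq n] (A : Matrix m n L) (P : Matrix m m L) (b : Matrix n n L)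
    (hdet : (A.transpose * A).det ≠ 0) (hrow : ∀ c : m → L, Matrix.vecMul c A = 0 → c = 0)
    (h : P * A = A * b) : P.trace = b.trace := by
  set d := (A.transpose * A).det with hd
  set B := (A.transpose * A).adjugate * A.transpose with hB
  have hBA : B * A = d • (1 : Matrix n n L) := by
    rw [hB, Matrix.mul_assoc, Matrix.adjugate_mul]
  have hAB : A * B = d • (1 : Matrix m m L) := by
    rw [← sub_eq_zero]
    ext i j
    have h0 : (A * B - d • 1) * A = 0 := by
      rw [Matrix.sub_mul, Matrix.mul_assoc, hBA, Matrix.mul_smul, Matrix.mul_one, Matrix.smul_mul,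
        Matrix.one_mul, sub_self]
    exact congrFun (hrow _ (funext fun j => congrFun (congrFun h0 i) j)) j
  refine mul_left_cancel₀ hdet ?_
  calc d * P.trace = (P * A * B).trace := by
        rw [Matrix.mul_assoc, hAB, Matrix.mul_smul, Matrix.mul_one, Matrix.trace_smul, smul_eq_mul]
    _ = (A * (b * B)).trace := by rw [h, Matrix.mul_assoc]
    _ = d * b.trace := by
        rw [Matrix.trace_mul_comm, Matrix.mul_assoc, hBA, Matrix.mul_smul, Matrix.mul_one,
          Matrix.trace_smul, smul_eq_mul]

/-- Dedekind's independence of characters: faithfulness makes the automorphisms given by W pairwise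
distinct multiplicative maps. -/
theorem eq_zero_of_sum_mul_smul_eq_zero [IsDomain S] [FaithfulSMul W S] (c : W → S)
    (h : ∀ f : S, ∑ w, c w * w • f = 0) : c = 0 := by
  have hli : LinearIndependent S
      fun w : W => ((MulSemiringAction.toRingHom W S w : S →* S) : S → S) :=
    (linearIndependent_monoidHom S S).comp
      (fun w : W => (MulSemiringAction.toRingHom W S w : S →* S)) fun w v hwv =>
        FaithfulSMul.eq_of_smul_eq_smul fun f => DFunLike.congr_fun hwv f
  rw [Fintype.linearIndependent_iff] at hli
  funext w
  refine hli c ?_ w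
  funext f
  rw [Finset.sum_apply]
  exact h f

/-- Non-trivial group elements have trace zero on the coinvariant algebra. -/
theorem trace_quotient_hilbertIdeal_eq_zero [IsDomain S] [CharZero k] [FaithfulSMul W S]
    [Algebra.FiniteType k S] {F : ℕ → Submodule k S} (hF : ∀ f, ∃ d, f ∈ F d)
    (hgen : Subgroup.closure {s : W | ∃ α δ, IsDividedDifference F s α δ} = ⊤)
    {w : W} (hw : w ≠ 1) (T : Module.End k (S ⧸ hilbertIdeal W ε))
    (hT : ∀ f, T (Ideal.Quotient.mk _ f) = Ideal.Quotient.mk _ (w • f)) :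
    LinearMap.trace k _ T = 0 := by
  classical
  have := finite_quotient_hilbertIdeal (k := k) (W := W) (S := S) (ε := ε)
  let B := Module.finBasis k (S ⧸ hilbertIdeal W ε)
  set r := Module.finrank k (S ⧸ hilbertIdeal W ε)
  choose h hh using fun i => Ideal.Quotient.mk_surjective (B i)
  have hind := @eq_zero_of_sum_mul_eq_zero k W S _ _ _ _ _ _ _ _ _ ε F hF hgen r
  obtain ⟨u, hu, hspan⟩ := exists_mul_mem_span (ε := ε) h fun x =>
    ⟨B.repr x, by simp_rw [hh]; exact (B.sum_repr x).symm⟩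
  have hu0 : (u : S) ≠ 0 := fun h0 => hu (by rw [h0, map_zero])
  have hbmk : LinearIndependent k fun i => Ideal.Quotient.mk (hilbertIdeal W ε) (h i) := by
    simp_rw [hh]; exact B.linearIndependent
  -- The b j i are the entries, up to the factor u, of the matrix of w in the lifts h. They are
  -- invariant, so every g in W can be applied to this equation.
  choose b hb using fun j => hspan (w • h j)
  let A : Matrix W (Fin r) S := Matrix.of fun g j => g • h j
  -- left multiplication by this matrix permutes the rows of `A` without fixed points
  let P : Matrix W W S := Matrix.of fun g g' => if g * w = g' then (u : S) else 0
  have hP : P.trace = 0 := by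
    rw [Matrix.trace]
    refine Finset.sum_eq_zero fun g _ => ?_
    simp [P, hw]
  have hPA : P * A = A * Matrix.of fun i j => (b j i : S) := by
    ext g j
    simp only [Matrix.mul_apply, P, A, Matrix.of_apply, ite_mul, zero_mul, Finset.sum_ite_eq,
      Finset.mem_univ, if_true]
    have := congrArg (g • ·) (hb j)
    simp only [smul_mul', Finset.smul_sum, smul_smul] at this
    rw [u.2 g] at this
    rw [this]
    exact Finset.sum_congr rfl fun i _ => by rw [(b j i).2 g]
  -- A linear combination of group elements that vanishes on all h j vanishes on every f, since u *
  -- f is an invariant combination of the h j. Dedekind's independence then applies.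
  have hrow : ∀ c : W → S, Matrix.vecMul c A = 0 → c = 0 := by
    intro c hc
    refine eq_zero_of_sum_mul_smul_eq_zero c fun f => ?_
    refine (mul_eq_zero.1 (?_ : (u : S) * _ = 0)).resolve_left hu0
    obtain ⟨a, ha⟩ := hspan f
    have h1 : ∀ g : W, (u : S) * (c g * g • f) = ∑ i, c g * g • h i * a i := by
      intro g
      have := congrArg (g • ·) ha
      simp only [smul_mul', Finset.smul_sum] at this
      rw [u.2 g] at this
      rw [mul_left_comm, this, Finset.mul_sum]
      exact Finset.sum_congr rfl fun i _ => by rw [(a i).2 g, mul_assoc]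
    rw [Finset.mul_sum]
    simp_rw [h1]
    rw [Finset.sum_comm]
    refine Finset.sum_eq_zero fun i _ => ?_
    rw [← Finset.sum_mul]
    have := congrFun hc i
    simp only [Matrix.vecMul, dotProduct, A, Matrix.of_apply, Pi.zero_apply] at this
    rw [this, zero_mul]
  -- This is the Gram matrix AᵀA of the trace form, viewed over the invariants. A kernel vector c
  -- gives z = ∑ c j * h j with all g • z = 0 by `hrow`, hence z = 0, and then c = 0 by independence
  -- over the invariants.
  let tr : Fin r → Fin r → FixedPoints.subalgebra k S W := fun i j =>
    ⟨∑ g : W, g • (h i * h j), sum_smul_invariant _⟩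
  have hdetR : (Matrix.of tr).det ≠ 0 := by
    intro h0
    obtain ⟨c, hc0, hc⟩ := Matrix.exists_mulVec_eq_zero_iff.2 h0
    refine hc0 ?_
    set z := ∑ j, (c j : S) * h j with hz
    have hz0 : z = 0 := by
      have h1 : ∀ i, ∑ g : W, g • h i * g • z = 0 := by
        intro i
        have h2 := congrArg Subtype.val (congrFun hc i)
        simp only [Matrix.mulVec, dotProduct, Matrix.of_apply, tr] at h2
        rw [AddSubmonoidClass.coe_finsetSum] at h2
        simp only [MulMemClass.coe_mul, Finset.sum_mul] at h2
        rw [Finset.sum_comm] at h2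
        refine Eq.trans (Finset.sum_congr rfl fun g _ => ?_) h2
        rw [hz, Finset.smul_sum, Finset.mul_sum]
        refine Finset.sum_congr rfl fun j _ => ?_
        rw [smul_mul', smul_mul', (c j).2 g]
        ring
      have h3 := hrow (fun g => g • z) (by
        funext i
        simp only [Matrix.vecMul, dotProduct, A, Matrix.of_apply, Pi.zero_apply]
        rw [← h1 i]
        exact Finset.sum_congr rfl fun g _ => mul_comm _ _)
      simpa using congrFun h3 1
    have h4 := hind (fun i => (c i : S)) h (fun i => (c i).2) hbmk hz0
    funext i
    exact Subtype.ext (congrFun h4 i)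
  have hdet : (A.transpose * A).det ≠ 0 := by
    have h1 : A.transpose * A = (FixedPoints.subalgebra k S W).val.mapMatrix (Matrix.of tr) := by
      ext i j
      simp [Matrix.mul_apply, A, tr]
    rw [h1, ← AlgHom.map_det]
    exact fun h0 => hdetR (Subtype.ext h0)
  have htr := trace_eq_of_mul_eq A P _ hdet hrow hPA
  rw [hP] at htr
  -- Reduction modulo the Hilbert ideal turns invariants into their values under ε, so the trace
  -- identity over S descends to T.
  have hM : ε u • LinearMap.toMatrix B B T = Matrix.of fun i j => ε (b j i) := by
    ext i j
    rw [Matrix.smul_apply, LinearMap.toMatrix_apply, Matrix.of_apply, ← hh j, hT]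
    have h1 := congrArg (Ideal.Quotient.mk (hilbertIdeal W ε)) (hb j)
    rw [mk_invariant_mul u.2, map_sum] at h1
    have h2 : ∀ i, Ideal.Quotient.mk (hilbertIdeal W ε) (h i * (b j i : S)) = ε (b j i) • B i :=
      fun i => by rw [mul_comm, mk_invariant_mul (b j i).2, hh]
    simp_rw [h2] at h1
    have h3 := congrArg (fun x => B.repr x i) h1
    simp only [map_smul, Finsupp.smul_apply, map_sum, Finsupp.finsetSum_apply, B.repr_self] at h3
    rw [h3]
    simp [Finsupp.single_apply]
  have h5 : ε u * LinearMap.trace k _ T = 0 := by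
    rw [LinearMap.trace_eq_matrix_trace k B, ← smul_eq_mul, ← Matrix.trace_smul, hM]
    have := congrArg ε htr
    rw [map_zero, Matrix.trace, map_sum] at this
    exact this.symm
  exact (mul_eq_zero.1 h5).resolve_left hu

end Coinvariant

/-! ### Group actions and skew derivations on symmetric algebras -/

section SymmetricAlgebra

variable {W M : Type*} [Group W] [AddCommGroup M] [Module ℂ M] (ρ : Representation ℂ W M)

@[simp]
theorem symAct_ι (w : W) (x : M) :
    symAct ρ w (SymmetricAlgebra.ι ℂ M x) = SymmetricAlgebra.ι ℂ M (ρ w x) := by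
  simp [symAct]

theorem ι_ne_zero {m : M} (hm : m ≠ 0) : SymmetricAlgebra.ι ℂ M m ≠ 0 := by
  intro h
  refine hm ((Module.forall_dual_apply_eq_zero_iff ℂ m).1 fun y => ?_)
  have := congrArg (SymmetricAlgebra.lift y) h
  rwa [SymmetricAlgebra.lift_ι_apply, map_zero] at this

theorem symAct_one_apply (f : SymmetricAlgebra ℂ M) : symAct ρ 1 f = f := by
  have : symAct ρ 1 = AlgHom.id ℂ _ := by
    apply SymmetricAlgebra.algHom_ext
    ext x
    simp
  rw [this]; rfl

theorem symAct_mul_apply (g h : W) (f : SymmetricAlgebra ℂ M) :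
    symAct ρ (g * h) f = symAct ρ g (symAct ρ h f) := by
  have : symAct ρ (g * h) = (symAct ρ g).comp (symAct ρ h) := by
    apply SymmetricAlgebra.algHom_ext
    ext x
    simp
  rw [this]; rfl

/-- The action of `W` on the symmetric algebra. -/
abbrev symMulSemiringAction : MulSemiringAction W (SymmetricAlgebra ℂ M) where
  smul w f := symAct ρ w f
  one_smul := symAct_one_apply ρ
  mul_smul := symAct_mul_apply ρ
  smul_zero w := map_zero (symAct ρ w)
  smul_add w := map_add (symAct ρ w)
  smul_one w := map_one (symAct ρ w)
  smul_mul w := map_mul (symAct ρ w)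

/-- The ideal generated by the invariants with zero constant term. -/
def posIdeal : Ideal (SymmetricAlgebra ℂ M) := Ideal.span (posInvariants ρ)

/-- The coinvariant algebra. -/
def Coinv : Type _ := SymmetricAlgebra ℂ M ⧸ posIdeal ρ

instance : CommRing (Coinv ρ) := inferInstanceAs (CommRing (SymmetricAlgebra ℂ M ⧸ posIdeal ρ))

instance : Algebra ℂ (Coinv ρ) := inferInstanceAs (Algebra ℂ (SymmetricAlgebra ℂ M ⧸ posIdeal ρ))

/-- The quotient map to the coinvariant algebra. -/
def coinvMk : SymmetricAlgebra ℂ M →ₐ[ℂ] Coinv ρ := Ideal.Quotient.mkₐ ℂ (posIdeal ρ)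

theorem coinvMk_surjective : Function.Surjective (coinvMk ρ) := Ideal.Quotient.mk_surjective

theorem coinvMk_eq_zero_iff {f : SymmetricAlgebra ℂ M} : coinvMk ρ f = 0 ↔ f ∈ posIdeal ρ :=
  Ideal.Quotient.eq_zero_iff_mem

/-- Linear maps from the coinvariant algebra. -/
def coinvLift {E : Type*} [AddCommGroup E] [Module ℂ E] (F : SymmetricAlgebra ℂ M →ₗ[ℂ] E)
    (hF : ∀ f ∈ posIdeal ρ, F f = 0) : Coinv ρ →ₗ[ℂ] E :=
  Submodule.liftQ ((posIdeal ρ).restrictScalars ℂ) F hF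

theorem SymmetricAlgebra.algebraMapInv_symAct (w : W) (f : SymmetricAlgebra ℂ M) :
    SymmetricAlgebra.algebraMapInv (symAct ρ w f) = SymmetricAlgebra.algebraMapInv f := by
  have : (SymmetricAlgebra.algebraMapInv (R := ℂ) (M := M)).comp (symAct ρ w) =
      SymmetricAlgebra.algebraMapInv := by
    apply SymmetricAlgebra.algHom_ext
    ext x
    simp [SymmetricAlgebra.algebraMapInv_ι]
  exact DFunLike.congr_fun this f

theorem symAct_mem_posIdeal (w : W) {f : SymmetricAlgebra ℂ M} (hf : f ∈ posIdeal ρ) :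
    symAct ρ w f ∈ posIdeal ρ := by
  let := symMulSemiringAction ρ
  have : SMulCommClass W ℂ (SymmetricAlgebra ℂ M) := ⟨fun w c f => map_smul (symAct ρ w) c f⟩
  exact Coinvariant.smul_mem_hilbertIdeal (ε := SymmetricAlgebra.algebraMapInv) w hf

instance [FiniteDimensional ℂ M] : Algebra.FiniteType ℂ (SymmetricAlgebra ℂ M) :=
  Algebra.FiniteType.equiv inferInstance
    (SymmetricAlgebra.equivMvPolynomial (Module.finBasis ℂ M)).symm

instance [Finite W] [FiniteDimensional ℂ M] : FiniteDimensional ℂ (Coinv ρ) := by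
  let := symMulSemiringAction ρ
  let : SMulCommClass W ℂ (SymmetricAlgebra ℂ M) := ⟨fun w c f => map_smul (symAct ρ w) c f⟩
  let := Fintype.ofFinite W
  exact Coinvariant.finite_quotient_hilbertIdeal (ε := SymmetricAlgebra.algebraMapInv)

/-- The augmentation ideal of the symmetric algebra. -/
def augIdeal (M : Type*) [AddCommGroup M] [Module ℂ M] : Ideal (SymmetricAlgebra ℂ M) :=
  Ideal.span (Set.range (SymmetricAlgebra.ι ℂ M))

theorem sub_algebraMapInv_mem_augIdeal (f : SymmetricAlgebra ℂ M) :
    f - algebraMap ℂ _ (SymmetricAlgebra.algebraMapInv f) ∈ augIdeal M := by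
  induction f using SymmetricAlgebra.induction with
  | algebraMap r => simp
  | ι x =>
    rw [SymmetricAlgebra.algebraMapInv_ι, map_zero, sub_zero]
    exact Ideal.subset_span ⟨x, rfl⟩
  | mul a b ha hb =>
    have := Ideal.add_mem _ (Ideal.mul_mem_right b _ ha)
      (Ideal.mul_mem_left _ (algebraMap ℂ _ (SymmetricAlgebra.algebraMapInv a)) hb)
    rw [sub_mul, mul_sub, sub_add_sub_cancel] at this
    rwa [map_mul, map_mul]
  | add a b ha hb =>
    rw [map_add, map_add, add_sub_add_comm]
    exact Ideal.add_mem _ ha hb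

theorem augIdeal_fg [FiniteDimensional ℂ M] : (augIdeal M).FG := by
  let b := Module.finBasis ℂ M
  have : augIdeal M = Ideal.span (Set.range fun i => SymmetricAlgebra.ι ℂ M (b i)) := by
    refine le_antisymm (Ideal.span_le.2 ?_) (Ideal.span_mono ?_)
    · rintro _ ⟨x, rfl⟩
      rw [← b.sum_repr x, map_sum]
      refine Ideal.sum_mem _ fun i _ => ?_
      rw [map_smul]
      exact Submodule.smul_of_tower_mem _ _ (Ideal.subset_span ⟨i, rfl⟩)
    · rintro _ ⟨i, rfl⟩
      exact ⟨b i, rfl⟩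
  rw [this]
  exact Submodule.fg_span (Set.finite_range _)

open Polynomial in
-- The orbit polynomial ∏ (X - w • x) vanishes at x. Its coefficients are invariant, and the
-- augmentation sends it to X ^ |W|, so all coefficients below the leading one lie in the ideal.
theorem ι_pow_card_mem_posIdeal [Finite W] (x : M) :
    SymmetricAlgebra.ι ℂ M x ^ Nat.card W ∈ posIdeal ρ := by
  let := symMulSemiringAction ρ
  let := Fintype.ofFinite W
  let P := MulSemiringAction.charpoly W (SymmetricAlgebra.ι ℂ M x)
  have hP : P.map (SymmetricAlgebra.algebraMapInv (R := ℂ) (M := M)).toRingHom =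
      X ^ Nat.card W := by
    simp only [P, MulSemiringAction.charpoly_eq, Polynomial.map_prod, Polynomial.map_sub,
      Polynomial.map_X, Polynomial.map_C]
    have : ∀ w : W, (SymmetricAlgebra.algebraMapInv (R := ℂ) (M := M)).toRingHom
        (w • SymmetricAlgebra.ι ℂ M x) = 0 := fun w => by
      change SymmetricAlgebra.algebraMapInv (symAct ρ w _) = 0
      rw [symAct_ι, SymmetricAlgebra.algebraMapInv_ι]
    simp_rw [this]
    simp [Nat.card_eq_fintype_card]
  have hmonic : P.Monic := MulSemiringAction.monic_charpoly W _
  have hdeg : P.natDegree = Nat.card W := by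
    rw [← hmonic.natDegree_map (SymmetricAlgebra.algebraMapInv (R := ℂ) (M := M)).toRingHom, hP,
      natDegree_X_pow]
  have heval : P.eval (SymmetricAlgebra.ι ℂ M x) = 0 := MulSemiringAction.eval_charpoly W _
  rw [eval_eq_sum_range, Finset.sum_range_succ, hmonic.coeff_natDegree, one_mul, hdeg] at heval
  rw [← neg_eq_of_add_eq_zero_right heval]
  refine neg_mem (Ideal.sum_mem _ fun j hj => Ideal.mul_mem_right _ _ (Ideal.subset_span ⟨?_, ?_⟩))
  · exact fun w => MulSemiringAction.smul_coeff_charpoly _ j w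
  · have := congrArg (fun Q => Q.coeff j) hP
    simp only [coeff_map, coeff_X_pow] at this
    rw [if_neg (Finset.mem_range.1 hj).ne] at this
    exact this

theorem exists_augIdeal_pow_le_posIdeal [Finite W] [FiniteDimensional ℂ M] :
    ∃ n, augIdeal M ^ n ≤ posIdeal ρ := by
  refine Ideal.exists_pow_le_of_le_radical_of_fg (Ideal.span_le.2 ?_) augIdeal_fg
  rintro _ ⟨x, rfl⟩
  exact ⟨_, ι_pow_card_mem_posIdeal ρ x⟩

theorem posIdeal_le_augIdeal : posIdeal ρ ≤ augIdeal M := by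
  refine Ideal.span_le.2 fun f hf => ?_
  have := sub_algebraMapInv_mem_augIdeal f
  rwa [hf.2, map_zero, sub_zero] at this

theorem algebraMapInv_eq_zero_of_mem_augIdeal {f : SymmetricAlgebra ℂ M} (hf : f ∈ augIdeal M) :
    SymmetricAlgebra.algebraMapInv f = 0 := by
  have : augIdeal M ≤ RingHom.ker (SymmetricAlgebra.algebraMapInv (R := ℂ) (M := M)) := by
    refine Ideal.span_le.2 ?_
    rintro _ ⟨x, rfl⟩
    exact SymmetricAlgebra.algebraMapInv_ι x
  exact this hf

/-- The degree filtration of the symmetric algebra. -/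
def symFiltration (M : Type*) [AddCommGroup M] [Module ℂ M] (d : ℕ) :
    Submodule ℂ (SymmetricAlgebra ℂ M) :=
  (1 ⊔ LinearMap.range (SymmetricAlgebra.ι ℂ M)) ^ d

theorem symFiltration_mono : Monotone (symFiltration M) := by
  refine monotone_nat_of_le_succ fun d => ?_
  rw [symFiltration, symFiltration, pow_succ]
  conv_lhs => rw [← mul_one ((1 ⊔ LinearMap.range (SymmetricAlgebra.ι ℂ M)) ^ d)]
  exact mul_le_mul' le_rfl le_sup_left

theorem exists_mem_symFiltration (f : SymmetricAlgebra ℂ M) : ∃ d, f ∈ symFiltration M d := by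
  induction f using SymmetricAlgebra.induction with
  | algebraMap r => exact ⟨0, by rw [symFiltration, pow_zero]; exact Submodule.algebraMap_mem r⟩
  | ι x => exact ⟨1, by rw [symFiltration, pow_one]; exact Submodule.mem_sup_right ⟨x, rfl⟩⟩
  | mul a b ha hb =>
    obtain ⟨d, hd⟩ := ha
    obtain ⟨e, he⟩ := hb
    exact ⟨d + e, by rw [symFiltration, pow_add]; exact Submodule.mul_mem_mul hd he⟩
  | add a b ha hb =>
    obtain ⟨d, hd⟩ := ha
    obtain ⟨e, he⟩ := hb
    exact ⟨max d e, add_mem (symFiltration_mono (le_max_left _ _) hd)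
      (symFiltration_mono (le_max_right _ _) he)⟩

end SymmetricAlgebra

/-! ### Skew derivations -/

section SkewDerivation

variable {M : Type*} [AddCommGroup M] [Module ℂ M]

/-- The compatibility of an endomorphism and a functional that allows to extend the functional to
a skew derivation of the symmetric algebra. -/
def SkewCompatible (r : M →ₗ[ℂ] M) (μ : M →ₗ[ℂ] ℂ) : Prop :=
  ∀ m m', μ m • (m' - r m') = μ m' • (m - r m)

/-- The linear map `m ↦ [[r m, μ m], [0, m]]`. -/
def skewMatrix (r : M →ₗ[ℂ] M) (μ : M →ₗ[ℂ] ℂ) :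
    M →ₗ[ℂ] Matrix (Fin 2) (Fin 2) (SymmetricAlgebra ℂ M) where
  toFun m := !![SymmetricAlgebra.ι ℂ M (r m), algebraMap ℂ _ (μ m); 0, SymmetricAlgebra.ι ℂ M m]
  map_add' m m' := by
    ext i j; fin_cases i <;> fin_cases j <;> simp
  map_smul' c m := by
    ext i j; fin_cases i <;> fin_cases j <;> simp [Algebra.smul_def]

variable {r : M →ₗ[ℂ] M} {μ : M →ₗ[ℂ] ℂ}

/-- Only the upper right entry of the two products needs an argument, and equality there is exactly
`SkewCompatible`. Commutation is what allows the extension to the symmetric algebra. -/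
theorem skewMatrix_commute (h : SkewCompatible r μ) (m m' : M) :
    Commute (skewMatrix r μ m) (skewMatrix r μ m') := by
  have key := congrArg (SymmetricAlgebra.ι ℂ M) (h m m')
  simp only [map_smul, map_sub, Algebra.smul_def] at key
  ext i j
  fin_cases i <;> fin_cases j
  · simp [skewMatrix, Matrix.mul_apply, Fin.sum_univ_two, mul_comm]
  · simp [skewMatrix, Matrix.mul_apply, Fin.sum_univ_two]
    linear_combination key
  · simp [skewMatrix, Matrix.mul_apply, Fin.sum_univ_two]
  · simp [skewMatrix, Matrix.mul_apply, Fin.sum_univ_two, mul_comm]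

/-- The algebra homomorphism `f ↦ [[r f, D f], [0, f]]`. -/
def skewMatrixHom (h : SkewCompatible r μ) :
    SymmetricAlgebra ℂ M →ₐ[ℂ] Matrix (Fin 2) (Fin 2) (SymmetricAlgebra ℂ M) :=
  symLift (skewMatrix r μ) (skewMatrix_commute h)

/-- The skew derivation of the symmetric algebra extending the functional `μ`. -/
def skewDer (h : SkewCompatible r μ) : SymmetricAlgebra ℂ M →ₗ[ℂ] SymmetricAlgebra ℂ M where
  toFun f := skewMatrixHom h f 0 1
  map_add' f g := by rw [map_add, Matrix.add_apply]
  map_smul' c f := by rw [map_smul, Matrix.smul_apply, RingHom.id_apply]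

/-- The algebra endomorphism induced by `r`. -/
def symMap (r : M →ₗ[ℂ] M) : SymmetricAlgebra ℂ M →ₐ[ℂ] SymmetricAlgebra ℂ M :=
  SymmetricAlgebra.lift (SymmetricAlgebra.ι ℂ M ∘ₗ r)

theorem symMap_ι (m : M) :
    symMap r (SymmetricAlgebra.ι ℂ M m) = SymmetricAlgebra.ι ℂ M (r m) := by
  simp [symMap]

theorem skewMatrixHom_apply (h : SkewCompatible r μ) (f : SymmetricAlgebra ℂ M) :
    skewMatrixHom h f = !![symMap r f, skewDer h f; 0, f] := by
  suffices H : skewMatrixHom h f 0 0 = symMap r f ∧ skewMatrixHom h f 1 0 = 0 ∧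
      skewMatrixHom h f 1 1 = f by
    ext i j
    fin_cases i <;> fin_cases j
    · exact H.1
    · rfl
    · exact H.2.1
    · exact H.2.2
  induction f using SymmetricAlgebra.induction with
  | algebraMap c => simp [Matrix.algebraMap_matrix_apply]
  | ι m => simp [skewMatrixHom, symLift_ι, skewMatrix, symMap_ι]
  | mul a b ha hb =>
    simp only [map_mul, Matrix.mul_apply, Fin.sum_univ_two, ha.1, ha.2.1, ha.2.2, hb.1, hb.2.1,
      hb.2.2]
    simp
  | add a b ha hb =>
    simp only [map_add, Matrix.add_apply, ha.1, ha.2.1, ha.2.2, hb.1, hb.2.1, hb.2.2]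
    simp

@[simp]
theorem skewDer_ι (h : SkewCompatible r μ) (m : M) :
    skewDer h (SymmetricAlgebra.ι ℂ M m) = algebraMap ℂ _ (μ m) := by
  change skewMatrixHom h (SymmetricAlgebra.ι ℂ M m) 0 1 = _
  rw [skewMatrixHom, symLift_ι]; rfl

@[simp]
theorem skewDer_algebraMap (h : SkewCompatible r μ) (c : ℂ) :
    skewDer h (algebraMap ℂ _ c) = 0 := by
  change skewMatrixHom h (algebraMap ℂ _ c) 0 1 = _
  rw [AlgHom.commutes]
  simp [Matrix.algebraMap_matrix_apply]

theorem skewDer_mul (h : SkewCompatible r μ) (f g : SymmetricAlgebra ℂ M) :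
    skewDer h (f * g) = skewDer h f * g + symMap r f * skewDer h g := by
  change skewMatrixHom h (f * g) 0 1 = _
  rw [map_mul, skewMatrixHom_apply, skewMatrixHom_apply, Matrix.mul_apply, Fin.sum_univ_two]
  simp [add_comm]

/-- The twist may be put on either factor because the algebra is commutative. This form matches
moving group elements to the right in commutators. -/
theorem skewDer_mul' (h : SkewCompatible r μ) (f g : SymmetricAlgebra ℂ M) :
    skewDer h (f * g) = f * skewDer h g + skewDer h f * symMap r g := by
  rw [mul_comm f g, skewDer_mul]; ring

/-- This identifies the skew derivation as the divided difference f ↦ μ(m)(f - r f)/(m - r m). On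
generators it is `SkewCompatible`, and it propagates through products by the twisted Leibniz rule.
-/
theorem skewDer_mul_ι_sub (h : SkewCompatible r μ) (f : SymmetricAlgebra ℂ M) (m : M) :
    skewDer h f * SymmetricAlgebra.ι ℂ M (m - r m) = μ m • (f - symMap r f) := by
  induction f using SymmetricAlgebra.induction with
  | algebraMap c => simp
  | ι m' =>
    rw [skewDer_ι, symMap_ι, ← map_sub, ← Algebra.smul_def, ← map_smul, ← map_smul, h]
  | mul a b ha hb =>
    rw [skewDer_mul, add_mul, mul_right_comm, ha, mul_assoc, hb, map_mul]
    simp only [Algebra.smul_def]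
    ring
  | add a b ha hb =>
    rw [map_add, add_mul, ha, hb, map_add]
    simp only [Algebra.smul_def]
    ring

theorem skewDer_eq_zero (h : SkewCompatible r μ) {m : M} (hm : m - r m ≠ 0)
    {f : SymmetricAlgebra ℂ M} (hf : symMap r f = f) : skewDer h f = 0 := by
  have := skewDer_mul_ι_sub h f m
  rw [hf, sub_self, smul_zero] at this
  exact (mul_eq_zero.1 this).resolve_right (ι_ne_zero hm)

end SkewDerivation
-- Reflections and their divided differences
section Trace

variable {W M : Type*} [Group W] [AddCommGroup M] [Module ℂ M]

theorem symMap_mem_range_sup {r : M →ₗ[ℂ] M} {f : SymmetricAlgebra ℂ M}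
    (hf : f ∈ 1 ⊔ LinearMap.range (SymmetricAlgebra.ι ℂ M)) :
    symMap r f ∈ 1 ⊔ LinearMap.range (SymmetricAlgebra.ι ℂ M) := by
  obtain ⟨a, ha, b, ⟨m, rfl⟩, rfl⟩ := Submodule.mem_sup.1 hf
  obtain ⟨c, rfl⟩ := Submodule.mem_one.1 ha
  rw [map_add, AlgHom.commutes, symMap_ι]
  exact add_mem (Submodule.mem_sup_left ha) (Submodule.mem_sup_right ⟨_, rfl⟩)

theorem skewDer_mem_one {r : M →ₗ[ℂ] M} {μ : M →ₗ[ℂ] ℂ} (h : SkewCompatible r μ)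
    {f : SymmetricAlgebra ℂ M} (hf : f ∈ 1 ⊔ LinearMap.range (SymmetricAlgebra.ι ℂ M)) :
    ∃ c : ℂ, skewDer h f = algebraMap ℂ _ c := by
  obtain ⟨a, ha, b, ⟨m, rfl⟩, rfl⟩ := Submodule.mem_sup.1 hf
  obtain ⟨c, rfl⟩ := Submodule.mem_one.1 ha
  exact ⟨μ m, by rw [map_add, skewDer_algebraMap, zero_add, skewDer_ι]⟩

theorem skewDer_symFiltration_zero {r : M →ₗ[ℂ] M} {μ : M →ₗ[ℂ] ℂ} (h : SkewCompatible r μ)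
    {f : SymmetricAlgebra ℂ M} (hf : f ∈ symFiltration M 0) : skewDer h f = 0 := by
  rw [symFiltration, pow_zero] at hf
  obtain ⟨c, rfl⟩ := Submodule.mem_one.1 hf
  exact skewDer_algebraMap h c

theorem skewDer_symFiltration_succ {r : M →ₗ[ℂ] M} {μ : M →ₗ[ℂ] ℂ} (h : SkewCompatible r μ)
    (d : ℕ) {f : SymmetricAlgebra ℂ M} (hf : f ∈ symFiltration M (d + 1)) :
    skewDer h f ∈ symFiltration M d := by
  induction d generalizing f with
  | zero =>
    rw [symFiltration, zero_add, pow_one] at hf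
    obtain ⟨c, hc⟩ := skewDer_mem_one h hf
    rw [hc, symFiltration, pow_zero]
    exact Submodule.algebraMap_mem c
  | succ d ih =>
    rw [symFiltration, pow_succ'] at hf
    induction hf using Submodule.mul_induction_on' with
    | mem_mul_mem a ha f hf =>
      rw [skewDer_mul]
      obtain ⟨c, hc⟩ := skewDer_mem_one h ha
      rw [hc, ← Algebra.smul_def]
      refine add_mem (Submodule.smul_mem _ _ hf) ?_
      rw [symFiltration, pow_succ']
      exact Submodule.mul_mem_mul (symMap_mem_range_sup ha) (ih hf)
    | add f _ g _ hf hg => rw [map_add]; exact add_mem hf hg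

variable (ρ : Representation ℂ W M)

/-- By rank-nullity 1 - s has rank one, so it is a vector times a functional. -/
theorem IsReflection.exists_smul [FiniteDimensional ℂ M] {ρ : Representation ℂ W M} {s : W}
    (hs : IsReflection ρ s) :
    ∃ (α : M) (l : M →ₗ[ℂ] ℂ), α ≠ 0 ∧ l ≠ 0 ∧ ∀ x, x - ρ s x = l x • α := by
  have h1 : Module.finrank ℂ (LinearMap.range (ρ s - 1)) = 1 := by
    have := LinearMap.finrank_range_add_finrank_ker (ρ s - 1)
    have h2 : Module.finrank ℂ (LinearMap.ker (ρ s - 1)) + 1 = Module.finrank ℂ M := hs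
    omega
  let b := Module.finBasisOfFinrankEq ℂ (LinearMap.range (ρ s - 1)) h1
  have hx : ∀ x, x - ρ s x = (-(b.coord 0 ∘ₗ (ρ s - 1).rangeRestrict)) x • (b 0 : M) := by
    intro x
    have h3 := congrArg Subtype.val (b.sum_repr ((ρ s - 1).rangeRestrict x))
    rw [Fin.sum_univ_one] at h3
    have h4 : ρ s x - x = b.repr ((ρ s - 1).rangeRestrict x) 0 • (b 0 : M) := h3.symm
    rw [← neg_sub, h4, LinearMap.neg_apply, neg_smul]; rfl
  refine ⟨b 0, -(b.coord 0 ∘ₗ (ρ s - 1).rangeRestrict), ?_, ?_, hx⟩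
  · exact fun h => b.ne_zero 0 (Subtype.ext h)
  · intro h0
    obtain ⟨x, hx'⟩ := (b 0).2
    refine b.ne_zero 0 (Subtype.ext ?_)
    rw [← hx', LinearMap.sub_apply, Module.End.one_apply, ← neg_sub, hx, h0]
    simp

/-- Writing x - s x = l(x) α, both sides equal l(m) l(m') y(α) α. -/
theorem IsReflection.skewCompatible [FiniteDimensional ℂ M] {ρ : Representation ℂ W M} {s : W}
    (hs : IsReflection ρ s) (y : Module.Dual ℂ M) : SkewCompatible (ρ s) (y ∘ₗ (1 - ρ s)) := by
  obtain ⟨α, l, -, -, h⟩ := hs.exists_smul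
  intro m m'
  simp only [LinearMap.comp_apply, LinearMap.sub_apply, Module.End.one_apply, h, map_smul,
    smul_smul, smul_eq_mul]
  congr 1
  ring

theorem IsReflection.exists_ne [FiniteDimensional ℂ M] {ρ : Representation ℂ W M} {s : W}
    (hs : IsReflection ρ s) : ∃ x, x - ρ s x ≠ 0 := by
  obtain ⟨α, l, hα, hl, h⟩ := hs.exists_smul
  obtain ⟨x, hx⟩ := DFunLike.ne_iff.1 hl
  exact ⟨x, by rw [h]; exact smul_ne_zero hx hα⟩

theorem trace_coinv_eq_zero [Finite W] [FiniteDimensional ℂ M] (hfaith : Function.Injective ρ)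
    (hgen : Subgroup.closure {s : W | IsReflection ρ s} = ⊤) {w : W} (hw : w ≠ 1)
    (T : Module.End ℂ (Coinv ρ))
    (hT : ∀ f, T (coinvMk ρ f) = coinvMk ρ (symAct ρ w f)) :
    LinearMap.trace ℂ _ T = 0 := by
  let := symMulSemiringAction ρ
  have : SMulCommClass W ℂ (SymmetricAlgebra ℂ M) := ⟨fun w c f => map_smul (symAct ρ w) c f⟩
  let := Fintype.ofFinite W
  have : FaithfulSMul W (SymmetricAlgebra ℂ M) := ⟨fun {w v} h => by
    refine hfaith (LinearMap.ext fun x => ?_)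
    have h1 : symAct ρ w (SymmetricAlgebra.ι ℂ M x) = symAct ρ v (SymmetricAlgebra.ι ℂ M x) := h _
    rw [symAct_ι, symAct_ι, ← sub_eq_zero, ← map_sub] at h1
    by_contra hne
    exact ι_ne_zero (sub_ne_zero.2 hne) h1⟩
  refine Coinvariant.trace_quotient_hilbertIdeal_eq_zero (ε := SymmetricAlgebra.algebraMapInv)
    (F := symFiltration M) exists_mem_symFiltration ?_ hw T hT
  rw [eq_top_iff, ← hgen]
  refine Subgroup.closure_mono fun s hs => ?_
  obtain ⟨x, hx⟩ := IsReflection.exists_ne hs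
  obtain ⟨y, hy⟩ : ∃ y : Module.Dual ℂ M, y (x - ρ s x) ≠ 0 := by
    by_contra! h
    exact hx ((Module.forall_dual_apply_eq_zero_iff ℂ _).1 h)
  -- The skew derivation divides by x - s x up to the constant y (x - s x), whence the normalising
  -- scalar.
  refine ⟨SymmetricAlgebra.ι ℂ M (x - ρ s x),
    (y (x - ρ s x))⁻¹ • skewDer (IsReflection.skewCompatible hs y), ι_ne_zero hx, fun f => ?_,
    fun f hf => ?_, fun d f hf => ?_⟩
  · rw [LinearMap.smul_apply, smul_mul_assoc, skewDer_mul_ι_sub]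
    change _ = _ • y (x - ρ s x) • _
    rw [smul_smul, inv_mul_cancel₀ hy, one_smul]
    rfl
  · rw [LinearMap.smul_apply, skewDer_symFiltration_zero _ hf, smul_zero]
  · rw [LinearMap.smul_apply]
    exact Submodule.smul_mem _ _ (skewDer_symFiltration_succ _ d hf)

end Trace

/-! ### Commutation with symmetric algebras -/

section SymLift

variable {W M A : Type*} [Group W] [AddCommGroup M] [Module ℂ M] [Ring A] [Algebra ℂ A]
  {ρ : Representation ℂ W M} {P : M →ₗ[ℂ] A} (hP : ∀ m m', Commute (P m) (P m')) {G : W →* A}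

theorem grp_mul_symLift (hG : ∀ g m, G g * P m = P (ρ g m) * G g) (g : W)
    (f : SymmetricAlgebra ℂ M) :
    G g * symLift P hP f = symLift P hP (symAct ρ g f) * G g := by
  induction f using SymmetricAlgebra.induction with
  | algebraMap c => simp only [AlgHom.commutes]; exact (Algebra.commutes c (G g)).symm
  | ι m => rw [symAct_ι, symLift_ι, symLift_ι, hG]
  | mul a b ha hb => rw [map_mul, ← mul_assoc, ha, mul_assoc, hb, map_mul, map_mul, mul_assoc]
  | add a b ha hb => rw [map_add, mul_add, ha, hb, map_add, map_add, add_mul]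

/-- The commutator with z is a derivation. Moving G (s i) to the right past the second factor twists
that factor by s i, so the coefficient of G (s i) obeys the skew Leibniz rule and is determined on
generators. -/
theorem symLift_mul_sub_mul {ι : Type*} [Fintype ι] (s : ι → W) (a : ι → ℂ)
    (μ : ι → M →ₗ[ℂ] ℂ) (hμ : ∀ i, SkewCompatible (ρ (s i)) (μ i))
    (hG : ∀ g m, G g * P m = P (ρ g m) * G g) (z : A)
    (hz : ∀ m, P m * z - z * P m = ∑ i, (a i * μ i m) • G (s i)) (f : SymmetricAlgebra ℂ M) :
    symLift P hP f * z - z * symLift P hP f =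
      ∑ i, a i • (symLift P hP (skewDer (hμ i) f) * G (s i)) := by
  induction f using SymmetricAlgebra.induction with
  | algebraMap c =>
    simp only [AlgHom.commutes, skewDer_algebraMap, map_zero, zero_mul, smul_zero,
      Finset.sum_const_zero, Algebra.commutes c z, sub_self]
  | ι m =>
    rw [symLift_ι, hz]
    refine Finset.sum_congr rfl fun i _ => ?_
    rw [skewDer_ι, AlgHom.commutes, ← Algebra.smul_def, smul_smul]
  | mul f g hf hg =>
    have h1 : symLift P hP (f * g) * z - z * symLift P hP (f * g) =
        symLift P hP f * (symLift P hP g * z - z * symLift P hP g) +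
          (symLift P hP f * z - z * symLift P hP f) * symLift P hP g := by
      rw [map_mul]; noncomm_ring
    rw [h1, hf, hg, Finset.mul_sum, Finset.sum_mul, ← Finset.sum_add_distrib]
    refine Finset.sum_congr rfl fun i _ => ?_
    rw [mul_smul_comm, smul_mul_assoc, ← smul_add, mul_assoc _ (G (s i)),
      grp_mul_symLift hP hG, skewDer_mul', map_add, map_mul, map_mul, add_mul, mul_assoc, mul_assoc]
    rfl
  | add f g hf hg =>
    rw [map_add, add_mul, mul_add, add_sub_add_comm, hf, hg, ← Finset.sum_add_distrib]
    refine Finset.sum_congr rfl fun i _ => ?_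
    rw [map_add, map_add, add_mul, smul_add]

end SymLift

namespace ReflectionGroup

variable {W V : Type*} [Group W] [Finite W] [AddCommGroup V] [Module ℂ V] [FiniteDimensional ℂ V]
  (Γ : ReflectionGroup W V)

/-! ### The commutator relation as a sum over reflections -/

/-- The set of reflections. -/
abbrev Refl : Type _ := {s : W // IsReflection Γ.rep s}

instance : Fintype Γ.Refl := Fintype.ofFinite _

/-- The hyperplane of a reflection. -/
def reflHyp (s : Γ.Refl) : Γ.Hyp := ⟨LinearMap.ker (Γ.rep s.1 - 1), s.1, s.2, rfl⟩

theorem mem_reflHyp {s : Γ.Refl} {v : V} : v ∈ (Γ.reflHyp s).1 ↔ Γ.rep s.1 v = v := by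
  change v ∈ LinearMap.ker (Γ.rep s.1 - 1) ↔ _
  rw [LinearMap.mem_ker, LinearMap.sub_apply, sub_eq_zero]; rfl

theorem mem_stab_reflHyp (s : Γ.Refl) : s.1 ∈ Γ.stab (Γ.reflHyp s) :=
  fun _ hv => Γ.mem_reflHyp.1 hv

variable {Γ} in
theorem refl_ne_one (s : Γ.Refl) : s.1 ≠ 1 := by
  intro h
  obtain ⟨x, hx⟩ := s.2.exists_ne
  apply hx
  rw [h, map_one]
  exact sub_self x

/-- The fixed space of s contains the hyperplane H and, by faithfulness, is not all of V. -/
theorem eq_ker_of_mem_stab {H : Γ.Hyp} {s : W} (hs : s ∈ Γ.stab H) (hs1 : s ≠ 1) :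
    H.1 = LinearMap.ker (Γ.rep s - 1) := by
  have hle : H.1 ≤ LinearMap.ker (Γ.rep s - 1) := fun v hv => by
    rw [LinearMap.mem_ker, LinearMap.sub_apply, sub_eq_zero]
    exact hs v hv
  obtain ⟨t, ht, hH⟩ := H.2
  have h1 : Module.finrank ℂ H.1 + 1 = Module.finrank ℂ V := by rw [hH]; exact ht
  refine Submodule.eq_of_le_of_finrank_le hle ?_
  have hlt : Module.finrank ℂ (LinearMap.ker (Γ.rep s - 1)) < Module.finrank ℂ V := by
    refine Submodule.finrank_lt fun h => hs1 (Γ.faithful ?_)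
    rw [map_one]
    exact sub_eq_zero.1 (LinearMap.ker_eq_top.1 h)
  omega

theorem isReflection_of_mem_stab {H : Γ.Hyp} {s : W} (hs : s ∈ Γ.stab H) (hs1 : s ≠ 1) :
    IsReflection Γ.rep s := by
  obtain ⟨t, ht, hH⟩ := H.2
  have := Γ.eq_ker_of_mem_stab hs hs1
  rw [IsReflection, ← this, hH]
  exact ht

/-- The coefficient of a reflection in the commutator relation. -/
def reflCoeff (k : Γ.Parameter) (s : Γ.Refl) : ℂ :=
  Γ.coeff k (Γ.reflHyp s) s.1 / LinearMap.trace ℂ V (1 - Γ.rep s.1)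

/-- The chosen root and coroot are proportional to the α and l of 1 - s = l ⊗ α, and the normalised
pairing does not see the factors. Its denominator l(α) is the trace of 1 - s. -/
theorem hypPairing_reflHyp (s : Γ.Refl) (x : V) (y : Module.Dual ℂ V) :
    Γ.hypPairing (Γ.reflHyp s) x y = y (x - Γ.rep s.1 x) / LinearMap.trace ℂ V (1 - Γ.rep s.1) := by
  obtain ⟨α, l, hα, hl, h⟩ := s.2.exists_smul
  have hr := Γ.isRootCorootPair (Γ.reflHyp s)
  set β := Γ.root (Γ.reflHyp s)
  set φ := Γ.coroot (Γ.reflHyp s)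
  obtain ⟨v, hv⟩ := hr.root s.1 (Γ.mem_stab_reflHyp s) (refl_ne_one s)
  have hβ : β = l v • α := by rw [← hv, ← h]; rfl
  have hlv : l v ≠ 0 := fun h0 => hr.ne_zero (by
    rw [hβ, h0, zero_smul])
  have htr : LinearMap.trace ℂ V (1 - Γ.rep s.1) = l α := by
    have : (1 - Γ.rep s.1) = l.smulRight α := LinearMap.ext fun x => h x
    rw [this, LinearMap.trace_smulRight]
  have hker : ∀ x, l x = 0 → φ x = 0 := by
    intro x hx
    rw [← LinearMap.mem_ker, hr.coroot, mem_reflHyp, ← sub_eq_zero, ← neg_sub, h, hx, zero_smul,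
      neg_zero]
  have hφ : ∀ x, φ x = l x * (φ v / l v) := by
    intro x
    have h1 := hker (l v • x - l x • v) (by simp [mul_comm])
    rw [map_sub, map_smul, map_smul, sub_eq_zero, smul_eq_mul, smul_eq_mul] at h1
    field_simp
    linear_combination h1
  have hφv : φ v ≠ 0 := by
    intro h0
    have : v ∈ (Γ.reflHyp s).1 := by
      rw [← hr.coroot]
      exact h0
    rw [mem_reflHyp] at this
    refine hr.ne_zero ?_
    rw [← hv, LinearMap.sub_apply, this]
    exact sub_self v
  rw [hypPairing, htr, h]
  change φ x * y β / φ β = _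
  rw [hφ x, hφ β, hβ, map_smul, map_smul, map_smul]
  simp only [smul_eq_mul]
  -- No argument that l α is non-zero is needed: otherwise both sides are quotients by zero, hence
  -- zero by convention.
  by_cases hlα : l α = 0
  · simp [hlα]
  · field_simp

/-- A reflection determines its hyperplane, so pairs of a hyperplane and a non-trivial element of
its stabilizer correspond bijectively to reflections. In this form no choice of roots remains. -/
theorem sum_hyp_eq_sum_refl (k : Γ.Parameter) {A : Type*} [AddCommGroup A] [Module ℂ A]
    (g : W → A) (x : V) (y : Module.Dual ℂ V) :
    ∑ᶠ H : Γ.Hyp, Γ.hypPairing H x y •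
        ∑ᶠ s : {s : Γ.stab H // s ≠ 1}, Γ.coeff k H s.1 • g (s.1 : W) =
      ∑ s : Γ.Refl, (Γ.reflCoeff k s * y (x - Γ.rep s.1 x)) • g s.1 := by
  classical
  let := Fintype.ofFinite Γ.Hyp
  let (H : Γ.Hyp) : Fintype {s : Γ.stab H // s ≠ 1} := Fintype.ofFinite _
  simp_rw [finsum_eq_sum_of_fintype, Finset.smul_sum]
  rw [← Fintype.sum_sigma']
  have hne : ∀ p : (Σ H : Γ.Hyp, {s : Γ.stab H // s ≠ 1}), (p.2.1 : W) ≠ 1 :=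
    fun p h => p.2.2 (Subtype.ext h)
  refine Fintype.sum_bijective
    (fun p => (⟨p.2.1, Γ.isReflection_of_mem_stab p.2.1.2 (hne p)⟩ : Γ.Refl)) ⟨?_, ?_⟩ _ _ ?_
  · rintro ⟨H, s⟩ ⟨H', s'⟩ hss
    have h1 : (s.1 : W) = s'.1 := congrArg Subtype.val hss
    have h2 : H = H' := by
      apply Subtype.ext
      rw [Γ.eq_ker_of_mem_stab s.1.2 (hne ⟨H, s⟩), Γ.eq_ker_of_mem_stab s'.1.2 (hne ⟨H', s'⟩), h1]
    subst h2
    exact congrArg _ (Subtype.ext (Subtype.ext h1))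
  · intro s
    exact ⟨⟨Γ.reflHyp s, ⟨⟨s.1, Γ.mem_stab_reflHyp s⟩, fun h => refl_ne_one s
      (congrArg Subtype.val h)⟩⟩, rfl⟩
  · rintro ⟨H, s⟩
    have hH : H = Γ.reflHyp ⟨s.1, Γ.isReflection_of_mem_stab s.1.2 (hne ⟨H, s⟩)⟩ :=
      Subtype.ext (Γ.eq_ker_of_mem_stab s.1.2 (hne ⟨H, s⟩))
    have h1 := Γ.hypPairing_reflHyp ⟨s.1, Γ.isReflection_of_mem_stab s.1.2 (hne ⟨H, s⟩)⟩ x y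
    rw [← hH] at h1
    rw [h1, smul_smul, reflCoeff, ← hH]
    congr 1
    ring

/-- Conjugation of reflections. -/
def conjRefl (g : W) (s : Γ.Refl) : Γ.Refl := ⟨g * s.1 * g⁻¹, by
  have h : LinearMap.ker (Γ.rep (g * s.1 * g⁻¹) - 1) =
      (LinearMap.ker (Γ.rep s.1 - 1)).map (Γ.rep g) := by
    ext v
    rw [LinearMap.mem_ker, LinearMap.sub_apply, sub_eq_zero, rep_mul_apply, rep_mul_apply]
    constructor
    · intro h
      refine ⟨Γ.rep g⁻¹ v, ?_, Γ.rep_apply_inv g v⟩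
      rw [SetLike.mem_coe, LinearMap.mem_ker, LinearMap.sub_apply, sub_eq_zero]
      have := congrArg (Γ.rep g⁻¹) h
      rwa [rep_inv_apply] at this
    · rintro ⟨u, hu, rfl⟩
      rw [SetLike.mem_coe, LinearMap.mem_ker, LinearMap.sub_apply, sub_eq_zero] at hu
      rw [rep_inv_apply, hu]; rfl
  rw [IsReflection, h, ← (Submodule.equivMapOfInjective (Γ.rep g)
    (Function.LeftInverse.injective (Γ.rep_inv_apply g)) _).finrank_eq]
  exact s.2⟩

theorem reflCoeff_conjRefl (k : Γ.Parameter) (g : W) (s : Γ.Refl) :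
    Γ.reflCoeff k (Γ.conjRefl g s) = Γ.reflCoeff k s := by
  have hmul : Γ.rep (g * s.1 * g⁻¹) = Γ.rep g * Γ.rep s.1 * Γ.rep g⁻¹ := by
    rw [map_mul, map_mul]
  have hinv : Γ.rep g⁻¹ * Γ.rep g = 1 := by rw [← map_mul, inv_mul_cancel, map_one]
  have hdet : LinearMap.det (Γ.rep (Γ.conjRefl g s).1) = LinearMap.det (Γ.rep s.1) := by
    change LinearMap.det (Γ.rep (g * s.1 * g⁻¹)) = _
    have := congrArg LinearMap.det hinv
    rw [map_mul, map_one] at this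
    rw [hmul, map_mul, map_mul]
    linear_combination LinearMap.det (Γ.rep s.1) * this
  have htr : LinearMap.trace ℂ V (1 - Γ.rep (Γ.conjRefl g s).1) =
      LinearMap.trace ℂ V (1 - Γ.rep s.1) := by
    change LinearMap.trace ℂ V (1 - Γ.rep (g * s.1 * g⁻¹)) = _
    rw [map_sub, map_sub, hmul, LinearMap.trace_mul_comm, ← mul_assoc, hinv, one_mul]
  have horb : Γ.orbit (Γ.reflHyp (Γ.conjRefl g s)) = Γ.orbit (Γ.reflHyp s) := by
    refine Quotient.sound (Setoid.symm ⟨g, ?_⟩)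
    refine Submodule.ext fun v => ⟨?_, fun hv => ⟨Γ.rep g⁻¹ v, ?_, Γ.rep_apply_inv g v⟩⟩
    · rintro ⟨u, hu, rfl⟩
      rw [SetLike.mem_coe, mem_reflHyp] at hu
      rw [mem_reflHyp]
      change Γ.rep (g * s.1 * g⁻¹) _ = _
      rw [rep_mul_apply, rep_mul_apply, rep_inv_apply, hu]
    · rw [mem_reflHyp] at hv
      rw [SetLike.mem_coe, mem_reflHyp]
      change Γ.rep (g * s.1 * g⁻¹) _ = _ at hv
      rw [rep_mul_apply, rep_mul_apply] at hv
      have := congrArg (Γ.rep g⁻¹) hv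
      rwa [rep_inv_apply] at this
  -- The index type of k depends on the orbit, so the equality of orbits is substituted in general
  -- position rather than rewritten.
  have hcoeff : ∀ (Ω Ω' : Γ.HypOrbit) (d d' : ℂ), Ω = Ω' → d = d' →
      ∑ j ∈ Finset.range (Γ.e Ω), d ^ j * (k Ω ((j + 1 : ℕ)) - k Ω (j : ℕ)) =
      ∑ j ∈ Finset.range (Γ.e Ω'), d' ^ j * (k Ω' ((j + 1 : ℕ)) - k Ω' (j : ℕ)) := by
    rintro Ω _ d _ rfl rfl
    rfl
  rw [reflCoeff, reflCoeff, htr]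
  congr 1
  exact hcoeff _ _ _ _ horb hdet

/-- Conjugation as a permutation of the reflections. -/
def conjReflEquiv (g : W) : Γ.Refl ≃ Γ.Refl where
  toFun := Γ.conjRefl g
  invFun := Γ.conjRefl g⁻¹
  left_inv s := Subtype.ext (by simp [conjRefl, mul_assoc])
  right_inv s := Subtype.ext (by simp [conjRefl, mul_assoc])

/-! ### Realisations of the defining relations -/

/-- Maps of `V`, `V^*` and `W` to an algebra satisfying the defining relations of `H_{0,k}`. -/
structure IsCherednikTriple (k : Γ.Parameter) {A : Type*} [Ring A] [Algebra ℂ A]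
    (X : V →ₗ[ℂ] A) (Y : Module.Dual ℂ V →ₗ[ℂ] A) (G : W →* A) : Prop where
  commute_vec : ∀ x x', Commute (X x) (X x')
  commute_cov : ∀ y y', Commute (Y y) (Y y')
  grp_vec : ∀ g x, G g * X x = X (Γ.rep g x) * G g
  grp_cov : ∀ g y, G g * Y y = Y (Γ.rep.dual g y) * G g
  vec_cov : ∀ x y, X x * Y y - Y y * X x =
    ∑ s : Γ.Refl, (Γ.reflCoeff k s * y (x - Γ.rep s.1 x)) • G s.1

/-- On the dual space too, 1 - s has rank one, with scalar factor proportional to y ↦ y(α), and y ↦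
y(x - s x) is a multiple of the same functional. -/
theorem dual_skewCompatible (s : Γ.Refl) (x : V) :
    SkewCompatible (Γ.rep.dual s.1) (Module.Dual.eval ℂ V (x - Γ.rep s.1 x)) := by
  obtain ⟨α, l, -, -, h⟩ := s.2.exists_smul
  intro y y'
  ext z
  have h1 : ∀ y : Module.Dual ℂ V, (y - Γ.rep.dual s.1 y) z = -(l (Γ.rep s.1⁻¹ z) * y α) := by
    intro y
    have h2 := h (Γ.rep s.1⁻¹ z)
    rw [Γ.rep_apply_inv] at h2
    have h3 := congrArg y h2
    rw [map_sub, map_smul, smul_eq_mul] at h3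
    rw [LinearMap.sub_apply, ← h3]
    change y z - y (Γ.rep s.1⁻¹ z) = _
    ring
  rw [LinearMap.smul_apply, LinearMap.smul_apply, h1, h1, Module.Dual.eval_apply,
    Module.Dual.eval_apply, h, map_smul, map_smul]
  simp only [smul_eq_mul]
  ring

theorem dual_exists_ne (s : Γ.Refl) : ∃ y : Module.Dual ℂ V, y - Γ.rep.dual s.1 y ≠ 0 := by
  by_contra! h
  obtain ⟨x, hx⟩ := s.2.exists_ne
  refine hx ((Module.forall_dual_apply_eq_zero_iff ℂ _).1 fun y => ?_)
  have := DFunLike.congr_fun (h y) (Γ.rep s.1 x)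
  rw [LinearMap.sub_apply] at this
  change y (Γ.rep s.1 x) - y (Γ.rep s.1⁻¹ (Γ.rep s.1 x)) = 0 at this
  rw [rep_inv_apply] at this
  rw [map_sub, ← neg_sub, this, neg_zero]

namespace IsCherednikTriple

variable {Γ} {k : Γ.Parameter} {A : Type*} [Ring A] [Algebra ℂ A]
  {X : V →ₗ[ℂ] A} {Y : Module.Dual ℂ V →ₗ[ℂ] A} {G : W →* A} (h : Γ.IsCherednikTriple k X Y G)
include h

theorem symVec_mul_sub_mul (f : SymmetricAlgebra ℂ V) (y : Module.Dual ℂ V) :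
    symLift X h.commute_vec f * Y y - Y y * symLift X h.commute_vec f =
      ∑ s : Γ.Refl, Γ.reflCoeff k s •
        (symLift X h.commute_vec (skewDer (s.2.skewCompatible y) f) * G s.1) :=
  symLift_mul_sub_mul h.commute_vec (fun s : Γ.Refl => s.1) (Γ.reflCoeff k)
    (fun s => y ∘ₗ (1 - Γ.rep s.1)) (fun s => s.2.skewCompatible y) h.grp_vec (Y y)
    (fun x => h.vec_cov x y) f

/-- The commutator is a combination of skew derivatives of f along reflections, and a divided
difference kills s-invariant elements. -/
theorem commute_symCov {f : SymmetricAlgebra ℂ (Module.Dual ℂ V)}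
    (hf : ∀ w, symAct Γ.rep.dual w f = f) (x : V) :
    Commute (X x) (symLift Y h.commute_cov f) := by
  have h1 := symLift_mul_sub_mul h.commute_cov (fun s : Γ.Refl => s.1)
    (fun s => -Γ.reflCoeff k s) (fun s => Module.Dual.eval ℂ V (x - Γ.rep s.1 x))
    (fun s => Γ.dual_skewCompatible s x) h.grp_cov (X x)
    (fun y => by
      rw [← neg_sub, h.vec_cov, ← Finset.sum_neg_distrib]
      refine Finset.sum_congr rfl fun s _ => ?_
      rw [neg_mul, neg_smul]; rfl) f
  rw [Finset.sum_eq_zero, sub_eq_zero] at h1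
  · exact h1.symm
  · intro s _
    obtain ⟨y, hy⟩ := Γ.dual_exists_ne s
    rw [skewDer_eq_zero (Γ.dual_skewCompatible s x) hy (hf s.1), map_zero, zero_mul, smul_zero]

end IsCherednikTriple

end ReflectionGroup

theorem map_symLift {M A A' : Type*} [AddCommGroup M] [Module ℂ M] [Ring A] [Algebra ℂ A] [Ring A']
    [Algebra ℂ A'] {P : M →ₗ[ℂ] A} {P' : M →ₗ[ℂ] A'} (hP : ∀ m m', Commute (P m) (P m'))
    (hP' : ∀ m m', Commute (P' m) (P' m')) (φ : A →ₐ[ℂ] A') (h : ∀ m, φ (P m) = P' m)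
    (f : SymmetricAlgebra ℂ M) : φ (symLift P hP f) = symLift P' hP' f := by
  induction f using SymmetricAlgebra.induction with
  | algebraMap c => simp only [AlgHom.commutes]
  | ι x => rw [symLift_ι, symLift_ι, h]
  | mul a b ha hb => rw [map_mul, map_mul, ha, hb, map_mul]
  | add a b ha hb => rw [map_add, map_add, ha, hb, map_add]

namespace ReflectionGroup

variable {W V : Type*} [Group W] [Finite W] [AddCommGroup V] [Module ℂ V] [FiniteDimensional ℂ V]
  (Γ : ReflectionGroup W V) (k : Γ.Parameter)

/-! ### The restricted rational Cherednik algebra by generators and relations -/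

/-- The canonical map `V → H̄_k`. -/
def rVec : V →ₗ[ℂ] Γ.Restricted k := (Γ.toRestricted k).toLinearMap ∘ₗ Γ.vec 0 k

/-- The canonical map `V^* → H̄_k`. -/
def rCov : Module.Dual ℂ V →ₗ[ℂ] Γ.Restricted k := (Γ.toRestricted k).toLinearMap ∘ₗ Γ.cov 0 k

/-- The canonical map `W → H̄_k`. -/
def rGrp : W →* Γ.Restricted k := ((Γ.toRestricted k : _ →* Γ.Restricted k)).comp (Γ.grp 0 k)

theorem vec_cov_relation (x : V) (y : Module.Dual ℂ V) :
    Γ.vec 0 k x * Γ.cov 0 k y - Γ.cov 0 k y * Γ.vec 0 k x =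
      ∑ s : Γ.Refl, (Γ.reflCoeff k s * y (x - Γ.rep s.1 x)) • Γ.grp 0 k s.1 := by
  have h := toCherednik_rel (Rel.vec_cov (Γ := Γ) (t := 0) (k := k) x y)
  rw [sum_hyp_eq_sum_refl Γ k (fun w => FreeAlgebra.ι ℂ (Gen.grp w)) x y] at h
  rw [zero_mul, map_zero, zero_add, map_sub, map_mul, map_mul, map_sum] at h
  simp only [map_smul] at h
  exact h

theorem isCherednikTriple_restricted :
    Γ.IsCherednikTriple k (Γ.rVec k) (Γ.rCov k) (Γ.rGrp k) where
  commute_vec x x' := (Γ.vec_commute 0 k x x').map (Γ.toRestricted k)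
  commute_cov y y' := (Γ.cov_commute 0 k y y').map (Γ.toRestricted k)
  grp_vec g x := by
    have h := toCherednik_rel (Rel.grp_vec (Γ := Γ) (t := 0) (k := k) g x)
    rw [map_mul, map_mul] at h
    have h' := congrArg (Γ.toRestricted k) h
    rwa [map_mul, map_mul] at h'
  grp_cov g y := by
    have h := toCherednik_rel (Rel.grp_cov (Γ := Γ) (t := 0) (k := k) g y)
    rw [map_mul, map_mul] at h
    have h' := congrArg (Γ.toRestricted k) h
    rwa [map_mul, map_mul] at h'
  vec_cov x y := by
    have h := congrArg (Γ.toRestricted k) (Γ.vec_cov_relation k x y)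
    rw [map_sub, map_mul, map_mul, map_sum] at h
    simp only [map_smul] at h
    exact h

theorem symLift_rVec (f : SymmetricAlgebra ℂ V) :
    symLift (Γ.rVec k) (Γ.isCherednikTriple_restricted k).commute_vec f =
      Γ.toRestricted k (Γ.symVec k f) :=
  (map_symLift _ _ (Γ.toRestricted k) (fun _ => rfl) f).symm

theorem symLift_rCov (f : SymmetricAlgebra ℂ (Module.Dual ℂ V)) :
    symLift (Γ.rCov k) (Γ.isCherednikTriple_restricted k).commute_cov f =
      Γ.toRestricted k (Γ.symCov k f) :=
  (map_symLift _ _ (Γ.toRestricted k) (fun _ => rfl) f).symm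

theorem toCherednik_surjective : Function.Surjective (Γ.toCherednik 0 k) :=
  RingQuot.mkAlgHom_surjective ℂ _

theorem toRestricted_surjective : Function.Surjective (Γ.toRestricted k) :=
  RingQuot.mkAlgHom_surjective ℂ _

variable {Γ k} in
theorem toRestricted_rel {a b : Γ.Cherednik 0 k} (h : Γ.RestrictedRel k a b) :
    Γ.toRestricted k a = Γ.toRestricted k b :=
  RingQuot.mkAlgHom_rel ℂ h

theorem symLift_rVec_eq_zero {f : SymmetricAlgebra ℂ V} (hf : f ∈ posIdeal Γ.rep) :
    symLift (Γ.rVec k) (Γ.isCherednikTriple_restricted k).commute_vec f = 0 := by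
  induction hf using Submodule.span_induction with
  | mem f hf =>
    rw [symLift_rVec, toRestricted_rel (RestrictedRel.vec f hf), map_zero]
  | zero => exact map_zero _
  | add f g _ _ hf hg => rw [map_add, hf, hg, add_zero]
  | smul c f _ hf => rw [smul_eq_mul, map_mul, hf, mul_zero]

theorem symLift_rCov_eq_zero {f : SymmetricAlgebra ℂ (Module.Dual ℂ V)}
    (hf : f ∈ posIdeal Γ.rep.dual) :
    symLift (Γ.rCov k) (Γ.isCherednikTriple_restricted k).commute_cov f = 0 := by
  induction hf using Submodule.span_induction with
  | mem f hf =>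
    rw [symLift_rCov, toRestricted_rel (RestrictedRel.cov f hf), map_zero]
  | zero => exact map_zero _
  | add f g _ _ hf hg => rw [map_add, hf, hg, add_zero]
  | smul c f _ hf => rw [smul_eq_mul, map_mul, hf, mul_zero]

/-- The algebra homomorphism from the free algebra on the generators of `H_{0,k}`. -/
def genHom {A : Type*} [Ring A] [Algebra ℂ A]
    (X : V →ₗ[ℂ] A) (Y : Module.Dual ℂ V →ₗ[ℂ] A) (G : W →* A) :
    FreeAlgebra ℂ (Gen W V) →ₐ[ℂ] A :=
  FreeAlgebra.lift ℂ fun | .vec x => X x | .cov y => Y y | .grp g => G g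

/-- The universal property of the restricted rational Cherednik algebra. -/
theorem exists_restricted_hom {A : Type*} [Ring A] [Algebra ℂ A]
    {X : V →ₗ[ℂ] A} {Y : Module.Dual ℂ V →ₗ[ℂ] A} {G : W →* A} (h : Γ.IsCherednikTriple k X Y G)
    (hX : ∀ f ∈ posInvariants Γ.rep, symLift X h.commute_vec f = 0)
    (hY : ∀ f ∈ posInvariants Γ.rep.dual, symLift Y h.commute_cov f = 0) :
    ∃ φ : Γ.Restricted k →ₐ[ℂ] A, (∀ x, φ (Γ.rVec k x) = X x) ∧ (∀ y, φ (Γ.rCov k y) = Y y) ∧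
      ∀ g, φ (Γ.rGrp k g) = G g := by
  have hvec : ∀ x, genHom X Y G (FreeAlgebra.ι ℂ (.vec x)) = X x := fun x => by simp [genHom]
  have hcov : ∀ y, genHom X Y G (FreeAlgebra.ι ℂ (.cov y)) = Y y := fun y => by simp [genHom]
  have hgrp : ∀ g, genHom X Y G (FreeAlgebra.ι ℂ (.grp g)) = G g := fun g => by simp [genHom]
  have hrel : ∀ ⦃a b⦄, Rel Γ 0 k a b → genHom X Y G a = genHom X Y G b := by
    intro a b hab
    cases hab with
    | vec_add x x' => simp only [map_add, hvec]
    | vec_smul c x => simp only [map_smul, hvec]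
    | cov_add y y' => simp only [map_add, hcov]
    | cov_smul c y => simp only [map_smul, hcov]
    | grp_one => simp only [map_one, hgrp]
    | grp_mul g g' => simp only [map_mul, hgrp]
    | grp_vec g x => simp only [map_mul, hgrp, hvec, h.grp_vec]
    | grp_cov g y => simp only [map_mul, hgrp, hcov, h.grp_cov]
    | vec_vec x x' => simp only [map_mul, hvec]; exact h.commute_vec x x'
    | cov_cov y y' => simp only [map_mul, hcov]; exact h.commute_cov y y'
    | vec_cov x y =>
      rw [sum_hyp_eq_sum_refl Γ k (fun w => FreeAlgebra.ι ℂ (Gen.grp w)) x y]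
      rw [zero_mul, map_zero, zero_add, map_sub, map_mul, map_mul, map_sum]
      simp only [map_smul, hvec, hcov, hgrp]
      exact h.vec_cov x y
  let φ₀ : Γ.Cherednik 0 k →ₐ[ℂ] A := RingQuot.liftAlgHom ℂ ⟨genHom X Y G, hrel⟩
  have hφ₀ : ∀ a, φ₀ (Γ.toCherednik 0 k a) = genHom X Y G a :=
    fun a => RingQuot.liftAlgHom_mkAlgHom_apply ℂ _ _ a
  have hsX : ∀ f, φ₀ (Γ.symVec k f) = symLift X h.commute_vec f :=
    map_symLift _ _ φ₀ fun x => (hφ₀ _).trans (hvec x)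
  have hsY : ∀ f, φ₀ (Γ.symCov k f) = symLift Y h.commute_cov f :=
    map_symLift _ _ φ₀ fun y => (hφ₀ _).trans (hcov y)
  have hrel' : ∀ ⦃a b⦄, Γ.RestrictedRel k a b → φ₀ a = φ₀ b := by
    intro a b hab
    cases hab with
    | vec f hf => rw [hsX, hX f hf, map_zero]
    | cov f hf => rw [hsY, hY f hf, map_zero]
  let φ : Γ.Restricted k →ₐ[ℂ] A := RingQuot.liftAlgHom ℂ ⟨φ₀, hrel'⟩
  have hφ : ∀ a, φ (Γ.toRestricted k a) = φ₀ a :=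
    fun a => RingQuot.liftAlgHom_mkAlgHom_apply ℂ _ _ a
  refine ⟨φ, fun x => ?_, fun y => ?_, fun g => ?_⟩
  · exact (hφ _).trans ((hφ₀ _).trans (hvec x))
  · exact (hφ _).trans ((hφ₀ _).trans (hcov y))
  · exact (hφ _).trans ((hφ₀ _).trans (hgrp g))

/-- A subspace of a module stable under the generators is a submodule. -/
theorem smul_mem_of_stable {E : Type*} [AddCommGroup E] [Module ℂ E] [Module (Γ.Restricted k) E]
    [IsScalarTower ℂ (Γ.Restricted k) E] (N : Submodule ℂ E)
    (hX : ∀ x, ∀ n ∈ N, Γ.rVec k x • n ∈ N) (hY : ∀ y, ∀ n ∈ N, Γ.rCov k y • n ∈ N)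
    (hG : ∀ g, ∀ n ∈ N, Γ.rGrp k g • n ∈ N) (a : Γ.Restricted k) {n : E} (hn : n ∈ N) :
    a • n ∈ N := by
  obtain ⟨a, rfl⟩ := Γ.toRestricted_surjective k a
  obtain ⟨a, rfl⟩ := Γ.toCherednik_surjective k a
  induction a using FreeAlgebra.induction generalizing n with
  | grade0 c =>
    rw [AlgHom.commutes, AlgHom.commutes, algebraMap_smul]
    exact N.smul_mem c hn
  | grade1 v =>
    cases v with
    | vec x => exact hX x n hn
    | cov y => exact hY y n hn
    | grp g => exact hG g n hn
  | mul a b ha hb => rw [map_mul, map_mul, mul_smul]; exact ha (hb hn)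
  | add a b ha hb => rw [map_add, map_add, add_smul]; exact N.add_mem (ha hn) (hb hn)

/-- This is the spanning half of the triangular decomposition: products of images of S(V), ℂW and
S(V*) span, because their span contains 1 and is stable under left multiplication by generators. The
outer factors are finite-dimensional as they factor through coinvariants. -/
instance : FiniteDimensional ℂ (Γ.Restricted k) := by
  have hT := Γ.isCherednikTriple_restricted k
  let P := LinearMap.range (symLift (Γ.rVec k) hT.commute_vec).toLinearMap
  let Q := Submodule.span ℂ (Set.range (Γ.rGrp k))
  let R := LinearMap.range (symLift (Γ.rCov k) hT.commute_cov).toLinearMap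
  have hP : P.FG := by
    let φ : Coinv Γ.rep →ₗ[ℂ] Γ.Restricted k := coinvLift _
      (symLift (Γ.rVec k) hT.commute_vec).toLinearMap
      fun f hf => Γ.symLift_rVec_eq_zero k hf
    have : P = LinearMap.range φ := SetLike.coe_injective (by
      rw [LinearMap.coe_range, LinearMap.coe_range]
      exact ((coinvMk_surjective _).range_comp φ))
    rw [this, LinearMap.range_eq_map]
    exact (Module.Finite.fg_top (R := ℂ) (M := Coinv Γ.rep)).map φ
  have hR : R.FG := by
    let φ : Coinv Γ.rep.dual →ₗ[ℂ] Γ.Restricted k := coinvLift _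
      (symLift (Γ.rCov k) hT.commute_cov).toLinearMap
      fun f hf => Γ.symLift_rCov_eq_zero k hf
    have : R = LinearMap.range φ := SetLike.coe_injective (by
      rw [LinearMap.coe_range, LinearMap.coe_range]
      exact ((coinvMk_surjective _).range_comp φ))
    rw [this, LinearMap.range_eq_map]
    exact (Module.Finite.fg_top (R := ℂ) (M := Coinv Γ.rep.dual)).map φ
  have hQ : Q.FG := Submodule.fg_span (Set.finite_range _)
  have hmem : ∀ f w g, symLift (Γ.rVec k) hT.commute_vec f * Γ.rGrp k w *
      symLift (Γ.rCov k) hT.commute_cov g ∈ P * Q * R := fun f w g =>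
    Submodule.mul_mem_mul (Submodule.mul_mem_mul ⟨f, rfl⟩ (Submodule.subset_span ⟨w, rfl⟩)) ⟨g, rfl⟩
  have hind : ∀ z : Γ.Restricted k, (∀ f w g, z * (symLift (Γ.rVec k) hT.commute_vec f *
      Γ.rGrp k w * symLift (Γ.rCov k) hT.commute_cov g) ∈ P * Q * R) →
      ∀ n ∈ P * Q * R, z • n ∈ P * Q * R := by
    intro z hz n hn
    induction hn using Submodule.mul_induction_on' with
    | mem_mul_mem a ha r hr =>
      obtain ⟨g, rfl⟩ := hr
      induction ha using Submodule.mul_induction_on' with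
      | mem_mul_mem p hp q hq =>
        obtain ⟨f, rfl⟩ := hp
        induction hq using Submodule.span_induction with
        | mem q hq => obtain ⟨w, rfl⟩ := hq; exact hz f w g
        | zero => simp
        | add q q' _ _ hq hq' => rw [mul_add, add_mul, smul_add]; exact add_mem hq hq'
        | smul c q _ hq =>
          rw [mul_smul_comm, smul_mul_assoc, smul_comm]; exact Submodule.smul_mem _ c hq
      | add a _ b _ ha hb => rw [add_mul, smul_add]; exact add_mem ha hb
    | add a _ b _ ha hb => rw [smul_add]; exact add_mem ha hb
  have htop : P * Q * R = ⊤ := by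
    rw [eq_top_iff]
    rintro a -
    have h1 : (1 : Γ.Restricted k) ∈ P * Q * R := by
      have := hmem 1 1 1
      rwa [map_one, map_one, map_one, mul_one, mul_one] at this
    rw [← mul_one a, ← smul_eq_mul]
    refine Γ.smul_mem_of_stable k _ (fun x => hind _ fun f w g => ?_)
      (fun y => hind _ fun f w g => ?_) (fun v => hind _ fun f w g => ?_) a h1
    · rw [← mul_assoc, ← mul_assoc, ← symLift_ι (Γ.rVec k) hT.commute_vec x, ← map_mul]
      exact hmem _ _ _
    · have h2 := hT.symVec_mul_sub_mul f y
      rw [sub_eq_iff_eq_add, ← sub_eq_iff_eq_add'] at h2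
      rw [← mul_assoc, ← mul_assoc, ← h2, sub_mul, sub_mul]
      refine sub_mem ?_ ?_
      · have h3 := hT.grp_cov w (Γ.rep.dual w⁻¹ y)
        rw [← Module.End.mul_apply, ← map_mul, mul_inv_cancel, map_one, Module.End.one_apply] at h3
        rw [mul_assoc _ (Γ.rCov k y), ← h3, ← mul_assoc, mul_assoc _ (Γ.rCov k _),
          ← symLift_ι (Γ.rCov k) hT.commute_cov (Γ.rep.dual w⁻¹ y), ← map_mul]
        exact hmem _ _ _
      · rw [Finset.sum_mul, Finset.sum_mul]
        refine Submodule.sum_mem _ fun s _ => ?_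
        rw [smul_mul_assoc, smul_mul_assoc, mul_assoc _ (Γ.rGrp k s.1), ← map_mul]
        exact Submodule.smul_mem _ _ (hmem _ _ _)
    · rw [← mul_assoc, ← mul_assoc, grp_mul_symLift hT.commute_vec hT.grp_vec,
        mul_assoc _ (Γ.rGrp k v), ← map_mul]
      exact hmem _ _ _
  exact ⟨htop ▸ (hP.mul hQ).mul hR⟩

end ReflectionGroup

/-! ### Operators on the coinvariant algebra -/

section Coinv

variable {W M : Type*} [Group W] [AddCommGroup M] [Module ℂ M]

theorem skewDer_congr_add {r : M →ₗ[ℂ] M} {μ μ' μ'' : M →ₗ[ℂ] ℂ} (h : SkewCompatible r μ)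
    (h' : SkewCompatible r μ') (h'' : SkewCompatible r μ'') (hμ : μ'' = μ + μ')
    (f : SymmetricAlgebra ℂ M) : skewDer h'' f = skewDer h f + skewDer h' f := by
  induction f using SymmetricAlgebra.induction with
  | algebraMap c => simp
  | ι m => simp [hμ]
  | mul a b ha hb => rw [skewDer_mul, skewDer_mul, skewDer_mul, ha, hb]; ring
  | add a b ha hb => rw [map_add, map_add, map_add, ha, hb]; ring

theorem skewDer_congr_smul {r : M →ₗ[ℂ] M} {μ μ' : M →ₗ[ℂ] ℂ} (h : SkewCompatible r μ)
    (h' : SkewCompatible r μ') (c : ℂ) (hμ : μ' = c • μ)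
    (f : SymmetricAlgebra ℂ M) : skewDer h' f = c • skewDer h f := by
  induction f using SymmetricAlgebra.induction with
  | algebraMap c => simp
  | ι m => simp [hμ, Algebra.smul_def]
  | mul a b ha hb => rw [skewDer_mul, skewDer_mul, ha, hb]; simp only [Algebra.smul_def]; ring
  | add a b ha hb => rw [map_add, map_add, ha, hb, smul_add]

variable (ρ : Representation ℂ W M)

/-- The action of a group element on the coinvariant algebra. -/
def coinvAct (w : W) : Coinv ρ →ₗ[ℂ] Coinv ρ :=
  coinvLift ρ ((coinvMk ρ).comp (symAct ρ w)).toLinearMap fun _ hf =>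
    (coinvMk_eq_zero_iff ρ).2 (symAct_mem_posIdeal ρ w hf)

theorem coinvAct_mk (w : W) (f : SymmetricAlgebra ℂ M) :
    coinvAct ρ w (coinvMk ρ f) =
      coinvMk ρ (symAct ρ w f) := rfl

/-- The representation of `W` on the coinvariant algebra. -/
def coinvRep : Representation ℂ W (Coinv ρ) where
  toFun := coinvAct ρ
  map_one' := by
    refine LinearMap.ext fun x => ?_
    obtain ⟨f, rfl⟩ := coinvMk_surjective _ x
    rw [coinvAct_mk, symAct_one_apply, Module.End.one_apply]
  map_mul' g h := by
    refine LinearMap.ext fun x => ?_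
    obtain ⟨f, rfl⟩ := coinvMk_surjective _ x
    rw [coinvAct_mk, Module.End.mul_apply, coinvAct_mk, coinvAct_mk, symAct_mul_apply]

theorem coinvRep_mk (w : W) (f : SymmetricAlgebra ℂ M) :
    coinvRep ρ w (coinvMk ρ f) = coinvMk ρ (symAct ρ w f) := rfl

variable {ρ} [FiniteDimensional ℂ M]

/-- The generators are invariant and hence killed. The Leibniz rule with twist on the ideal element
handles multiples, since the ideal is W-stable. -/
theorem skewDer_mem_posIdeal {s : W} (hs : IsReflection ρ s) (y : Module.Dual ℂ M)
    {f : SymmetricAlgebra ℂ M} (hf : f ∈ posIdeal ρ) :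
    skewDer (hs.skewCompatible y) f ∈ posIdeal ρ := by
  induction hf using Submodule.span_induction with
  | mem f hf =>
    obtain ⟨x, hx⟩ := hs.exists_ne
    rw [skewDer_eq_zero _ hx (hf.1 s)]
    exact Ideal.zero_mem _
  | zero => rw [map_zero]; exact Ideal.zero_mem _
  | add f g _ _ hf hg => rw [map_add]; exact Ideal.add_mem _ hf hg
  | smul c f hf hf' =>
    rw [smul_eq_mul, skewDer_mul']
    exact Ideal.add_mem _ (Ideal.mul_mem_left _ _ hf')
      (Ideal.mul_mem_left _ _ (symAct_mem_posIdeal ρ s hf))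

/-- The skew derivation of the coinvariant algebra attached to a reflection and a functional. -/
def coinvDer {s : W} (hs : IsReflection ρ s) (y : Module.Dual ℂ M) : Coinv ρ →ₗ[ℂ] Coinv ρ :=
  coinvLift ρ ((coinvMk ρ).toLinearMap ∘ₗ skewDer (hs.skewCompatible y))
    fun _ hf => (coinvMk_eq_zero_iff ρ).2 (skewDer_mem_posIdeal hs y hf)

theorem coinvDer_mk {s : W} (hs : IsReflection ρ s) (y : Module.Dual ℂ M)
    (f : SymmetricAlgebra ℂ M) : coinvDer hs y (coinvMk ρ f) =
      coinvMk ρ (skewDer (hs.skewCompatible y) f) := rfl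

theorem coinvDer_add {s : W} (hs : IsReflection ρ s) (y y' : Module.Dual ℂ M) :
    coinvDer hs (y + y') = coinvDer hs y + coinvDer hs y' := by
  refine LinearMap.ext fun x => ?_
  obtain ⟨f, rfl⟩ := coinvMk_surjective _ x
  rw [LinearMap.add_apply, coinvDer_mk, coinvDer_mk, coinvDer_mk, ← map_add,
    skewDer_congr_add (hs.skewCompatible y) (hs.skewCompatible y') _ (LinearMap.add_comp _ _ _)]

theorem coinvDer_smul {s : W} (hs : IsReflection ρ s) (c : ℂ) (y : Module.Dual ℂ M) :
    coinvDer hs (c • y) = c • coinvDer hs y := by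
  refine LinearMap.ext fun x => ?_
  obtain ⟨f, rfl⟩ := coinvMk_surjective _ x
  rw [LinearMap.smul_apply, coinvDer_mk, coinvDer_mk, ← map_smul,
    skewDer_congr_smul (hs.skewCompatible y) _ c (LinearMap.smul_comp _ _ _)]

theorem coinv_tensor_ext {U E : Type*} [AddCommGroup U] [Module ℂ U] [AddCommGroup E] [Module ℂ E]
    {F F' : Coinv ρ ⊗[ℂ] U →ₗ[ℂ] E}
    (h : ∀ f u, F (coinvMk ρ f ⊗ₜ u) = F' (coinvMk ρ f ⊗ₜ u)) : F = F' := by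
  refine TensorProduct.ext' fun x u => ?_
  obtain ⟨f, rfl⟩ := coinvMk_surjective _ x
  exact h f u

end Coinv

namespace ReflectionGroup

variable {W V : Type*} [Group W] [Finite W] [AddCommGroup V] [Module ℂ V] [FiniteDimensional ℂ V]
  (Γ : ReflectionGroup W V) (k : Γ.Parameter) {U : Type*} [AddCommGroup U] [Module ℂ U]
  (σ : Representation ℂ W U)

/-! ### Dunkl operators at `t = 0` -/

/-- Multiplication by symmetric algebra elements on `S(V)^co ⊗ U`. -/
def coinvMul : SymmetricAlgebra ℂ V →ₐ[ℂ] Module.End ℂ (Coinv Γ.rep ⊗[ℂ] U) :=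
  ((Module.End.rTensorAlgHom ℂ (Coinv Γ.rep) U).comp (Algebra.lmul ℂ (Coinv Γ.rep))).comp
    (coinvMk Γ.rep)

theorem coinvMul_apply (g f : SymmetricAlgebra ℂ V) (u : U) :
    Γ.coinvMul g (coinvMk Γ.rep f ⊗ₜ u) =
      coinvMk Γ.rep (g * f) ⊗ₜ[ℂ] u := rfl

/-- The Dunkl operators on `S(V)^co ⊗ U`. -/
def dunkl : Module.Dual ℂ V →ₗ[ℂ] Module.End ℂ (Coinv Γ.rep ⊗[ℂ] U) where
  toFun y := ∑ s : Γ.Refl, (-Γ.reflCoeff k s) • TensorProduct.map (coinvDer s.2 y) (σ s.1)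
  map_add' y y' := by
    rw [← Finset.sum_add_distrib]
    refine Finset.sum_congr rfl fun s _ => ?_
    rw [coinvDer_add, TensorProduct.map_add_left, smul_add]
  map_smul' c y := by
    rw [RingHom.id_apply, Finset.smul_sum]
    refine Finset.sum_congr rfl fun s _ => ?_
    rw [coinvDer_smul, TensorProduct.map_smul_left, smul_comm]

theorem dunkl_apply (y : Module.Dual ℂ V) (f : SymmetricAlgebra ℂ V) (u : U) :
    Γ.dunkl k σ y (coinvMk Γ.rep f ⊗ₜ u) =
      ∑ s : Γ.Refl, (-Γ.reflCoeff k s) • (coinvMk Γ.rep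
        (skewDer (s.2.skewCompatible y) f) ⊗ₜ[ℂ] σ s.1 u) := by
  simp only [dunkl, LinearMap.coe_mk, AddHom.coe_mk, LinearMap.sum_apply,
    LinearMap.smul_apply, TensorProduct.map_tmul, coinvDer_mk]

theorem symAct_skewDer (g : W) (s : Γ.Refl) (y : Module.Dual ℂ V) (f : SymmetricAlgebra ℂ V) :
    symAct Γ.rep g (skewDer (s.2.skewCompatible y) f) =
      skewDer ((Γ.conjRefl g s).2.skewCompatible (Γ.rep.dual g y)) (symAct Γ.rep g f) := by
  induction f using SymmetricAlgebra.induction with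
  | algebraMap c => simp
  | ι x =>
    rw [skewDer_ι, symAct_ι, skewDer_ι, AlgHom.commutes]
    congr 1
    change y (x - Γ.rep s.1 x) =
      y (Γ.rep g⁻¹ (Γ.rep g x - Γ.rep (g * s.1 * g⁻¹) (Γ.rep g x)))
    rw [map_sub, rep_mul_apply, rep_mul_apply, rep_inv_apply, map_sub, rep_inv_apply,
      rep_inv_apply, map_sub]
  | mul a b ha hb =>
    rw [skewDer_mul, map_add, map_mul, map_mul, ha, hb, map_mul, skewDer_mul]
    congr 2
    change symAct Γ.rep g (symAct Γ.rep s.1 a) =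
      symAct Γ.rep (g * s.1 * g⁻¹) (symAct Γ.rep g a)
    rw [← symAct_mul_apply, ← symAct_mul_apply, inv_mul_cancel_right]
  | add a b ha hb => rw [map_add, map_add, ha, hb, map_add, map_add]

theorem tprod_apply_mk (g : W) (f : SymmetricAlgebra ℂ V) (u : U) :
    (coinvRep Γ.rep).tprod σ g (coinvMk Γ.rep f ⊗ₜ u) =
      coinvMk Γ.rep (symAct Γ.rep g f) ⊗ₜ[ℂ] σ g u := rfl

/-- Conjugation by g permutes the terms of the Dunkl operator, whose coefficients are conjugation
invariant. -/
theorem tprod_mul_dunkl (g : W) (y : Module.Dual ℂ V) :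
    (coinvRep Γ.rep).tprod σ g * Γ.dunkl k σ y =
      Γ.dunkl k σ (Γ.rep.dual g y) * (coinvRep Γ.rep).tprod σ g := by
  refine coinv_tensor_ext fun f u => ?_
  rw [Module.End.mul_apply, Module.End.mul_apply, dunkl_apply, tprod_apply_mk, dunkl_apply,
    map_sum]
  refine Eq.trans ?_ ((Γ.conjReflEquiv g).sum_comp _)
  refine Finset.sum_congr rfl fun s _ => ?_
  rw [map_smul, tprod_apply_mk, symAct_skewDer]
  change _ = (-Γ.reflCoeff k (Γ.conjRefl g s)) • (coinvMk Γ.rep _) ⊗ₜ[ℂ] σ (g * s.1 * g⁻¹) (σ g u)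
  rw [reflCoeff_conjRefl, ← Module.End.mul_apply, ← Module.End.mul_apply, ← map_mul, ← map_mul,
    inv_mul_cancel_right]
  rfl

theorem coinvMul_mul_dunkl_sub (x : V) (y : Module.Dual ℂ V) :
    Γ.coinvMul (SymmetricAlgebra.ι ℂ V x) * Γ.dunkl k σ y -
        Γ.dunkl k σ y * Γ.coinvMul (SymmetricAlgebra.ι ℂ V x) =
      ∑ s : Γ.Refl, (Γ.reflCoeff k s * y (x - Γ.rep s.1 x)) • (coinvRep Γ.rep).tprod σ s.1 := by
  refine coinv_tensor_ext fun f u => ?_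
  rw [LinearMap.sub_apply, Module.End.mul_apply, Module.End.mul_apply, dunkl_apply, coinvMul_apply,
    dunkl_apply, map_sum, LinearMap.sum_apply, ← Finset.sum_sub_distrib]
  refine Finset.sum_congr rfl fun s _ => ?_
  rw [map_smul, coinvMul_apply]
  refine (smul_sub (M := ℂ) (A := Coinv Γ.rep ⊗[ℂ] U) _ _ _).symm.trans ?_
  rw [← TensorProduct.sub_tmul, ← map_sub, skewDer_mul', sub_add_cancel_left, skewDer_ι, map_neg,
    TensorProduct.neg_tmul, smul_neg, neg_smul, neg_neg, LinearMap.smul_apply, tprod_apply_mk,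
    mul_smul]
  congr 1

/-- The commutator of operators satisfying the commutation relations of `H_{0,k}` commutes with the
image of `V`. -/
theorem commute_commutator {A : Type*} [Ring A] [Algebra ℂ A]
    {X : V →ₗ[ℂ] A} {Y : Module.Dual ℂ V →ₗ[ℂ] A} {G : W →* A}
    (hGY : ∀ g y, G g * Y y = Y (Γ.rep.dual g y) * G g)
    (hXY : ∀ x y, X x * Y y - Y y * X x =
      ∑ s : Γ.Refl, (Γ.reflCoeff k s * y (x - Γ.rep s.1 x)) • G s.1)
    (x : V) (y y' : Module.Dual ℂ V) :
    X x * (Y y * Y y' - Y y' * Y y) = (Y y * Y y' - Y y' * Y y) * X x := by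
  have hdual : ∀ (s : Γ.Refl) (y y' : Module.Dual ℂ V),
      y (x - Γ.rep s.1 x) • (Γ.rep.dual s.1 y' - y') =
        y' (x - Γ.rep s.1 x) • (Γ.rep.dual s.1 y - y) := by
    intro s y y'
    have := Γ.dual_skewCompatible s x y y'
    rw [← neg_sub y', ← neg_sub y, smul_neg, smul_neg]
    exact congrArg Neg.neg this
  -- By the Jacobi identity, [x, [y, y']] is the difference of [[x, y], y'] and the same with y and
  -- y' exchanged. The formula here, together with `hdual`, shows the double commutator to be
  -- symmetric in y and y'.
  have key : ∀ y y' : Module.Dual ℂ V,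
      (X x * Y y - Y y * X x) * Y y' - Y y' * (X x * Y y - Y y * X x) =
        ∑ s : Γ.Refl, Γ.reflCoeff k s •
          (Y (y (x - Γ.rep s.1 x) • (Γ.rep.dual s.1 y' - y')) * G s.1) := by
    intro y y'
    rw [hXY, Finset.sum_mul, Finset.mul_sum, ← Finset.sum_sub_distrib]
    refine Finset.sum_congr rfl fun s _ => ?_
    rw [smul_mul_assoc, mul_smul_comm, ← smul_sub, hGY, ← sub_mul, ← map_sub, map_smul,
      smul_mul_assoc, smul_smul]
  have h := (key y y').trans ((Finset.sum_congr rfl fun s _ => by rw [hdual s y y']).trans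
    (key y' y).symm)
  rw [← sub_eq_zero] at h ⊢
  rw [← h]
  noncomm_ring

/-- The elements 1 ⊗ u generate the module over S(V). This reduces commutativity of Dunkl operators,
and the vanishing of positive invariants, to a check on 1 ⊗ u. -/
theorem coinv_tensor_eq_zero {F : Module.End ℂ (Coinv Γ.rep ⊗[ℂ] U)}
    (hF : ∀ x, Commute (Γ.coinvMul (SymmetricAlgebra.ι ℂ V x)) F)
    (h1 : ∀ u : U, F (coinvMk Γ.rep 1 ⊗ₜ u) = 0) : F = 0 := by
  have hF' : ∀ f, Commute (Γ.coinvMul f) F := by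
    intro f
    induction f using SymmetricAlgebra.induction with
    | algebraMap c => rw [AlgHom.commutes]; exact Algebra.commute_algebraMap_left c F
    | ι x => exact hF x
    | mul a b ha hb => rw [map_mul]; exact ha.mul_left hb
    | add a b ha hb => rw [map_add]; exact ha.add_left hb
  refine coinv_tensor_ext fun f u => ?_
  have h2 := DFunLike.congr_fun (hF' f).eq (coinvMk Γ.rep 1 ⊗ₜ u)
  rw [Module.End.mul_apply, Module.End.mul_apply, coinvMul_apply, mul_one, h1, map_zero] at h2
  exact h2.symm

theorem dunkl_one (y : Module.Dual ℂ V) (u : U) :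
    Γ.dunkl k σ y (coinvMk Γ.rep 1 ⊗ₜ u) = 0 := by
  rw [dunkl_apply, Finset.sum_eq_zero]
  intro s _
  rw [← map_one (algebraMap ℂ (SymmetricAlgebra ℂ V)), skewDer_algebraMap, map_zero,
    TensorProduct.zero_tmul, smul_zero]

theorem isCherednikTriple_dunkl :
    Γ.IsCherednikTriple k (A := Module.End ℂ (Coinv Γ.rep ⊗[ℂ] U)) (Γ.coinvMul.toLinearMap ∘ₗ SymmetricAlgebra.ι ℂ V) (Γ.dunkl k σ)
      ((coinvRep Γ.rep).tprod σ) where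
  commute_vec x x' := (Commute.all (SymmetricAlgebra.ι ℂ V x) (SymmetricAlgebra.ι ℂ V x')).map
    Γ.coinvMul
  commute_cov y y' := by
    rw [commute_iff_eq, ← sub_eq_zero]
    refine Γ.coinv_tensor_eq_zero (fun x => ?_) fun u => ?_
    · exact Γ.commute_commutator k (A := Module.End ℂ (Coinv Γ.rep ⊗[ℂ] U))
        (X := Γ.coinvMul.toLinearMap ∘ₗ SymmetricAlgebra.ι ℂ V)
        (Γ.tprod_mul_dunkl k σ) (Γ.coinvMul_mul_dunkl_sub k σ) x y y'
    · rw [LinearMap.sub_apply, Module.End.mul_apply, Module.End.mul_apply, dunkl_one, dunkl_one,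
        map_zero, map_zero, sub_zero]
  grp_vec g x := by
    refine coinv_tensor_ext fun f u => ?_
    rw [Module.End.mul_apply, Module.End.mul_apply, LinearMap.comp_apply, LinearMap.comp_apply,
      AlgHom.toLinearMap_apply, AlgHom.toLinearMap_apply, coinvMul_apply, tprod_apply_mk, tprod_apply_mk, coinvMul_apply, map_mul, symAct_ι]
  grp_cov := Γ.tprod_mul_dunkl k σ
  vec_cov := Γ.coinvMul_mul_dunkl_sub k σ

theorem symLift_coinvMul (f : SymmetricAlgebra ℂ V) :
    symLift _ (Γ.isCherednikTriple_dunkl k σ).commute_vec f = Γ.coinvMul f := by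
  induction f using SymmetricAlgebra.induction with
  | algebraMap c => simp only [AlgHom.commutes]
  | ι x => rw [symLift_ι]; rfl
  | mul a b ha hb => rw [map_mul, map_mul, ha, hb]
  | add a b ha hb => rw [map_add, map_add, ha, hb]

theorem exists_dunkl_hom :
    ∃ φ : Γ.Restricted k →ₐ[ℂ] Module.End ℂ (Coinv Γ.rep ⊗[ℂ] U),
      (∀ x, φ (Γ.rVec k x) = Γ.coinvMul (SymmetricAlgebra.ι ℂ V x)) ∧
      (∀ y, φ (Γ.rCov k y) = Γ.dunkl k σ y) ∧
      ∀ g, φ (Γ.rGrp k g) = (coinvRep Γ.rep).tprod σ g := by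
  have hT := Γ.isCherednikTriple_dunkl k σ
  refine Γ.exists_restricted_hom k hT (fun f hf => ?_) fun f hf => ?_
  · rw [Γ.symLift_coinvMul k σ]
    refine coinv_tensor_ext fun g u => ?_
    rw [coinvMul_apply, (coinvMk_eq_zero_iff _).2
      (Ideal.mul_mem_right g _ (Ideal.subset_span hf : f ∈ posIdeal Γ.rep)),
      TensorProduct.zero_tmul, LinearMap.zero_apply]
  · refine Γ.coinv_tensor_eq_zero (fun x => hT.commute_symCov hf.1 x) fun u => ?_
    -- Dunkl operators kill 1 ⊗ u, so S(V*) acts on it through the constant term.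
    have hone : ∀ f, symLift (A := Module.End ℂ (Coinv Γ.rep ⊗[ℂ] U)) (Γ.dunkl k σ) hT.commute_cov f (coinvMk Γ.rep 1 ⊗ₜ[ℂ] u) =
        SymmetricAlgebra.algebraMapInv f • (coinvMk Γ.rep 1 ⊗ₜ[ℂ] u) := by
      intro f
      induction f using SymmetricAlgebra.induction with
      | algebraMap c =>
        rw [AlgHom.commutes, AlgHom.commutes]; rfl
      | ι y => rw [symLift_ι, dunkl_one, SymmetricAlgebra.algebraMapInv_ι, zero_smul]
      | mul a b ha hb =>
        rw [map_mul, Module.End.mul_apply, hb, map_smul, ha, smul_smul, map_mul, mul_comm]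
      | add a b ha hb => rw [map_add, LinearMap.add_apply, ha, hb, map_add, add_smul]
    rw [hone, hf.2, zero_smul]

end ReflectionGroup

namespace ReflectionGroup

variable {W V : Type*} [Group W] [Finite W] [AddCommGroup V] [Module ℂ V] [FiniteDimensional ℂ V]
  (Γ : ReflectionGroup W V) (k : Γ.Parameter) {U : Type*} [AddCommGroup U] [Module ℂ U]
  (σ : Representation ℂ W U)

/-! ### Verma modules -/

/-- The canonical map from `U` to its Verma module. -/
def vermaMk : U →ₗ[ℂ] Γ.Verma k σ where
  toFun u := (Γ.vermaRel k σ).mkQ (1 ⊗ₜ u)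
  map_add' u u' := by rw [TensorProduct.tmul_add, map_add]
  map_smul' c u := by rw [TensorProduct.tmul_smul, LinearMap.map_smul_of_tower, RingHom.id_apply]

theorem smul_vermaMk (h : Γ.Restricted k) (u : U) :
    h • Γ.vermaMk k σ u = (Γ.vermaRel k σ).mkQ (h ⊗ₜ u) := by
  change h • (Γ.vermaRel k σ).mkQ (1 ⊗ₜ u) = _
  rw [← map_smul, TensorProduct.smul_tmul', smul_eq_mul, mul_one]

theorem rGrp_smul_vermaMk (g : W) (u : U) :
    Γ.rGrp k g • Γ.vermaMk k σ u = Γ.vermaMk k σ (σ g u) := by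
  rw [smul_vermaMk, ← sub_eq_zero]
  change (Γ.vermaRel k σ).mkQ _ - (Γ.vermaRel k σ).mkQ _ = 0
  rw [← map_sub, ← LinearMap.mem_ker, Submodule.ker_mkQ]
  refine Submodule.subset_span (Or.inl ⟨1, g, u, ?_⟩)
  rw [one_mul]; rfl

theorem rCov_smul_vermaMk (y : Module.Dual ℂ V) (u : U) :
    Γ.rCov k y • Γ.vermaMk k σ u = 0 := by
  rw [smul_vermaMk, ← LinearMap.mem_ker, Submodule.ker_mkQ]
  refine Submodule.subset_span (Or.inr ⟨1, y, u, ?_⟩)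
  rw [one_mul]; rfl

/-- The universal property of Verma modules. -/
theorem exists_verma_hom {E : Type*} [AddCommGroup E] [Module ℂ E] [Module (Γ.Restricted k) E]
    [IsScalarTower ℂ (Γ.Restricted k) E] (φ : U →ₗ[ℂ] E)
    (hG : ∀ g u, Γ.rGrp k g • φ u = φ (σ g u)) (hY : ∀ y u, Γ.rCov k y • φ u = 0) :
    ∃ F : Γ.Verma k σ →ₗ[Γ.Restricted k] E, ∀ u, F (Γ.vermaMk k σ u) = φ u := by
  let F₀ : Γ.Restricted k ⊗[ℂ] U →ₗ[Γ.Restricted k] E :=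
    TensorProduct.AlgebraTensorModule.lift
      { toFun := fun h => (Algebra.lsmul ℂ ℂ E h).comp φ
        map_add' := fun h h' => by rw [map_add]; rfl
        map_smul' := fun h h' => by
          rw [smul_eq_mul, map_mul]; rfl }
  have hF₀ : ∀ h u, F₀ (h ⊗ₜ u) = h • φ u := fun h u => rfl
  have hle : Γ.vermaRel k σ ≤ LinearMap.ker F₀ := by
    refine Submodule.span_le.2 ?_
    rintro _ (⟨h, w, u, rfl⟩ | ⟨h, y, u, rfl⟩)
    · rw [SetLike.mem_coe, LinearMap.mem_ker, map_sub, hF₀, hF₀, mul_smul, sub_eq_zero]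
      exact congrArg (h • ·) (hG w u)
    · rw [SetLike.mem_coe, LinearMap.mem_ker, hF₀, mul_smul]
      exact (congrArg (h • ·) (hY y u)).trans (smul_zero h)
  refine ⟨(Γ.vermaRel k σ).liftQ F₀ hle, fun u => ?_⟩
  change (Γ.vermaRel k σ).liftQ F₀ hle ((Γ.vermaRel k σ).mkQ (1 ⊗ₜ u)) = _
  rw [Submodule.mkQ_apply, Submodule.liftQ_apply, hF₀, one_smul]

/-- The subspace S(V) · N is stable under all generators: a covector moved past S(V) leaves terms in
S(V) · W and then kills N. -/
theorem symCov_smul_eq {E : Type*} [AddCommGroup E] [Module ℂ E] [Module (Γ.Restricted k) E]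
    [IsScalarTower ℂ (Γ.Restricted k) E] {N : Submodule ℂ E}
    (hG : ∀ g, ∀ n ∈ N, Γ.rGrp k g • n ∈ N) (hY : ∀ y, ∀ n ∈ N, Γ.rCov k y • n = 0)
    (a : Γ.Restricted k) {n : E} (hn : n ∈ N) :
    a • n ∈ Submodule.span ℂ {m | ∃ f, ∃ n ∈ N,
      m = symLift (Γ.rVec k) (Γ.isCherednikTriple_restricted k).commute_vec f • n} := by
  have hT := Γ.isCherednikTriple_restricted k
  set P := Submodule.span ℂ {m | ∃ f, ∃ n ∈ N, m = symLift (Γ.rVec k) hT.commute_vec f • n}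
  have hmem : ∀ f, ∀ n ∈ N, symLift (Γ.rVec k) hT.commute_vec f • n ∈ P :=
    fun f n hn => Submodule.subset_span ⟨f, n, hn, rfl⟩
  have hind : ∀ z : Γ.Restricted k,
      (∀ f, ∀ n ∈ N, z • symLift (Γ.rVec k) hT.commute_vec f • n ∈ P) → ∀ m ∈ P, z • m ∈ P := by
    intro z hz m hm
    induction hm using Submodule.span_induction with
    | mem m hm => obtain ⟨f, n, hn, rfl⟩ := hm; exact hz f n hn
    | zero => rw [smul_zero]; exact zero_mem _
    | add m m' _ _ hm hm' => rw [smul_add]; exact add_mem hm hm'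
    | smul c m _ hm => rw [smul_comm]; exact Submodule.smul_mem _ c hm
  refine Γ.smul_mem_of_stable k P (fun x => hind _ fun f n hn => ?_)
    (fun y => hind _ fun f n hn => ?_) (fun g => hind _ fun f n hn => ?_) a ?_
  · rw [smul_smul, ← symLift_ι (Γ.rVec k) hT.commute_vec x, ← map_mul]
    exact hmem _ n hn
  · have h2 := hT.symVec_mul_sub_mul f y
    rw [sub_eq_iff_eq_add, ← sub_eq_iff_eq_add'] at h2
    rw [smul_smul, ← h2, sub_smul, mul_smul, hY y n hn, smul_zero, zero_sub, Finset.sum_smul]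
    refine neg_mem (Submodule.sum_mem _ fun s _ => ?_)
    rw [smul_assoc, mul_smul]
    exact Submodule.smul_mem _ _ (hmem _ _ (hG _ n hn))
  · rw [smul_smul, grp_mul_symLift hT.commute_vec hT.grp_vec, mul_smul]
    exact hmem _ _ (hG g n hn)
  · have := hmem 1 n hn
    rwa [map_one, one_smul] at this

theorem exists_coinv_equiv_verma :
    ∃ e : (Coinv Γ.rep ⊗[ℂ] U) ≃ₗ[ℂ] Γ.Verma k σ,
      (∀ f u, e (coinvMk Γ.rep f ⊗ₜ u) =
        symLift (Γ.rVec k) (Γ.isCherednikTriple_restricted k).commute_vec f • Γ.vermaMk k σ u) ∧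
      ∀ g z, e ((coinvRep Γ.rep).tprod σ g z) = Γ.rGrp k g • e z := by
  have hT := Γ.isCherednikTriple_restricted k
  let η₀ : Coinv Γ.rep →ₗ[ℂ] U →ₗ[ℂ] Γ.Verma k σ := coinvLift Γ.rep
    { toFun := fun f => (Algebra.lsmul ℂ ℂ (Γ.Verma k σ)
        (symLift (Γ.rVec k) hT.commute_vec f)).comp (Γ.vermaMk k σ)
      map_add' := fun f g => by rw [map_add, map_add, LinearMap.add_comp]
      map_smul' := fun c f => by rw [map_smul, map_smul, LinearMap.smul_comp, RingHom.id_apply] }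
    fun f hf => by
      change (Algebra.lsmul ℂ ℂ (Γ.Verma k σ) (symLift (Γ.rVec k) hT.commute_vec f)).comp
        (Γ.vermaMk k σ) = 0
      rw [Γ.symLift_rVec_eq_zero k hf, map_zero, LinearMap.zero_comp]
  let η : Coinv Γ.rep ⊗[ℂ] U →ₗ[ℂ] Γ.Verma k σ := TensorProduct.lift η₀
  have hη : ∀ f u, η (coinvMk Γ.rep f ⊗ₜ u) =
      symLift (Γ.rVec k) hT.commute_vec f • Γ.vermaMk k σ u := fun f u => rfl
  have hsurj : Function.Surjective η := by
    intro m
    obtain ⟨z, rfl⟩ := (Γ.vermaRel k σ).mkQ_surjective m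
    induction z using TensorProduct.induction_on with
    | zero => exact ⟨0, by rw [map_zero, map_zero]⟩
    | add z z' hz hz' =>
      obtain ⟨a, ha⟩ := hz
      obtain ⟨b, hb⟩ := hz'
      exact ⟨a + b, by rw [map_add, map_add, ha, hb]⟩
    | tmul h u =>
      rw [← smul_vermaMk]
      have h1 := Γ.symCov_smul_eq k (N := LinearMap.range (Γ.vermaMk k σ))
        (by rintro g _ ⟨u, rfl⟩; exact ⟨σ g u, (Γ.rGrp_smul_vermaMk k σ g u).symm⟩)
        (by rintro y _ ⟨u, rfl⟩; exact Γ.rCov_smul_vermaMk k σ y u) h ⟨u, rfl⟩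
      have h2 : h • Γ.vermaMk k σ u ∈ LinearMap.range η := by
        refine Submodule.span_le.2 ?_ h1
        rintro _ ⟨f, _, ⟨u, rfl⟩, rfl⟩
        exact ⟨_, hη f u⟩
      exact h2
  -- The Dunkl action makes S(V)^co ⊗ U a module in which 1 ⊗ U satisfies the Verma relations. The
  -- resulting map out of the Verma module is a left inverse of η.
  have hinj : Function.Injective η := by
    obtain ⟨φ, hφX, hφY, hφG⟩ := Γ.exists_dunkl_hom k σ
    let : Module (Γ.Restricted k) (Coinv Γ.rep ⊗[ℂ] U) := Module.compHom _ φ.toRingHom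
    have hsmul : ∀ (a : Γ.Restricted k) (z : Coinv Γ.rep ⊗[ℂ] U), a • z = φ a z :=
      fun a z => rfl
    have : IsScalarTower ℂ (Γ.Restricted k) (Coinv Γ.rep ⊗[ℂ] U) := ⟨fun c a z => by
      rw [hsmul, hsmul, map_smul]; rfl⟩
    obtain ⟨F, hF⟩ := Γ.exists_verma_hom k σ
      ((TensorProduct.mk ℂ (Coinv Γ.rep) U) (coinvMk Γ.rep 1))
      (fun g u => by
        rw [hsmul, hφG, TensorProduct.mk_apply, tprod_apply_mk, map_one]; rfl)
      (fun y u => by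
        rw [hsmul, hφY]
        exact Γ.dunkl_one k σ y u)
    refine Function.LeftInverse.injective (g := F) fun z => ?_
    induction z using TensorProduct.induction_on with
    | zero => rw [map_zero, map_zero]
    | add z z' hz hz' => rw [map_add, map_add, hz, hz']
    | tmul x u =>
      obtain ⟨f, rfl⟩ := coinvMk_surjective _ x
      rw [hη, map_smul, hF, hsmul, map_symLift hT.commute_vec
        (Γ.isCherednikTriple_dunkl k σ).commute_vec φ hφX, Γ.symLift_coinvMul k σ]
      rw [TensorProduct.mk_apply, coinvMul_apply, mul_one]
  refine ⟨LinearEquiv.ofBijective η ⟨hinj, hsurj⟩, hη, fun g z => ?_⟩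
  induction z using TensorProduct.induction_on with
  | zero => simp
  | add z z' hz hz' => rw [map_add, map_add, hz, hz', map_add, smul_add]
  | tmul x u =>
    obtain ⟨f, rfl⟩ := coinvMk_surjective _ x
    rw [tprod_apply_mk]
    change η _ = _ • η _
    rw [hη, hη, smul_smul, grp_mul_symLift hT.commute_vec hT.grp_vec, mul_smul, rGrp_smul_vermaMk]

instance [FiniteDimensional ℂ U] : FiniteDimensional ℂ (Γ.Verma k σ) := by
  obtain ⟨e, -⟩ := Γ.exists_coinv_equiv_verma k σ
  exact e.finiteDimensional

/-- Non-trivial group elements have trace zero on Verma modules. -/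
theorem trace_verma [FiniteDimensional ℂ U] {w : W} (hw : w ≠ 1) :
    LinearMap.trace ℂ (Γ.Verma k σ) (Algebra.lsmul ℂ ℂ _ (Γ.rGrp k w)) = 0 := by
  obtain ⟨e, -, he⟩ := Γ.exists_coinv_equiv_verma k σ
  have h1 : Algebra.lsmul ℂ ℂ (Γ.Verma k σ) (Γ.rGrp k w) =
      e.conj ((coinvRep Γ.rep).tprod σ w) := by
    refine LinearMap.ext fun z => ?_
    rw [LinearEquiv.conj_apply_apply, he, LinearEquiv.apply_symm_apply, Algebra.lsmul_coe]
  have h2 : LinearMap.trace ℂ _ (coinvRep Γ.rep w) = 0 :=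
    trace_coinv_eq_zero Γ.rep Γ.faithful Γ.generated hw _ fun f => coinvRep_mk Γ.rep w f
  rw [h1, LinearMap.trace_conj']
  change LinearMap.trace ℂ _ (TensorProduct.map (coinvRep Γ.rep w) (σ w)) = 0
  rw [LinearMap.trace_tensorProduct', h2, zero_mul]

/-- The augmentation of the coinvariant algebra. -/
def coinvAug {W M : Type*} [Group W] [AddCommGroup M] [Module ℂ M] (ρ : Representation ℂ W M) :
    Coinv ρ →ₗ[ℂ] ℂ :=
  coinvLift ρ (SymmetricAlgebra.algebraMapInv (R := ℂ) (M := M)).toLinearMap fun f hf => by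
    rw [AlgHom.toLinearMap_apply]
    exact algebraMapInv_eq_zero_of_mem_augIdeal (posIdeal_le_augIdeal _ hf)

theorem coinvAug_mk {W M : Type*} [Group W] [AddCommGroup M] [Module ℂ M]
    (ρ : Representation ℂ W M) (f : SymmetricAlgebra ℂ M) :
    coinvAug ρ (coinvMk ρ f) = SymmetricAlgebra.algebraMapInv f := rfl

/-- The projection of `S(V)^co ⊗ U` to its degree zero part. -/
def coinvProj : Coinv Γ.rep ⊗[ℂ] U →ₗ[ℂ] U :=
  (TensorProduct.lid ℂ U).toLinearMap ∘ₗ LinearMap.rTensor U (coinvAug Γ.rep)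

theorem coinvProj_apply (f : SymmetricAlgebra ℂ V) (u : U) :
    Γ.coinvProj (coinvMk Γ.rep f ⊗ₜ u) = SymmetricAlgebra.algebraMapInv f • u := by
  rw [coinvProj, LinearMap.comp_apply, LinearMap.rTensor_tmul, coinvAug_mk,
    LinearEquiv.coe_coe, TensorProduct.lid_tmul]

theorem coinvMul_sub_mem (n : ℕ) {f : SymmetricAlgebra ℂ V} (hf : f ∈ augIdeal V ^ n)
    (z : Coinv Γ.rep ⊗[ℂ] U) :
    Γ.coinvMul f z - coinvMk Γ.rep f ⊗ₜ Γ.coinvProj z ∈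
      Submodule.span ℂ {z | ∃ g ∈ augIdeal V ^ (n + 1), ∃ u : U, z = coinvMk Γ.rep g ⊗ₜ[ℂ] u} := by
  induction z using TensorProduct.induction_on with
  | zero => simp
  | add z z' hz hz' =>
    rw [map_add, map_add, TensorProduct.tmul_add, add_sub_add_comm]
    exact add_mem hz hz'
  | tmul x u =>
    obtain ⟨g, rfl⟩ := coinvMk_surjective _ x
    refine Submodule.subset_span ⟨f * (g - algebraMap ℂ _ (SymmetricAlgebra.algebraMapInv g)),
      ?_, u, ?_⟩
    · rw [pow_succ]
      exact Ideal.mul_mem_mul hf (sub_algebraMapInv_mem_augIdeal g)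
    · rw [coinvMul_apply, coinvProj_apply, ← TensorProduct.smul_tmul, ← TensorProduct.sub_tmul,
        ← map_smul, ← map_sub, mul_sub, Algebra.smul_def, mul_comm f (algebraMap _ _ _)]

/-- A Nakayama argument: modulo higher powers of the augmentation ideal, f · z is f ⊗ (degree-zero
part of z), and a high power of that ideal vanishes in the coinvariants. -/
theorem eq_top_of_coinvProj_surjective (N : Submodule ℂ (Coinv Γ.rep ⊗[ℂ] U))
    (hN : ∀ f, ∀ z ∈ N, Γ.coinvMul f z ∈ N) (hsurj : ∀ u, ∃ z ∈ N, Γ.coinvProj z = u) :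
    N = ⊤ := by
  obtain ⟨m, hm⟩ := exists_augIdeal_pow_le_posIdeal Γ.rep
  -- Descending induction on n, with j bounding the distance to the exponent m at which the powers
  -- vanish.
  have key : ∀ j n, m ≤ n + j → ∀ f ∈ augIdeal V ^ n, ∀ u : U,
      coinvMk Γ.rep f ⊗ₜ[ℂ] u ∈ N := by
    intro j
    induction j with
    | zero =>
      intro n hn f hf u
      rw [(coinvMk_eq_zero_iff _).2 (hm (Ideal.pow_le_pow_right hn hf)), TensorProduct.zero_tmul]
      exact zero_mem _
    | succ j ih =>
      intro n hn f hf u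
      obtain ⟨z, hz, rfl⟩ := hsurj u
      have h1 : Γ.coinvMul f z - coinvMk Γ.rep f ⊗ₜ Γ.coinvProj z ∈ N := by
        refine Submodule.span_le.2 ?_ (Γ.coinvMul_sub_mem n hf z)
        rintro _ ⟨g, hg, u, rfl⟩
        exact ih (n + 1) (by omega) g hg u
      have := sub_mem (hN f z hz) h1
      rwa [sub_sub_cancel] at this
  rw [eq_top_iff]
  rintro z -
  induction z using TensorProduct.induction_on with
  | zero => exact zero_mem _
  | add z z' hz hz' => exact add_mem hz hz'
  | tmul x u =>
    obtain ⟨f, rfl⟩ := coinvMk_surjective _ x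
    exact key m 0 (by omega) f (by rw [pow_zero, Ideal.one_eq_top]; trivial) u

/-- The Verma module of an irreducible representation has a largest proper submodule. -/
theorem exists_coatom_verma [hσ : σ.IsIrreducible] :
    ∃ K : Submodule (Γ.Restricted k) (Γ.Verma k σ), IsCoatom K ∧ ∀ N, N ≠ ⊤ → N ≤ K := by
  have hT := Γ.isCherednikTriple_restricted k
  obtain ⟨e, he, heG⟩ := Γ.exists_coinv_equiv_verma k σ
  have heX : ∀ f z, e (Γ.coinvMul f z) = symLift (Γ.rVec k) hT.commute_vec f • e z := by
    intro f z
    induction z using TensorProduct.induction_on with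
    | zero => simp
    | add z z' hz hz' => rw [map_add, map_add, hz, hz', map_add, smul_add]
    | tmul x u =>
      obtain ⟨g, rfl⟩ := coinvMk_surjective _ x
      rw [coinvMul_apply, he, he, map_mul, mul_smul]
  have hprojG : ∀ g (z : Coinv Γ.rep ⊗[ℂ] U),
      Γ.coinvProj ((coinvRep Γ.rep).tprod σ g z) = σ g (Γ.coinvProj z) := by
    intro g z
    induction z using TensorProduct.induction_on with
    | zero => simp
    | add z z' hz hz' => rw [map_add, map_add, hz, hz', map_add, map_add]
    | tmul x u =>
      obtain ⟨f, rfl⟩ := coinvMk_surjective _ x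
      rw [tprod_apply_mk, coinvProj_apply, coinvProj_apply,
        SymmetricAlgebra.algebraMapInv_symAct, map_smul]
  -- The degree-zero image of N is W-stable, so by irreducibility it is 0 or U. In the second case N
  -- is everything. Vanishing of this projection is preserved by sums, so the sum K of all proper
  -- submodules is still proper.
  have hproper : ∀ N : Submodule (Γ.Restricted k) (Γ.Verma k σ), N ≠ ⊤ →
      ∀ n ∈ N, Γ.coinvProj (e.symm n) = 0 := by
    intro N hN
    let N' : Submodule ℂ (Coinv Γ.rep ⊗[ℂ] U) := (N.restrictScalars ℂ).comap e.toLinearMap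
    let P : Subrepresentation σ :=
      { toSubmodule := N'.map Γ.coinvProj
        apply_mem_toSubmodule := by
          rintro g _ ⟨z, hz, rfl⟩
          refine ⟨(coinvRep Γ.rep).tprod σ g z, ?_, hprojG g z⟩
          change e _ ∈ N
          rw [heG]
          exact N.smul_mem _ hz }
    rcases eq_bot_or_eq_top P with hP | hP
    · intro n hn
      have h1 : Γ.coinvProj (e.symm n) ∈ P.toSubmodule := ⟨e.symm n, by
        change e (e.symm n) ∈ N
        rwa [e.apply_symm_apply], rfl⟩
      rw [hP] at h1
      exact (Submodule.mem_bot ℂ).1 h1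
    · refine absurd ?_ hN
      have h1 : N' = ⊤ := by
        refine Γ.eq_top_of_coinvProj_surjective N' (fun f z hz => ?_) fun u => ?_
        · change e _ ∈ N
          rw [heX]
          exact N.smul_mem _ hz
        · have h2 : u ∈ P.toSubmodule := by
            rw [hP]
            exact Submodule.mem_top
          exact h2
      rw [eq_top_iff]
      rintro m -
      have h2 : e.symm m ∈ N' := by rw [h1]; trivial
      have h3 : e (e.symm m) ∈ N := h2
      rwa [e.apply_symm_apply] at h3
  have hU : ∃ u : U, u ≠ 0 := by
    by_contra! h
    refine (bot_ne_top : (⊥ : Subrepresentation σ) ≠ ⊤) (SetLike.ext fun u => ?_)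
    rw [h u]
    exact iff_of_true (zero_mem (⊥ : Submodule ℂ U)) (zero_mem (⊤ : Submodule ℂ U))
  let K : Submodule (Γ.Restricted k) (Γ.Verma k σ) :=
    ⨆ N : {N : Submodule (Γ.Restricted k) (Γ.Verma k σ) // N ≠ ⊤}, N.1
  have hK : ∀ n ∈ K, Γ.coinvProj (e.symm n) = 0 := by
    intro n hn
    induction hn using Submodule.iSup_induction' with
    | mem N n hn => exact hproper N.1 N.2 n hn
    | zero => rw [map_zero, map_zero]
    | add n n' _ _ hn hn' => rw [map_add, map_add, hn, hn', add_zero]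
  have hle : ∀ N, N ≠ ⊤ → N ≤ K := fun N hN =>
    le_iSup (fun N : {N : Submodule (Γ.Restricted k) (Γ.Verma k σ) // N ≠ ⊤} => N.1) ⟨N, hN⟩
  refine ⟨K, ⟨fun hK' => ?_, fun N hN => ?_⟩, hle⟩
  · obtain ⟨u, hu⟩ := hU
    have h1 := hK (e (coinvMk Γ.rep 1 ⊗ₜ u)) (by rw [hK']; trivial)
    rw [e.symm_apply_apply, coinvProj_apply, map_one, one_smul] at h1
    exact hu h1
  · by_contra hN'
    exact hN.not_ge (hle N hN')

/-- The radical of the Verma module of an irreducible representation is its largest proper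
submodule. -/
theorem isCoatom_jacobson_verma [σ.IsIrreducible] :
    IsCoatom (Module.jacobson (Γ.Restricted k) (Γ.Verma k σ)) ∧
      ∀ N : Submodule (Γ.Restricted k) (Γ.Verma k σ), N ≠ ⊤ →
        N ≤ Module.jacobson (Γ.Restricted k) (Γ.Verma k σ) := by
  obtain ⟨K, hK, hmax⟩ := Γ.exists_coatom_verma k σ
  have : Module.jacobson (Γ.Restricted k) (Γ.Verma k σ) = K := by
    refine le_antisymm (sInf_le hK) (le_sInf fun N hN => ?_)
    rcases hN.le_iff.1 (hmax N hN.1) with h | h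
    · exact absurd h hK.1
    · exact h.le
  rw [this]
  exact ⟨hK, hmax⟩

instance [σ.IsIrreducible] : IsSimpleModule (Γ.Restricted k) (Γ.VermaHead k σ) :=
  isSimpleModule_iff_isCoatom.2 (Γ.isCoatom_jacobson_verma k σ).1

end ReflectionGroup

/-! ### Finite-dimensional modules -/

section FiniteDimensionalModules

variable {A : Type*} [Ring A] [Algebra ℂ A]

theorem finiteDimensional_quotient {N : Type*} [AddCommGroup N] [Module ℂ N] [Module A N]
    [IsScalarTower ℂ A N] [FiniteDimensional ℂ N] (E : Submodule A N) :
    FiniteDimensional ℂ (N ⧸ E) :=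
  Module.Finite.of_surjective (E.mkQ.restrictScalars ℂ) E.mkQ_surjective

/-- N is split linearly as E plus a complement. Cyclicity of the trace then isolates the two
diagonal blocks. -/
theorem trace_lsmul_eq_add {N : Type*} [AddCommGroup N] [Module ℂ N] [Module A N]
    [IsScalarTower ℂ A N] [FiniteDimensional ℂ N] (E : Submodule A N) (a : A) :
    LinearMap.trace ℂ N (Algebra.lsmul ℂ ℂ N a) =
      LinearMap.trace ℂ E (Algebra.lsmul ℂ ℂ E a) +
        LinearMap.trace ℂ (N ⧸ E) (Algebra.lsmul ℂ ℂ (N ⧸ E) a) := by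
  let i : E →ₗ[ℂ] N := E.subtype.restrictScalars ℂ
  let q : N →ₗ[ℂ] N ⧸ E := E.mkQ.restrictScalars ℂ
  have : FiniteDimensional ℂ E := FiniteDimensional.of_injective i Subtype.val_injective
  have : FiniteDimensional ℂ (N ⧸ E) := finiteDimensional_quotient E
  have hi : LinearMap.ker i = ⊥ := LinearMap.ker_eq_bot.2 Subtype.val_injective
  have hq : LinearMap.range q = ⊤ := LinearMap.range_eq_top.2 E.mkQ_surjective
  obtain ⟨p, hp⟩ := LinearMap.exists_leftInverse_of_injective i hi
  obtain ⟨t, ht⟩ := LinearMap.exists_rightInverse_of_surjective q hq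
  have hp' : ∀ e, p (i e) = e := fun e => DFunLike.congr_fun hp e
  have ht' : ∀ e, q (t e) = e := fun e => DFunLike.congr_fun ht e
  have hqi : ∀ e, q (i e) = 0 := fun e => (Submodule.Quotient.mk_eq_zero E).2 e.2
  -- Removing the E-component of the section t places it in the kernel of p, so that i ∘ p + s ∘ q
  -- is the identity.
  let s : N ⧸ E →ₗ[ℂ] N := t - i ∘ₗ p ∘ₗ t
  have hs : ∀ e, q (s e) = e := fun e => by
    change q (t e - i (p (t e))) = e
    rw [map_sub, hqi, sub_zero, ht']
  have hsum : ∀ n, i (p n) + s (q n) = n := by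
    intro n
    have h1 : n - t (q n) ∈ E := by
      rw [← Submodule.Quotient.mk_eq_zero E]
      change q (n - t (q n)) = 0
      rw [map_sub, ht', sub_self]
    have h2 := hp' ⟨_, h1⟩
    have h3 : i (p (n - t (q n))) = n - t (q n) := congrArg i h2
    change i (p n) + (t (q n) - i (p (t (q n)))) = n
    rw [map_sub, map_sub, sub_eq_sub_iff_add_eq_add] at h3
    rw [add_sub_left_comm, add_sub_assoc', sub_eq_iff_eq_add, add_comm, h3]
  let f := Algebra.lsmul ℂ ℂ N a
  have h1 : (Algebra.lsmul ℂ ℂ N a : N →ₗ[ℂ] N) = (f ∘ₗ i) ∘ₗ p + (f ∘ₗ s) ∘ₗ q := by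
    refine LinearMap.ext fun n => ?_
    change a • n = a • i (p n) + a • s (q n)
    rw [← smul_add, hsum]
  have h2 : p ∘ₗ (f ∘ₗ i) = Algebra.lsmul ℂ ℂ E a := by
    refine LinearMap.ext fun e => ?_
    exact hp' (a • e)
  have h3 : q ∘ₗ (f ∘ₗ s) = Algebra.lsmul ℂ ℂ (N ⧸ E) a := by
    refine LinearMap.ext fun e => ?_
    change E.mkQ (a • s e) = a • e
    rw [map_smul]
    exact congrArg (a • ·) (hs e)
  rw [h1, map_add, LinearMap.trace_comp_comm', LinearMap.trace_comp_comm' q, h2, h3]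

theorem trace_lsmul_congr {N N' : Type*} [AddCommGroup N] [Module ℂ N] [Module A N]
    [IsScalarTower ℂ A N] [AddCommGroup N'] [Module ℂ N'] [Module A N'] [IsScalarTower ℂ A N']
    (e : N ≃ₗ[A] N') (a : A) :
    LinearMap.trace ℂ N (Algebra.lsmul ℂ ℂ N a) =
      LinearMap.trace ℂ N' (Algebra.lsmul ℂ ℂ N' a) := by
  rw [← LinearMap.trace_conj' _ (e.restrictScalars ℂ)]
  congr 1
  refine LinearMap.ext fun n => ?_
  change e (a • e.symm n) = a • n
  rw [map_smul, e.apply_symm_apply]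

universe u

/-- If all simple modules on which `b` acts as the identity are isomorphic to `L`, then the trace
of an element on such a module is a multiple of its trace on `L`. -/
theorem exists_trace_eq_mul {L : Type*} [AddCommGroup L] [Module ℂ L] [Module A L]
    [IsScalarTower ℂ A L] (b : A)
    (hL : ∀ (E : Type u) [AddCommGroup E] [Module ℂ E] [Module A E] [IsScalarTower ℂ A E]
      [FiniteDimensional ℂ E] [IsSimpleModule A E], (∀ m : E, b • m = m) → Nonempty (E ≃ₗ[A] L))
    (N : Type u) [AddCommGroup N] [Module ℂ N] [Module A N] [IsScalarTower ℂ A N]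
    [FiniteDimensional ℂ N] (hN : ∀ m : N, b • m = m) :
    ∃ n : ℕ, ∀ a : A, LinearMap.trace ℂ N (Algebra.lsmul ℂ ℂ N a) =
      n * LinearMap.trace ℂ L (Algebra.lsmul ℂ ℂ L a) := by
  induction hd : Module.finrank ℂ N using Nat.strong_induction_on generalizing N with
  | _ d ih =>
  rcases subsingleton_or_nontrivial N with hsub | hnt
  · refine ⟨0, fun a => ?_⟩
    rw [Subsingleton.elim (Algebra.lsmul ℂ ℂ N a : N →ₗ[ℂ] N) 0, map_zero, Nat.cast_zero, zero_mul]
  · have : IsArtinian A N := isArtinian_of_tower ℂ inferInstance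
    obtain ⟨E, hE⟩ := IsAtomic.exists_atom (Submodule A N)
    have : IsSimpleModule A E := isSimpleModule_iff_isAtom.2 hE
    have : FiniteDimensional ℂ E :=
      FiniteDimensional.of_injective (E.subtype.restrictScalars ℂ) Subtype.val_injective
    have : FiniteDimensional ℂ (N ⧸ E) := finiteDimensional_quotient E
    obtain ⟨e⟩ := hL E fun m => Subtype.ext (hN m)
    have hlt : Module.finrank ℂ (N ⧸ E) < d := by
      have h1 := Submodule.finrank_quotient_add_finrank (E.restrictScalars ℂ)
      have h2 : 0 < Module.finrank ℂ (E.restrictScalars ℂ) := by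
        have : Nontrivial E := IsSimpleModule.nontrivial A E
        exact Module.finrank_pos (R := ℂ) (M := E)
      have h3 : Module.finrank ℂ (N ⧸ E) = Module.finrank ℂ (N ⧸ E.restrictScalars ℂ) := rfl
      omega
    obtain ⟨n, hn⟩ := ih _ hlt (N ⧸ E) (fun m => by
      obtain ⟨m, rfl⟩ := E.mkQ_surjective m
      rw [← map_smul, hN]) rfl
    refine ⟨1 + n, fun a => ?_⟩
    rw [trace_lsmul_eq_add E, hn, trace_lsmul_congr e]
    push_cast
    ring

/-- The submodule of vectors fixed by a central element. -/
def centralFixed (L : Type*) [AddCommGroup L] [Module A L] {c : A} (hc : c ∈ Subring.center A) :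
    Submodule A L where
  carrier := {m | c • m = m}
  add_mem' {m m'} hm hm' := (smul_add c m m').trans (congrArg₂ (· + ·) hm hm')
  zero_mem' := smul_zero c
  smul_mem' a m hm := by
    change c • a • m = a • m
    rw [smul_smul, ← Subring.mem_center_iff.1 hc a, mul_smul]
    exact congrArg (a • ·) hm

/-- A central idempotent acting as the identity on the simple head of a module with a largest
proper submodule acts as the identity on the whole module. -/
theorem smul_eq_self_of_quotient {M : Type*} [AddCommGroup M] [Module A M] {K : Submodule A M}
    (hK : K ≠ ⊤) (hmax : ∀ N : Submodule A M, N ≠ ⊤ → N ≤ K) {c : A}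
    (hc : c ∈ Subring.center A) (hidem : IsIdempotentElem c) (h : ∀ m : M ⧸ K, c • m = m) (m : M) :
    c • m = m := by
  have htop : centralFixed M hc = ⊤ := by
    by_contra hN
    refine hK (eq_top_iff.2 fun m _ => ?_)
    -- Modulo K, m equals c • m, and c • m lies in the fixed submodule, which is contained in K if
    -- it is proper.
    rw [← Submodule.ker_mkQ K, LinearMap.mem_ker, ← h (K.mkQ m), ← map_smul, ← LinearMap.mem_ker,
      Submodule.ker_mkQ]
    refine hmax _ hN ?_
    change c • c • m = c • m
    rw [smul_smul, hidem.eq]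
  have : m ∈ centralFixed M hc := by rw [htop]; trivial
  exact this

theorem smul_eq_self_or_eq_zero {L : Type*} [AddCommGroup L] [Module A L] [IsSimpleModule A L]
    {c : A} (hc : c ∈ Subring.center A) (hidem : IsIdempotentElem c) :
    (∀ m : L, c • m = m) ∨ ∀ m : L, c • m = 0 := by
  have hmem : ∀ m, m ∈ centralFixed L hc ↔ c • m = m := fun m => Iff.rfl
  rcases eq_bot_or_eq_top (centralFixed L hc) with h | h
  · refine Or.inr fun m => ?_
    rw [← Submodule.mem_bot A, ← h, hmem, smul_smul, hidem.eq]
  · refine Or.inl fun m => ?_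
    rw [← hmem, h]
    trivial

/-- Every simple module of a finite-dimensional algebra belongs to a block. -/
theorem exists_isBlockIdempotent [FiniteDimensional ℂ A] (L : Type*) [AddCommGroup L] [Module A L]
    [IsSimpleModule A L] : ∃ b : A, IsBlockIdempotent b ∧ ∀ m : L, b • m = m := by
  -- The block idempotent is a central idempotent c acting as the identity on L with dim cA minimal.
  -- For a central idempotent c below b, one of c and b - c acts as the identity on L and so equals
  -- b by minimality.
  let d : A → ℕ := fun c => Module.finrank ℂ (LinearMap.range (LinearMap.mulLeft ℂ c))
  have hex : ∃ n, ∃ c ∈ Subring.center A, IsIdempotentElem c ∧ (∀ m : L, c • m = m) ∧ d c = n :=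
    ⟨_, 1, Subring.one_mem _, IsIdempotentElem.one, one_smul A, rfl⟩
  classical
  obtain ⟨b, hbc, hbi, hbL, hbd⟩ := Nat.find_spec hex
  have hmin : ∀ c ∈ Subring.center A, IsIdempotentElem c → (∀ m : L, c • m = m) → d b ≤ d c :=
    fun c h1 h2 h3 => hbd ▸ Nat.find_min' hex ⟨c, h1, h2, h3, rfl⟩
  have key : ∀ c ∈ Subring.center A, IsIdempotentElem c → (∀ m : L, c • m = m) → b * c = c →
      c * b = b := by
    intro c h1 h2 h3 h4
    have hle : LinearMap.range (LinearMap.mulLeft ℂ c) ≤ LinearMap.range (LinearMap.mulLeft ℂ b) := by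
      rintro _ ⟨x, rfl⟩
      exact ⟨c * x, by rw [LinearMap.mulLeft_apply, LinearMap.mulLeft_apply, ← mul_assoc, h4]⟩
    have heq := Submodule.eq_of_le_of_finrank_le hle (hmin c h1 h2 h3)
    have hb : b ∈ LinearMap.range (LinearMap.mulLeft ℂ c) := by
      rw [heq]
      exact ⟨1, by rw [LinearMap.mulLeft_apply, mul_one]⟩
    obtain ⟨x, hx⟩ := hb
    rw [LinearMap.mulLeft_apply] at hx
    rw [← hx, ← mul_assoc, h2.eq]
  refine ⟨b, ⟨hbc, hbi, ?_, fun c hc hci hbc' => ?_⟩, hbL⟩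
  · rintro rfl
    have : Nontrivial L := IsSimpleModule.nontrivial A L
    obtain ⟨m, hm⟩ := exists_ne (0 : L)
    exact hm (by rw [← hbL m, zero_smul])
  · have hcb : c * b = c := by rw [Subring.mem_center_iff.1 hbc c, hbc']
    rcases smul_eq_self_or_eq_zero (L := L) hc hci with h | h
    · refine Or.inr ?_
      rw [← hcb]
      exact key c hc hci h hbc'
    · refine Or.inl ?_
      have h1 : IsIdempotentElem (b - c) := by
        change (b - c) * (b - c) = b - c
        rw [mul_sub, sub_mul, sub_mul, hbi.eq, hci.eq, hcb, hbc']
        abel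
      have h2 := key (b - c) (Subring.sub_mem _ hbc hc) h1
        (fun m => by rw [sub_smul, hbL, h, sub_zero]) (by rw [mul_sub, hbi.eq, hbc'])
      rw [sub_mul, hbi.eq, hcb, sub_eq_self] at h2
      exact h2

end FiniteDimensionalModules

/-! ### Irreducible subrepresentations -/

section Representations

variable {W : Type*} [Group W]

theorem exists_ne_zero_of_isIrreducible {U : Type*} [AddCommGroup U] [Module ℂ U]
    (σ : Representation ℂ W U) [σ.IsIrreducible] : ∃ u : U, u ≠ 0 := by
  by_contra! h
  refine (bot_ne_top : (⊥ : Subrepresentation σ) ≠ ⊤) (SetLike.ext fun u => ?_)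
  rw [h u]
  exact iff_of_true (zero_mem (⊥ : Submodule ℂ U)) (zero_mem (⊤ : Submodule ℂ U))

/-- A non-zero finite-dimensional stable subspace contains an irreducible one. -/
theorem exists_irreducible_embedding {E : Type*} [AddCommGroup E] [Module ℂ E]
    [FiniteDimensional ℂ E] (τ : Representation ℂ W E) (E₀ : Submodule ℂ E) (h₀ : E₀ ≠ ⊥)
    (hstab : ∀ g, ∀ e ∈ E₀, τ g e ∈ E₀) :
    ∃ (n : ℕ) (σ : Representation ℂ W (Fin n → ℂ)) (j : (Fin n → ℂ) →ₗ[ℂ] E),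
      σ.IsIrreducible ∧ Function.Injective j ∧ (∀ v, j v ∈ E₀) ∧ ∀ g v, j (σ g v) = τ g (j v) := by
  have hex : ∃ n, ∃ P : Submodule ℂ E, P ≠ ⊥ ∧ (∀ g, ∀ e ∈ P, τ g e ∈ P) ∧ P ≤ E₀ ∧
      Module.finrank ℂ P = n := ⟨_, E₀, h₀, hstab, le_rfl, rfl⟩
  classical
  obtain ⟨P, hP, hPs, hP₀, hPd⟩ := Nat.find_spec hex
  have hmin : ∀ Q : Submodule ℂ E, Q ≠ ⊥ → (∀ g, ∀ e ∈ Q, τ g e ∈ Q) → Q ≤ P → Q = P := by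
    intro Q h1 h2 h3
    refine Submodule.eq_of_le_of_finrank_le h3 ?_
    rw [hPd]
    exact Nat.find_min' hex ⟨Q, h1, h2, h3.trans hP₀, rfl⟩
  let e : P ≃ₗ[ℂ] (Fin (Module.finrank ℂ P) → ℂ) := (Module.finBasis ℂ P).equivFun
  let τP : Representation ℂ W P :=
    { toFun := fun g => (τ g).restrict (hPs g)
      map_one' := by ext x; simp
      map_mul' := fun g h => by ext x; simp }
  let σ : Representation ℂ W (Fin (Module.finrank ℂ P) → ℂ) :=
    { toFun := fun g => e.conj (τP g)
      map_one' := by rw [map_one]; exact e.conj_id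
      map_mul' := fun g h => by rw [map_mul]; exact e.conj_comp _ _ }
  let j := P.subtype ∘ₗ e.symm.toLinearMap
  have hj : Function.Injective j := Subtype.val_injective.comp e.symm.injective
  have hjσ : ∀ g v, j (σ g v) = τ g (j v) := by
    intro g v
    change ((e.symm (e.conj (τP g) v) : P) : E) = _
    rw [LinearEquiv.conj_apply_apply, e.symm_apply_apply]
    rfl
  have hrange : LinearMap.range j = P := by
    refine le_antisymm ?_ fun x hx => ⟨e ⟨x, hx⟩, ?_⟩
    · rintro _ ⟨v, rfl⟩
      exact (e.symm v).2
    · change ((e.symm (e ⟨x, hx⟩) : P) : E) = x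
      rw [e.symm_apply_apply]
  refine ⟨_, σ, j, ?_, hj, fun v => hP₀ (e.symm v).2, hjσ⟩
  have hdich : ∀ Q : Subrepresentation σ, Q.toSubmodule = ⊥ ∨ Q.toSubmodule = ⊤ := by
    intro Q
    by_cases hQ : Q.toSubmodule = ⊥
    · exact Or.inl hQ
    · refine Or.inr ?_
      have h1 := hmin (Q.toSubmodule.map j) (fun h => hQ (Submodule.map_injective_of_injective hj (h.trans (Submodule.map_bot j).symm))) (by
        rintro g _ ⟨v, hv, rfl⟩
        exact ⟨σ g v, Q.apply_mem_toSubmodule g hv, hjσ g v⟩) (by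
        rintro _ ⟨v, -, rfl⟩
        exact (e.symm v).2)
      exact Submodule.map_injective_of_injective hj
        (h1.trans (hrange.symm.trans (LinearMap.range_eq_map j)))
  have hnt : (⊥ : Subrepresentation σ) ≠ ⊤ := by
    intro h
    have h1 : (⊥ : Submodule ℂ (Fin (Module.finrank ℂ P) → ℂ)) = ⊤ :=
      congrArg Subrepresentation.toSubmodule h
    refine hP ?_
    exact hrange.symm.trans ((LinearMap.range_eq_map j).trans
      ((congrArg (Submodule.map j) h1.symm).trans (Submodule.map_bot j)))
  exact
    { exists_pair_ne := ⟨⊥, ⊤, hnt⟩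
      eq_bot_or_eq_top := fun Q => (hdich Q).imp
        (fun h => Subrepresentation.toSubmodule_injective h)
        (fun h => Subrepresentation.toSubmodule_injective h) }

/-- Irreducible representations with the same character are isomorphic. -/
theorem nonempty_equiv_of_character_eq [Finite W] {U U' : Type*} [AddCommGroup U] [Module ℂ U]
    [FiniteDimensional ℂ U] [AddCommGroup U'] [Module ℂ U'] [FiniteDimensional ℂ U']
    (σ : Representation ℂ W U) (σ' : Representation ℂ W U') [σ.IsIrreducible] [σ'.IsIrreducible]
    (h : σ.character = σ'.character) : Nonempty (σ.Equiv σ') := by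
  classical
  let := Fintype.ofFinite W
  have : Invertible (Nat.card W : ℂ) := invertibleOfNonzero (by exact_mod_cast Nat.card_pos.ne')
  have h1 := Representation.char_orthonormal σ' σ
  have h2 := Representation.char_orthonormal σ' σ'
  rw [if_pos ⟨Representation.Equiv.refl σ'⟩] at h2
  rw [h, h2] at h1
  by_contra hne
  rw [if_neg hne] at h1
  exact one_ne_zero h1

/-- If all non-trivial group elements have trace zero, then the order of the group divides the
dimension. -/
theorem card_dvd_finrank [Finite W] {E : Type*} [AddCommGroup E] [Module ℂ E]
    [FiniteDimensional ℂ E] (τ : Representation ℂ W E)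
    (h : ∀ w ≠ 1, LinearMap.trace ℂ E (τ w) = 0) : Nat.card W ∣ Module.finrank ℂ E := by
  let := Fintype.ofFinite W
  have hne : (Nat.card W : ℂ) ≠ 0 := by exact_mod_cast Nat.card_pos.ne'
  have : Invertible (Nat.card W : ℂ) := invertibleOfNonzero hne
  have h1 := τ.card_inv_mul_sum_char_eq_finrank
  have h' : ∀ w, w ≠ 1 → τ.character w = 0 := h
  rw [Finset.sum_eq_single 1 (fun w _ hw => h' w hw) (fun h => absurd (Finset.mem_univ _) h),
    Representation.char_one, inv_mul_eq_iff_eq_mul₀ hne] at h1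
  exact ⟨_, by exact_mod_cast h1⟩

end Representations

namespace ReflectionGroup

variable {W V : Type*} [Group W] [Finite W] [AddCommGroup V] [Module ℂ V] [FiniteDimensional ℂ V]
  (Γ : ReflectionGroup W V) (k : Γ.Parameter)

/-! ### Simple modules of the restricted rational Cherednik algebra -/

/-- The action of `W` on a module over the restricted rational Cherednik algebra. -/
def modRep (E : Type*) [AddCommGroup E] [Module ℂ E] [Module (Γ.Restricted k) E]
    [IsScalarTower ℂ (Γ.Restricted k) E] : Representation ℂ W E :=
  ((Algebra.lsmul ℂ ℂ E : Γ.Restricted k →ₐ[ℂ] Module.End ℂ E) : Γ.Restricted k →* _).comp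
    (Γ.rGrp k)

theorem modRep_apply {E : Type*} [AddCommGroup E] [Module ℂ E] [Module (Γ.Restricted k) E]
    [IsScalarTower ℂ (Γ.Restricted k) E] (w : W) (e : E) : Γ.modRep k E w e = Γ.rGrp k w • e := rfl

/-- The subspace of vectors killed by `V^*`. -/
def covKer (E : Type*) [AddCommGroup E] [Module ℂ E] [Module (Γ.Restricted k) E]
    [IsScalarTower ℂ (Γ.Restricted k) E] : Submodule ℂ E where
  carrier := {e | ∀ y, Γ.rCov k y • e = 0}
  add_mem' {e e'} he he' y := by rw [smul_add, he, he', add_zero]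
  zero_mem' y := smul_zero _
  smul_mem' c e he y := by rw [smul_comm, he, smul_zero]

/-- V* acts nilpotently through the coinvariants. With n + 1 the least power of the augmentation
ideal killing e ≠ 0, some f in the n-th power has f • e ≠ 0, and V* kills this vector. -/
theorem covKer_ne_bot (E : Type*) [AddCommGroup E] [Module ℂ E] [Module (Γ.Restricted k) E]
    [IsScalarTower ℂ (Γ.Restricted k) E] [Nontrivial E] : Γ.covKer k E ≠ ⊥ := by
  have hT := Γ.isCherednikTriple_restricted k
  obtain ⟨m, hm⟩ := exists_augIdeal_pow_le_posIdeal Γ.rep.dual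
  obtain ⟨e, he⟩ := exists_ne (0 : E)
  have hex : ∃ n, ∀ f ∈ augIdeal (Module.Dual ℂ V) ^ n,
      symLift (Γ.rCov k) hT.commute_cov f • e = 0 := ⟨m, fun f hf => by
    rw [Γ.symLift_rCov_eq_zero k (hm hf), zero_smul]⟩
  classical
  have hspec := Nat.find_spec hex
  have hmin := fun n (hn : n < Nat.find hex) => Nat.find_min hex hn
  rcases hn : Nat.find hex with _ | n
  · rw [hn] at hspec
    refine absurd (hspec 1 (by rw [pow_zero, Ideal.one_eq_top]; trivial)) ?_
    rwa [map_one, one_smul]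
  · rw [hn] at hspec hmin
    have h1 := hmin n (Nat.lt_succ_self n)
    push Not at h1
    obtain ⟨f, hf, hfe⟩ := h1
    refine fun h => hfe ?_
    rw [← Submodule.mem_bot ℂ, ← h]
    intro y
    rw [← symLift_ι (Γ.rCov k) hT.commute_cov y, smul_smul, ← map_mul]
    refine hspec _ ?_
    rw [pow_succ']
    exact Ideal.mul_mem_mul (Ideal.subset_span ⟨y, rfl⟩) hf

/-- Every finite-dimensional simple module is the head of a Verma module. -/
theorem exists_equiv_L (E : Type*) [AddCommGroup E] [Module ℂ E] [Module (Γ.Restricted k) E]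
    [IsScalarTower ℂ (Γ.Restricted k) E] [FiniteDimensional ℂ E]
    [IsSimpleModule (Γ.Restricted k) E] :
    ∃ ψ : IrrChar W, Nonempty (E ≃ₗ[Γ.Restricted k] Γ.L k ψ) := by
  have hT := Γ.isCherednikTriple_restricted k
  have : Nontrivial E := IsSimpleModule.nontrivial (Γ.Restricted k) E
  obtain ⟨n, σ, j, hσ, hj, hjmem, hjσ⟩ := exists_irreducible_embedding (Γ.modRep k E)
    (Γ.covKer k E) (Γ.covKer_ne_bot k E) (fun g e he y => by
      have h1 := hT.grp_cov g (Γ.rep.dual g⁻¹ y)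
      rw [← Module.End.mul_apply, ← map_mul, mul_inv_cancel, map_one, Module.End.one_apply] at h1
      rw [modRep_apply, smul_smul, ← h1, mul_smul, he, smul_zero])
  let ψ : IrrChar W := ⟨σ.character, n, σ, hσ, rfl⟩
  have hψ := ψ.rep_irreducible
  obtain ⟨ε⟩ := nonempty_equiv_of_character_eq ψ.rep σ ψ.rep_character
  obtain ⟨F, hF⟩ := Γ.exists_verma_hom k ψ.rep (j ∘ₗ ε.toIntertwiningMap.toLinearMap)
    (fun g u => by
      rw [LinearMap.comp_apply, LinearMap.comp_apply, ← modRep_apply, ← hjσ]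
      exact congrArg j (Representation.IntertwiningMap.isIntertwining _ _ ε.toIntertwiningMap g u).symm)
    (fun y u => hjmem _ y)
  have hF0 : F ≠ 0 := by
    rintro rfl
    obtain ⟨u, hu⟩ := exists_ne_zero_of_isIrreducible ψ.rep
    refine hu (ε.toLinearEquiv.injective (hj ?_))
    rw [map_zero, map_zero]
    exact (hF u).symm
  have hsurj : Function.Surjective F := F.surjective_or_eq_zero.resolve_right hF0
  -- The image of F is simple, so its kernel is maximal, and the Verma module has only one maximal
  -- submodule.
  have hker : LinearMap.ker F = Module.jacobson (Γ.Restricted k) (Γ.Verma k ψ.rep) := by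
    obtain ⟨hco, hmax⟩ := Γ.isCoatom_jacobson_verma k ψ.rep
    have h1 : LinearMap.ker F ≠ ⊤ := fun h => hF0 (LinearMap.ker_eq_top.1 h)
    have h2 : IsCoatom (LinearMap.ker F) := by
      rw [← isSimpleModule_iff_isCoatom]
      exact IsSimpleModule.congr (F.quotKerEquivOfSurjective hsurj)
    rcases h2.le_iff.1 (hmax _ h1) with h | h
    · exact absurd h hco.1
    · exact h.symm
  exact ⟨ψ, ⟨(F.quotKerEquivOfSurjective hsurj).symm.trans (Submodule.quotEquivOfEq _ _ hker)⟩⟩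

instance (χ : IrrChar W) : IsSimpleModule (Γ.Restricted k) (Γ.L k χ) :=
  have := χ.rep_irreducible
  inferInstance

instance (χ : IrrChar W) : FiniteDimensional ℂ (Γ.L k χ) :=
  finiteDimensional_quotient (A := Γ.Restricted k) _

/-- If the block of `L_k(χ)` contains no other irreducible character, then all non-trivial group
elements have trace zero on `L_k(χ)`. -/
theorem trace_L_eq_zero {b : Γ.Restricted k} (hb : IsBlockIdempotent b) {χ : IrrChar W}
    (hχ : χ ∈ Γ.blockFamily k b) (hF : (Γ.blockFamily k b).Subsingleton) {w : W} (hw : w ≠ 1) :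
    LinearMap.trace ℂ (Γ.L k χ) (Γ.modRep k (Γ.L k χ) w) = 0 := by
  have := χ.rep_irreducible
  have hntL : Nontrivial (Γ.L k χ) := IsSimpleModule.nontrivial (Γ.Restricted k) _
  obtain ⟨hco, hmax⟩ := Γ.isCoatom_jacobson_verma k χ.rep
  have hbM : ∀ m : Γ.Verma k χ.rep, b • m = m :=
    smul_eq_self_of_quotient hco.1 hmax hb.central hb.idem hχ
  -- A simple module on which b acts as the identity is the head of a Verma module in the same
  -- block, so it is L itself because the block contains only χ.
  obtain ⟨n, hn⟩ := exists_trace_eq_mul (L := Γ.L k χ) b (fun E _ _ _ _ _ _ hE => by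
    obtain ⟨ψ, ⟨e⟩⟩ := Γ.exists_equiv_L k E
    have hψ : ψ ∈ Γ.blockFamily k b := fun m => by
      rw [← e.apply_symm_apply m, ← map_smul, hE]
    obtain rfl : ψ = χ := hF hψ hχ
    exact ⟨e⟩) (Γ.Verma k χ.rep) hbM
  -- Comparing traces of 1, n = 0 would make the Verma module zero, although it surjects onto the
  -- non-zero L.
  have hn0 : (n : ℂ) ≠ 0 := by
    intro h0
    have h1 := hn 1
    rw [h0, zero_mul, map_one, LinearMap.trace_one] at h1
    have h2 : Module.finrank ℂ (Γ.Verma k χ.rep) = 0 := by exact_mod_cast h1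
    have := Module.finrank_zero_iff.1 h2
    exact not_subsingleton (Γ.L k χ) (Submodule.mkQ_surjective _).subsingleton
  have h1 := hn (Γ.rGrp k w)
  rw [Γ.trace_verma k χ.rep hw] at h1
  exact (mul_eq_zero.1 h1.symm).resolve_left hn0

end ReflectionGroup
end

theorem proposition2 {W V : Type*} [Group W] [Finite W] [AddCommGroup V] [Module ℂ V]
    [FiniteDimensional ℂ V] (Γ : ReflectionGroup W V) (k : Γ.Parameter) (χ : IrrChar W)
    (hdim : Module.finrank ℂ (Γ.L k χ) < Nat.card W) :
    ∃ F ∈ Γ.CM k, χ ∈ F ∧ F.Nontrivial := by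
  obtain ⟨b, hb, hbL⟩ := exists_isBlockIdempotent (A := Γ.Restricted k) (Γ.L k χ)
  refine ⟨Γ.blockFamily k b, ⟨b, hb, rfl⟩, hbL, ?_⟩
  by_contra hF
  rw [Set.not_nontrivial_iff] at hF
  have : Nontrivial (Γ.L k χ) := IsSimpleModule.nontrivial (Γ.Restricted k) _
  have hdvd := card_dvd_finrank (Γ.modRep k (Γ.L k χ)) fun w hw => Γ.trace_L_eq_zero k hb hbL hF hw
  exact absurd (Nat.le_of_dvd Module.finrank_pos hdvd) (not_le.2 hdim)
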